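/- \textbf{Setting.} Let $q\in\mathbb C$, $0<|q|<1$, with a fixed logarithm used to define $q^z$ for $z\in\mathbb C$. Let $U_q(sl(2))$ be the Hopf algebra generated by $e,f,q^{th}$ $(t\in\mathbb C)$ with $q^{0}=1$, $q^{sh}q^{th}=q^{(s+t)h}$, $q^{th}eq^{-th}=q^{2t}e$, $q^{th}fq^{-th}=q^{-2t}f$, $[e,f]=\frac{q^h-q^{-h}}{q-q^{-1}}$, and $\Delta(q^{th})=q^{th}\otimes q^{th}$, $\Delta(e)=e\otimes q^h+1\otimes e$, $\Delta(f)=f\otimes 1+q^{-h}\otimes f$. Representations are finite-dimensional and are direct sums of weight spaces $V[m]$, $m\in\mathbb Z$ (where $q^{th}=q^{tm}$). For a field $A\supset\mathbb C$, $(A\otimes U_q(sl(2))^{\otimes n})^c$ denotes the algebra of families $a_{V_1,\dots,V_n}\in A\otimes\mathrm{End}(V_1\otimes\cdots\otimes V_n)$, natural (hence additive) in the representations $V_i$; $\Delta(a)_{V,W}=a_{V\otimes W}$. Take $A=\mathbb C(\tilde\nu)$, and put $x=\nu=\tilde\nu^4$; the shift $a(xq^{h_2})$ substitutes $x\mapsto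 xq^m$ (i.e. $\tilde\nu\mapsto \tilde\nu q^{m/4}$) on the weight-$m$ part of the second factor. The superscripts $U_q(\mathfrak h)^c$, $(U_q^{\pm})^c$ denote elements acting by a scalar on each weight space, respectively strictly raising/lowering weights. Put $e_{q^{-1}}^{z}=\sum_{n\ge0}z^n/(n)_{q^{-1}}!$ with $(n)_{q^{-1}}=\frac{1-q^{-2n}}{1-q^{-2}}$, and $$K=q^{h\otimes h/2},\quad \widehat R=e_{q^{-1}}^{(q-q^{-1})e\otimes f},\quad R=K\widehat R,\quad B(x)=x^{h}q^{h^2/2}.$$ The \emph{standard solution} $F(x)$ is the unique $F\in 1\otimes1+(\mathbb C(x^2)\otimes U_q(sl(2))\otimes U_q^-(sl(2)))^c$ with $F_{12}(x)B_2(x)=\widehat R_{12}^{-1}B_2(x)F_{12}(x)$. An element $a$ is \emph{$\nu$-rational} if its coefficients are in $\mathbb C(\nu)$, and \emph{almost $\nu$-rational} if there is an invertible $b\in(\mathbb C(\tilde\nu)\otimes U_q(\mathfrak h))^c$ such that $b^{-1}a$ and $\Delta(b)\,b_2(x)^{-1}b_1(xq^{h_2})^{-1}$ are $\nu$-rational.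 With $J=1$, the \emph{strong dynamical coboundary problem} asks for an invertible almost $\nu$-rational $\mathcal M\in(\mathbb C(\tilde\nu)\otimes U_q(sl(2)))^c$ such that $$\mathcal F(x)=\Delta(\mathcal M(x))\,J\,\mathcal M_2(x)^{-1}\mathcal M_1(xq^{h_2})^{-1}$$ is invertible, of zero weight ($[\mathcal F,h\otimes1+1\otimes h]=0$), satisfies $(\Delta\otimes\mathrm{id})(\mathcal F(x))\mathcal F_{12}(xq^{h_3})=(\mathrm{id}\otimes\Delta)(\mathcal F(x))\mathcal F_{23}(x)$, is such that $\mathcal R(x)=\mathcal F_{21}(x)^{-1}R_{12}\mathcal F_{12}(x)$ satisfies $\mathcal R_{12}(x)B_2(x)=B_2(x)K_{12}^2\mathcal R_{21}(x)^{-1}$, and equals the standard solution $F(x)$. \textbf{Theorem ($U_q(sl(2))$ case).} Let $$\mathcal M^{(0)}(x)=1,\qquad \mathfrak C^{[+]}(x)=e_{q^{-1}}^{-xe},\qquad \mathfrak C^{[-]}(x)^{-1}=e_{q^{-1}}^{(xq^{h+1})^{-1}f},$$ and let $\tau$ be the extension to the completion of the algebra morphism $e\mapsto 0$ (that is, $\tau(a)=\varepsilon(a)1$).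 Then $\mathfrak C^{[\pm]}\in 1\oplus(\mathbb C(\nu)\otimes U_q^{\pm}(sl(2)))^c$, the products $$\mathcal M^{(+)}(x)=\prod_{k=1}^{\infty}\tau^{k-1}(\mathfrak C^{[+]}(x)),\qquad \mathcal M^{(-)}(x)=\prod_{k=1}^{\infty}\big(B(x)^{-k}\mathfrak C^{[-]}(x)B(x)^k\big)^{-1}$$ (factors ordered from left to right by increasing $k$) converge, in each representation for all sufficiently small nonzero values of $\tilde\nu$, to elements $\mathcal M^{(\pm)}\in 1\oplus(\mathbb C(\nu)\otimes U_q^{\pm}(sl(2)))^c$, and $$\mathcal M(x)=\mathcal M^{(0)}(x)\,\mathcal M^{(-)}(x)^{-1}\,\mathcal M^{(+)}(x)$$ is a solution of the strong dynamical coboundary problem. -/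

import Mathlib

open scoped TensorProduct

noncomputable section

namespace DynCoboundary

/-! ### The deformation parameter -/

/-- A complex number `q` with `0 < |q| < 1`, given together with a logarithm (`q = exp log`),
so that all powers `q ^ z`, `z ∈ ℂ`, make sense. -/
structure QParam where
  log : ℂ
  norm_lt_one : ‖Complex.exp log‖ < 1

/-- `q ^ z = exp (z log q)`. -/
def QParam.pow (p : QParam) (z : ℂ) : ℂ := Complex.exp (p.log * z)

/-- The number `q`. -/
def QParam.q (p : QParam) : ℂ := p.pow 1

theorem QParam.pow_ne_zero (p : QParam) (z : ℂ) : p.pow z ≠ 0 := Complex.exp_ne_zero _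

theorem QParam.pow_add (p : QParam) (y z : ℂ) : p.pow (y + z) = p.pow y * p.pow z := by
  simp [QParam.pow, mul_add, Complex.exp_add]

theorem QParam.pow_zero (p : QParam) : p.pow 0 = 1 := by simp [QParam.pow]

theorem QParam.pow_int_injective (p : QParam) :
    Function.Injective (fun m : ℤ => p.pow (m : ℂ)) := by
  intro m n h
  have hre : p.log.re < 0 := by
    have := p.norm_lt_one
    rw [Complex.norm_exp] at this
    simpa using this
  have h1 := congrArg norm h
  simp only [QParam.pow, Complex.norm_exp, Real.exp_eq_exp] at h1
  simp only [Complex.mul_re, Complex.intCast_re, Complex.intCast_im, mul_zero, sub_zero] at h1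
  exact_mod_cast mul_left_cancel₀ hre.ne h1

/-! ### The Hopf algebra `U_q(sl(2))` -/

/-- Generators: `e`, `f`, and `k t = q ^ (t h)` for `t ∈ ℂ` (so `t h` runs through the
Cartan subalgebra `ℂ h`). -/
inductive Gen where
  | e : Gen
  | f : Gen
  | k : ℂ → Gen

open FreeAlgebra in
/-- Defining relations of `U_q(sl(2))`. -/
inductive Rel (p : QParam) : FreeAlgebra ℂ Gen → FreeAlgebra ℂ Gen → Prop
  | k_zero : Rel p (ι ℂ (Gen.k 0)) 1
  | k_add (s t : ℂ) : Rel p (ι ℂ (Gen.k s) * ι ℂ (Gen.k t)) (ι ℂ (Gen.k (s + t)))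
  | k_e (t : ℂ) : Rel p (ι ℂ (Gen.k t) * ι ℂ Gen.e * ι ℂ (Gen.k (-t)))
      (p.pow (2 * t) • ι ℂ Gen.e)
  | k_f (t : ℂ) : Rel p (ι ℂ (Gen.k t) * ι ℂ Gen.f * ι ℂ (Gen.k (-t)))
      (p.pow (-(2 * t)) • ι ℂ Gen.f)
  | e_f : Rel p (ι ℂ Gen.e * ι ℂ Gen.f - ι ℂ Gen.f * ι ℂ Gen.e)
      ((p.q - p.q⁻¹)⁻¹ • (ι ℂ (Gen.k 1) - ι ℂ (Gen.k (-1))))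

/-- `U_q(sl(2))`. -/
abbrev Uq (p : QParam) : Type := RingQuot (Rel p)

/-- The image of a generator in `U_q(sl(2))`. -/
def Uq.of (p : QParam) (g : Gen) : Uq p := RingQuot.mkAlgHom ℂ (Rel p) (FreeAlgebra.ι ℂ g)

theorem Uq.k_zero (p : QParam) : Uq.of p (.k 0) = 1 := by
  simpa [Uq.of] using RingQuot.mkAlgHom_rel ℂ (Rel.k_zero (p := p))

theorem Uq.k_add (p : QParam) (s t : ℂ) :
    Uq.of p (.k s) * Uq.of p (.k t) = Uq.of p (.k (s + t)) := by
  simpa [Uq.of] using RingQuot.mkAlgHom_rel ℂ (Rel.k_add (p := p) s t)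

theorem Uq.k_e (p : QParam) (t : ℂ) :
    Uq.of p (.k t) * Uq.of p .e * Uq.of p (.k (-t)) = p.pow (2 * t) • Uq.of p .e := by
  simpa [Uq.of] using RingQuot.mkAlgHom_rel ℂ (Rel.k_e (p := p) t)

theorem Uq.k_f (p : QParam) (t : ℂ) :
    Uq.of p (.k t) * Uq.of p .f * Uq.of p (.k (-t)) = p.pow (-(2 * t)) • Uq.of p .f := by
  simpa [Uq.of] using RingQuot.mkAlgHom_rel ℂ (Rel.k_f (p := p) t)

theorem Uq.e_f (p : QParam) :
    Uq.of p .e * Uq.of p .f - Uq.of p .f * Uq.of p .e =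
      (p.q - p.q⁻¹)⁻¹ • (Uq.of p (.k 1) - Uq.of p (.k (-1))) := by
  simpa [Uq.of] using RingQuot.mkAlgHom_rel ℂ (Rel.e_f (p := p))

theorem Uq.k_neg_mul (p : QParam) (t : ℂ) : Uq.of p (.k (-t)) * Uq.of p (.k t) = 1 := by
  rw [Uq.k_add]; simp [Uq.k_zero]

theorem Uq.k_mul_e (p : QParam) (t : ℂ) :
    Uq.of p (.k t) * Uq.of p .e = p.pow (2 * t) • (Uq.of p .e * Uq.of p (.k t)) := by
  rw [← smul_mul_assoc, ← Uq.k_e, mul_assoc _ _ (Uq.of p (.k t)), Uq.k_neg_mul, mul_one]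

theorem Uq.k_mul_f (p : QParam) (t : ℂ) :
    Uq.of p (.k t) * Uq.of p .f = p.pow (-(2 * t)) • (Uq.of p .f * Uq.of p (.k t)) := by
  rw [← smul_mul_assoc, ← Uq.k_f, mul_assoc _ _ (Uq.of p (.k t)), Uq.k_neg_mul, mul_one]

/-- The coproduct on generators:
`Δ e = e ⊗ q^h + 1 ⊗ e`, `Δ f = f ⊗ 1 + q^(-h) ⊗ f`, `Δ q^(t h) = q^(t h) ⊗ q^(t h)`. -/
def comulGen (p : QParam) : Gen → Uq p ⊗[ℂ] Uq p
  | .e => Uq.of p .e ⊗ₜ Uq.of p (.k 1) + 1 ⊗ₜ Uq.of p .e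
  | .f => Uq.of p .f ⊗ₜ 1 + Uq.of p (.k (-1)) ⊗ₜ Uq.of p .f
  | .k t => Uq.of p (.k t) ⊗ₜ Uq.of p (.k t)

theorem comulGen_rel (p : QParam) ⦃a b : FreeAlgebra ℂ Gen⦄ (h : Rel p a b) :
    FreeAlgebra.lift ℂ (comulGen p) a = FreeAlgebra.lift ℂ (comulGen p) b := by
  cases h with
  | k_zero => simp [comulGen, Uq.k_zero, Algebra.TensorProduct.one_def]
  | k_add s t => simp [comulGen, Uq.k_add]
  | k_e t =>
    have h1 : Uq.of p (.k t) * Uq.of p (.k 1) * Uq.of p (.k (-t)) = Uq.of p (.k 1) := by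
      rw [Uq.k_add, Uq.k_add]; congr 2; ring
    have h2 : Uq.of p (.k t) * Uq.of p (.k (-t)) = 1 := by
      rw [Uq.k_add]; simp [Uq.k_zero]
    simp [comulGen, mul_add, add_mul, Uq.k_e, h1, h2, TensorProduct.smul_tmul']
  | k_f t =>
    have h1 : Uq.of p (.k t) * Uq.of p (.k (-1)) * Uq.of p (.k (-t)) = Uq.of p (.k (-1)) := by
      rw [Uq.k_add, Uq.k_add]; congr 2; ring
    have h2 : Uq.of p (.k t) * Uq.of p (.k (-t)) = 1 := by
      rw [Uq.k_add]; simp [Uq.k_zero]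
    simp [comulGen, mul_add, add_mul, Uq.k_f, h1, h2, TensorProduct.smul_tmul']
  | e_f =>
    have hef := Uq.e_f p
    rw [sub_eq_iff_eq_add] at hef
    have hc : p.pow (2 * -1) * p.pow (-(2 * 1)) ≠ 0 :=
      mul_ne_zero (p.pow_ne_zero _) (p.pow_ne_zero _)
    have h1 := Uq.k_mul_e p (-1)
    have h2 := Uq.k_mul_f p 1
    have hx : (Uq.of p (.k (-1)) * Uq.of p .e) ⊗ₜ[ℂ] (Uq.of p .f * Uq.of p (.k 1)) =
        (Uq.of p .e * Uq.of p (.k (-1))) ⊗ₜ[ℂ] (Uq.of p (.k 1) * Uq.of p .f) := by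
      rw [h1, h2, TensorProduct.tmul_smul, TensorProduct.smul_tmul']
      congr 3
      ring
    simp only [map_sub, map_mul, map_smul, FreeAlgebra.lift_ι_apply, comulGen, mul_add, add_mul,
      Algebra.TensorProduct.tmul_mul_tmul, one_mul, mul_one, hef, hx, TensorProduct.add_tmul,
      TensorProduct.tmul_add, smul_sub, TensorProduct.sub_tmul, TensorProduct.tmul_sub,
      ← TensorProduct.smul_tmul', TensorProduct.tmul_smul]
    abel

/-- The coproduct `Δ : U_q(sl(2)) → U_q(sl(2)) ⊗ U_q(sl(2))`. -/
def comul (p : QParam) : Uq p →ₐ[ℂ] Uq p ⊗[ℂ] Uq p :=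
  RingQuot.liftAlgHom ℂ ⟨FreeAlgebra.lift ℂ (comulGen p), comulGen_rel p⟩

/-- The counit on generators. -/
def counitGen : Gen → ℂ
  | .e => 0
  | .f => 0
  | .k _ => 1

theorem counitGen_rel (p : QParam) ⦃a b : FreeAlgebra ℂ Gen⦄ (h : Rel p a b) :
    FreeAlgebra.lift ℂ counitGen a = FreeAlgebra.lift ℂ counitGen b := by
  cases h <;> simp [counitGen]

/-- The counit of `U_q(sl(2))`. -/
def counit (p : QParam) : Uq p →ₐ[ℂ] ℂ :=
  RingQuot.liftAlgHom ℂ ⟨FreeAlgebra.lift ℂ counitGen, counitGen_rel p⟩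

/-! ### Finite-dimensional representations -/

/-- The weight space `V[m] = {v | q^(t h) v = q^(t m) v for all t}`. -/
def weightSpace (p : QParam) {V : Type} [AddCommGroup V] [Module ℂ V]
    (ρ : Uq p →ₐ[ℂ] Module.End ℂ V) (m : ℤ) : Submodule ℂ V :=
  ⨅ t : ℂ, LinearMap.ker (ρ (Uq.of p (.k t)) - algebraMap ℂ (Module.End ℂ V) (p.pow (t * m)))

/-- A finite-dimensional `U_q(sl(2))`-module which is the sum of its weight spaces (with integral
weights, as for every `𝔥`-semisimple finite-dimensional module with real weights). -/
structure Rep (p : QParam) where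
  V : Type
  [addCommGroup : AddCommGroup V]
  [module : Module ℂ V]
  [finite : FiniteDimensional ℂ V]
  ρ : Uq p →ₐ[ℂ] Module.End ℂ V
  iSup_weightSpace : ⨆ m : ℤ, weightSpace p ρ m = ⊤

attribute [instance] Rep.addCommGroup Rep.module Rep.finite

theorem mem_weightSpace (p : QParam) {V : Type} [AddCommGroup V] [Module ℂ V]
    (ρ : Uq p →ₐ[ℂ] Module.End ℂ V) (m : ℤ) (v : V) :
    v ∈ weightSpace p ρ m ↔ ∀ t : ℂ, ρ (Uq.of p (.k t)) v = p.pow (t * m) • v := by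
  simp [weightSpace, sub_eq_zero, Module.algebraMap_end_apply]

theorem iSupIndep_weightSpace (p : QParam) {V : Type} [AddCommGroup V] [Module ℂ V]
    (ρ : Uq p →ₐ[ℂ] Module.End ℂ V) : iSupIndep (weightSpace p ρ) := by
  refine ((Module.End.eigenspaces_iSupIndep (ρ (Uq.of p (.k 1)))).comp
    p.pow_int_injective).mono fun m v hv => ?_
  have := (mem_weightSpace p ρ m v).1 hv 1
  simpa [Module.End.mem_eigenspace_iff] using this

theorem Rep.isCompl (p : QParam) (V : Rep p) (m : ℤ) :
    IsCompl (weightSpace p V.ρ m) (⨆ n : ℤ, ⨆ _ : n ≠ m, weightSpace p V.ρ n) := by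
  refine ⟨iSupIndep_weightSpace p V.ρ m, codisjoint_iff.2 (top_le_iff.1 ?_)⟩
  rw [← V.iSup_weightSpace]
  refine iSup_le fun n => ?_
  by_cases h : n = m
  · subst h; exact le_sup_left
  · exact le_trans (le_iSup₂_of_le n h le_rfl) le_sup_right

/-- The projection `P_m` of `V` onto `V[m]` along the other weight spaces. -/
def Rep.proj {p : QParam} (V : Rep p) (m : ℤ) : Module.End ℂ V.V :=
  (weightSpace p V.ρ m).projection _ (V.isCompl p m)

/-- The finite set of weights of `V`. -/
def Rep.weights {p : QParam} (V : Rep p) : Finset ℤ :=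
  (WellFoundedGT.finite_ne_bot_of_iSupIndep (iSupIndep_weightSpace p V.ρ)).toFinset

/-- The action of `U_q(sl(2))` on `V ⊗ W` through the coproduct. -/
def tensorAction (p : QParam) (V W : Rep p) : Uq p →ₐ[ℂ] Module.End ℂ (V.V ⊗[ℂ] W.V) :=
  ((Module.endTensorEndAlgHom (R := ℂ) (S := ℂ) (A := ℂ) (M := V.V) (N := W.V)).comp
    (Algebra.TensorProduct.map V.ρ W.ρ)).comp (comul p)

theorem tensorAction_k (p : QParam) (V W : Rep p) (t : ℂ) :
    tensorAction p V W (Uq.of p (.k t)) =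
      TensorProduct.map (V.ρ (Uq.of p (.k t))) (W.ρ (Uq.of p (.k t))) := by
  have h : comul p (Uq.of p (.k t)) = Uq.of p (.k t) ⊗ₜ Uq.of p (.k t) := by
    simp [comul, Uq.of, comulGen]
  ext v w
  simp [tensorAction, h, Module.endTensorEndAlgHom_apply]

theorem tensorAction_iSup (p : QParam) (V W : Rep p) :
    ⨆ m : ℤ, weightSpace p (tensorAction p V W) m = ⊤ := by
  rw [eq_top_iff]
  rintro x -
  have key : ∀ (m n : ℤ) (v : V.V) (w : W.V), v ∈ weightSpace p V.ρ m →
      w ∈ weightSpace p W.ρ n → v ⊗ₜ[ℂ] w ∈ weightSpace p (tensorAction p V W) (m + n) := by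
    intro m n v w hv hw
    rw [mem_weightSpace] at hv hw ⊢
    intro t
    rw [tensorAction_k, TensorProduct.map_tmul, hv, hw, TensorProduct.smul_tmul_smul]
    push_cast
    rw [mul_add, p.pow_add]
  induction x using TensorProduct.induction_on with
  | zero => exact zero_mem _
  | add x y hx hy => exact add_mem hx hy
  | tmul v w =>
    have hv : v ∈ ⨆ m : ℤ, weightSpace p V.ρ m := by rw [V.iSup_weightSpace]; trivial
    have hw : w ∈ ⨆ m : ℤ, weightSpace p W.ρ m := by rw [W.iSup_weightSpace]; trivial
    induction hv using Submodule.iSup_induction' with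
    | zero => rw [TensorProduct.zero_tmul]; exact zero_mem _
    | add x y _ _ hx hy => rw [TensorProduct.add_tmul]; exact add_mem hx hy
    | mem m v hv =>
      induction hw using Submodule.iSup_induction' with
      | zero => rw [TensorProduct.tmul_zero]; exact zero_mem _
      | add x y _ _ hx hy => rw [TensorProduct.tmul_add]; exact add_mem hx hy
      | mem n w hw => exact Submodule.mem_iSup_of_mem (m + n) (key m n v w hv hw)

/-- The tensor product of two representations. -/
@[reducible] def Rep.tensor {p : QParam} (V W : Rep p) : Rep p where
  V := V.V ⊗[ℂ] W.V
  ρ := tensorAction p V W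
  iSup_weightSpace := tensorAction_iSup p V W

/-- The action of `U_q(sl(2))` on `ℂ` through the counit. -/
def trivialAction (p : QParam) : Uq p →ₐ[ℂ] Module.End ℂ ℂ :=
  (Algebra.ofId ℂ (Module.End ℂ ℂ)).comp (counit p)

theorem trivialAction_iSup (p : QParam) :
    ⨆ m : ℤ, weightSpace p (trivialAction p) m = ⊤ := by
  rw [eq_top_iff]
  refine le_trans (fun v _ => ?_) (le_iSup _ 0)
  rw [mem_weightSpace]
  intro t
  have h : counit p (Uq.of p (.k t)) = 1 := by simp [counit, Uq.of, counitGen]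
  simp [trivialAction, h, p.pow_zero]

/-- The trivial representation. -/
@[reducible] def Rep.trivial (p : QParam) : Rep p where
  V := ℂ
  ρ := trivialAction p
  iSup_weightSpace := trivialAction_iSup p

/-- `φ` is an intertwiner. -/
def IsIntertwiner {p : QParam} {V W : Rep p} (φ : V.V →ₗ[ℂ] W.V) : Prop :=
  ∀ u : Uq p, φ ∘ₗ V.ρ u = W.ρ u ∘ₗ φ

/-! ### Rational functions of the dynamical parameter -/

/-- The field `ℂ(ν̃)`. Its generator `ν̃ = ν̃₁` is a fourth root of `ν = ν₁ = x`, where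
`diag(ν₁, ν₂) = diag(x, x⁻¹)` is the value of `x ^ h` in the fundamental representation. -/
abbrev Fld : Type := RatFunc ℂ

/-- The element `x = ν̃ ^ 4` of `ℂ(ν̃)`. -/
def xVar : Fld := RatFunc.X ^ 4

theorem subst_le (P : Polynomial ℂ) (hP : P.natDegree ≠ 0) :
    nonZeroDivisors (Polynomial ℂ) ≤ (nonZeroDivisors (Polynomial ℂ)).comap
      (Polynomial.aeval P : Polynomial ℂ →ₐ[ℂ] Polynomial ℂ) := by
  intro f hf
  refine mem_nonZeroDivisors_of_ne_zero fun h0 => nonZeroDivisors.ne_zero hf ?_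
  have h1 : f.comp P = 0 := by
    rw [← h0, Polynomial.comp, Polynomial.aeval_def]; rfl
  rcases Polynomial.comp_eq_zero_iff.1 h1 with h | ⟨_, h⟩
  · exact h
  · exact absurd (by rw [h, Polynomial.natDegree_C]) hP

/-- The substitution `g(ν̃) ↦ g(P(ν̃))` for a nonconstant polynomial `P`. -/
def subst (P : Polynomial ℂ) (hP : P.natDegree ≠ 0) : Fld →ₐ[ℂ] Fld :=
  RatFunc.mapAlgHom (Polynomial.aeval P : Polynomial ℂ →ₐ[ℂ] Polynomial ℂ) (subst_le P hP)

/-- The shift `x ↦ x q ^ m`, i.e. `ν̃ ↦ ν̃ q ^ (m / 4)`. -/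
def shiftFld (p : QParam) (m : ℤ) : Fld →ₐ[ℂ] Fld :=
  subst (Polynomial.C (p.pow (m / 4)) * Polynomial.X) (by
    rw [Polynomial.natDegree_C_mul_X _ (p.pow_ne_zero _)]; exact one_ne_zero)

/-- The embedding `ℂ(y) → ℂ(ν̃)` with `y = ν̃ ^ n`, for `n ≥ 1`. -/
def powFld (n : ℕ) (hn : n ≠ 0) : Fld →ₐ[ℂ] Fld :=
  subst (Polynomial.X ^ n) (by simpa using hn)

/-- Operators on `V` with coefficients in `ℂ(ν̃)`: `ℂ(ν̃) ⊗ End V`. -/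
abbrev Op (V : Type) [AddCommGroup V] [Module ℂ V] : Type := Fld ⊗[ℂ] Module.End ℂ V

/-- Apply a `ℂ`-algebra map to the coefficients. -/
def mapCoeff (V : Type) [AddCommGroup V] [Module ℂ V] (σ : Fld →ₐ[ℂ] Fld) : Op V →ₐ[ℂ] Op V :=
  Algebra.TensorProduct.map σ (AlgHom.id ℂ (Module.End ℂ V))

/-- Apply a linear functional `l` on `End V` to an element of `ℂ(ν̃) ⊗ End V`. -/
def coeff {V : Type} [AddCommGroup V] [Module ℂ V] (l : Module.End ℂ V →ₗ[ℂ] ℂ) :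
    Op V →ₗ[ℂ] Fld :=
  (TensorProduct.rid ℂ Fld).toLinearMap ∘ₗ LinearMap.lTensor Fld l

/-- `a ↦ a ⊗ id_W`. -/
def opLeft (V W : Type) [AddCommGroup V] [Module ℂ V] [AddCommGroup W] [Module ℂ W] :
    Op V →ₐ[ℂ] Op (V ⊗[ℂ] W) :=
  Algebra.TensorProduct.map (AlgHom.id ℂ Fld) (Module.End.rTensorAlgHom ℂ V W)

/-- `a ↦ id_V ⊗ a`. -/
def opRight (V W : Type) [AddCommGroup V] [Module ℂ V] [AddCommGroup W] [Module ℂ W] :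
    Op W →ₐ[ℂ] Op (V ⊗[ℂ] W) :=
  Algebra.TensorProduct.map (AlgHom.id ℂ Fld) (Module.End.lTensorAlgHom ℂ W V)

/-- Transport of operators along a linear isomorphism: `a ↦ φ a φ⁻¹`. -/
def opConj {V W : Type} [AddCommGroup V] [Module ℂ V] [AddCommGroup W] [Module ℂ W]
    (φ : V ≃ₗ[ℂ] W) : Op V →ₐ[ℂ] Op W :=
  Algebra.TensorProduct.map (AlgHom.id ℂ Fld) (φ.conjAlgEquiv ℂ).toAlgHom

/-! ### The completions of `ℂ(ν̃) ⊗ U_q(sl(2))` and `ℂ(ν̃) ⊗ U_q(sl(2))^{⊗ 2}`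

An element of the completion is a natural family of operators on representations; additivity
`a_{V ⊕ W} = a_V ⊕ a_W` is the case of the inclusions of `V` and `W` into `V ⊕ W`.
Families are multiplied pointwise. -/

/-- Families `a_V ∈ ℂ(ν̃) ⊗ End V`. -/
abbrev Fam1 (p : QParam) : Type 1 := ∀ V : Rep p, Op V.V

/-- Families `a_{V,W} ∈ ℂ(ν̃) ⊗ End (V ⊗ W)`. -/
abbrev Fam2 (p : QParam) : Type 1 := ∀ V W : Rep p, Op (V.V ⊗[ℂ] W.V)

/-- `a` belongs to `(ℂ(ν̃) ⊗ U_q(sl(2)))^c`: `(1 ⊗ φ) a_V = a_W (1 ⊗ φ)` in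
`ℂ(ν̃) ⊗ Hom(V, W)` for all intertwiners `φ : V → W`. -/
def IsNatural1 {p : QParam} (a : Fam1 p) : Prop :=
  ∀ (V W : Rep p) (φ : V.V →ₗ[ℂ] W.V), IsIntertwiner φ →
    LinearMap.lTensor Fld (LinearMap.llcomp ℂ V.V V.V W.V φ) (a V) =
      LinearMap.lTensor Fld (LinearMap.lcomp ℂ W.V φ) (a W)

/-- `a` belongs to `(ℂ(ν̃) ⊗ U_q(sl(2))^{⊗ 2})^c`. -/
def IsNatural2 {p : QParam} (a : Fam2 p) : Prop :=
  ∀ (V V' W W' : Rep p) (φ : V.V →ₗ[ℂ] V'.V) (ψ : W.V →ₗ[ℂ] W'.V),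
    IsIntertwiner φ → IsIntertwiner ψ →
    LinearMap.lTensor Fld (LinearMap.llcomp ℂ (V.V ⊗[ℂ] W.V) (V.V ⊗[ℂ] W.V) (V'.V ⊗[ℂ] W'.V)
        (TensorProduct.map φ ψ)) (a V W) =
      LinearMap.lTensor Fld (LinearMap.lcomp ℂ (V'.V ⊗[ℂ] W'.V) (TensorProduct.map φ ψ)) (a V' W')

/-- The element of the completion defined by `u ∈ U_q(sl(2))`. -/
def gen (p : QParam) (u : Uq p) : Fam1 p := fun V => 1 ⊗ₜ V.ρ u

/-- The projection onto weight `m`. -/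
def projFam (p : QParam) (m : ℤ) : Fam1 p := fun V => 1 ⊗ₜ V.proj m

/-- The function `g(h)` of `h`: it acts on `V[m]` by `g m`. -/
def funH (p : QParam) (g : ℤ → Fld) : Fam1 p := fun V => ∑ m ∈ V.weights, g m ⊗ₜ V.proj m

/-- The function `g(h ⊗ 1, 1 ⊗ h)`: it acts on `V[m] ⊗ W[n]` by `g m n`. -/
def funHH (p : QParam) (g : ℤ → ℤ → Fld) : Fam2 p := fun V W =>
  ∑ m ∈ V.weights, ∑ n ∈ W.weights, g m n ⊗ₜ TensorProduct.map (V.proj m) (W.proj n)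

/-- `a ↦ a₁`. -/
def leg1 {p : QParam} (a : Fam1 p) : Fam2 p := fun V W => opLeft V.V W.V (a V)

/-- `a ↦ a₂`. -/
def leg2 {p : QParam} (a : Fam1 p) : Fam2 p := fun V W => opRight V.V W.V (a W)

/-- `a ↦ Δ(a)`, with `Δ(a)_{V,W} = a_{V ⊗ W}`. -/
def coprod {p : QParam} (a : Fam1 p) : Fam2 p := fun V W => a (V.tensor W)

/-- `a ↦ a₂₁`. -/
def flip {p : QParam} (a : Fam2 p) : Fam2 p := fun V W =>
  opConj (TensorProduct.comm ℂ W.V V.V) (a W V)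

/-- For an operator `a(x)` on `M`, the operator `a(x q^{h_W})` on `M ⊗ W`: it is
`a(x q^m) ⊗ id` on `M ⊗ W[m]`. -/
def dynShift {p : QParam} {M : Type} [AddCommGroup M] [Module ℂ M] (a : Op M) (W : Rep p) :
    Op (M ⊗[ℂ] W.V) :=
  ∑ m ∈ W.weights, opLeft M W.V (mapCoeff M (shiftFld p m) a) * opRight M W.V (projFam p m W)

/-- `a ↦ a₁(x q^{h₂})`. -/
def leg1Shift {p : QParam} (a : Fam1 p) : Fam2 p := fun V W => dynShift (a V) W

/-- All entries of `a` lie in the subfield `ℂ(ν̃ ^ n)`, i.e. `a_V ∈ ℂ(ν̃ ^ n) ⊗ End V`. -/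
def HasCoeffsIn1 {p : QParam} (n : ℕ) (hn : n ≠ 0) (a : Fam1 p) : Prop :=
  ∀ V : Rep p, a V ∈ (mapCoeff V.V (powFld n hn)).range

/-- All entries of `a` lie in the subfield `ℂ(ν̃ ^ n)`. -/
def HasCoeffsIn2 {p : QParam} (n : ℕ) (hn : n ≠ 0) (a : Fam2 p) : Prop :=
  ∀ V W : Rep p, a V W ∈ (mapCoeff (V.V ⊗[ℂ] W.V) (powFld n hn)).range

/-- `ν`-rational elements: coefficients in `ℂ(ν)`, `ν = ν̃ ^ 4`. -/
def IsNuRational1 {p : QParam} (a : Fam1 p) : Prop := HasCoeffsIn1 4 (by norm_num) a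

/-- `ν`-rational elements: coefficients in `ℂ(ν)`, `ν = ν̃ ^ 4`. -/
def IsNuRational2 {p : QParam} (a : Fam2 p) : Prop := HasCoeffsIn2 4 (by norm_num) a

/-- `x²`-rational elements: coefficients in `ℂ(x²)`, `x² = ν̃ ^ 8`. -/
def IsXSqRational2 {p : QParam} (a : Fam2 p) : Prop := HasCoeffsIn2 8 (by norm_num) a

/-- `a ∈ (ℂ(ν̃) ⊗ U_q(𝔥))^c`: `a` acts on each `V[m]` by a scalar. -/
def IsCartan {p : QParam} (a : Fam1 p) : Prop :=
  IsNatural1 a ∧ ∀ (V : Rep p) (m : ℤ), ∃ c : Fld, a V * projFam p m V = c ⊗ₜ V.proj m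

/-- `a ∈ 1 ⊕ (ℂ(ν) ⊗ U_q^+)^c`: `a` is `ν`-rational and `a - 1` strictly raises weights. -/
def IsUnipotentUpper {p : QParam} (a : Fam1 p) : Prop :=
  IsNatural1 a ∧ IsNuRational1 a ∧
    ∀ m m' : ℤ, ¬ m < m' → projFam p m' * (a - 1) * projFam p m = 0

/-- `a ∈ 1 ⊕ (ℂ(ν) ⊗ U_q^-)^c`: `a` is `ν`-rational and `a - 1` strictly lowers weights. -/
def IsUnipotentLower {p : QParam} (a : Fam1 p) : Prop :=
  IsNatural1 a ∧ IsNuRational1 a ∧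
    ∀ m m' : ℤ, ¬ m' < m → projFam p m' * (a - 1) * projFam p m = 0

/-! ### `q`-exponentials and the standard `R`-matrix -/

/-- `(n)_{q⁻¹} = (1 - q^{-2n}) / (1 - q^{-2})`. -/
def qInvNumber (p : QParam) (n : ℕ) : ℂ := (1 - p.pow (-(2 * n))) / (1 - p.pow (-2))

/-- `(n)_{q⁻¹}! = (1)_{q⁻¹} ⋯ (n)_{q⁻¹}`. -/
def qInvFactorial (p : QParam) (n : ℕ) : ℂ := ∏ i ∈ Finset.range n, qInvNumber p (i + 1)

/-- The `q`-exponential `e_{q⁻¹}^a = ∑ aⁿ / (n)_{q⁻¹}!` of a nilpotent element `a`. -/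
def qInvExp (p : QParam) {R : Type} [Ring R] [Algebra ℂ R] (a : R) : R :=
  ∑ n ∈ Finset.range (nilpotencyClass a), (qInvFactorial p n)⁻¹ • a ^ n

/-- `K = q^{h ⊗ h / 2}`. -/
def matK (p : QParam) : Fam2 p := funHH p fun m n => RatFunc.C (p.pow (m * n / 2))

/-- `R̂ = e_{q⁻¹}^{(q - q⁻¹) e ⊗ f}`. -/
def matRhat (p : QParam) : Fam2 p := fun V W =>
  qInvExp p ((p.q - p.q⁻¹) • (leg1 (gen p (Uq.of p .e)) V W * leg2 (gen p (Uq.of p .f)) V W))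

/-- The standard `R`-matrix `R = K R̂`. -/
def matR (p : QParam) : Fam2 p := matK p * matRhat p

/-- `B(x) = x^h q^{h² / 2}`. -/
def elemB (p : QParam) : Fam1 p := funH p fun m => xVar ^ m * RatFunc.C (p.pow (m ^ 2 / 2))

/-! ### The dynamical coboundary problem -/

/-- `[F, h ⊗ 1 + 1 ⊗ h] = 0`. -/
def IsZeroWeight {p : QParam} (F : Fam2 p) : Prop :=
  Commute F (leg1 (funH p fun m => RatFunc.C (m : ℂ)) + leg2 (funH p fun m => RatFunc.C (m : ℂ)))

/-- The quantum dynamical cocycle equation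
`(Δ ⊗ id)(F(x)) F₁₂(x q^{h₃}) = (id ⊗ Δ)(F(x)) F₂₃(x)`. -/
def SatisfiesQDCE {p : QParam} (F : Fam2 p) : Prop :=
  ∀ U V W : Rep p,
    opConj (TensorProduct.assoc ℂ U.V V.V W.V) (F (U.tensor V) W * dynShift (F U V) W) =
      F U (V.tensor W) * opRight U.V (V.V ⊗[ℂ] W.V) (F V W)

/-- `F` is an `x²`-rational solution of the ABRR equation `F B₂ = R̂⁻¹ B₂ F` such that
`F - 1 ⊗ 1` belongs to `(ℂ(x²) ⊗ U_q ⊗ U_q^-)^c`. -/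
def IsABRRSolution {p : QParam} (F : Fam2 p) : Prop :=
  IsNatural2 F ∧ IsXSqRational2 F ∧
    (∀ m m' : ℤ, ¬ m' < m → leg2 (projFam p m') * (F - 1) * leg2 (projFam p m) = 0) ∧
    F * leg2 (elemB p) = Ring.inverse (matRhat p) * leg2 (elemB p) * F

/-- `F` is the standard solution of the dynamical cocycle equation, i.e. the unique
solution of the ABRR equation in `1 ⊗ 1 + (ℂ(x²) ⊗ U_q ⊗ U_q^-)^c`. -/
def IsStandardSolution {p : QParam} (F : Fam2 p) : Prop :=
  IsABRRSolution F ∧ ∀ G : Fam2 p, IsABRRSolution G → G = F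

/-- The cocycle `J`; it is trivial for `sl(2)`. -/
def cocycleJ (p : QParam) : Fam2 p := 1

/-- `Δ(M(x)) J M₂(x)⁻¹ M₁(x q^{h₂})⁻¹`. -/
def coboundary {p : QParam} (J : Fam2 p) (M : Fam1 p) : Fam2 p :=
  coprod M * J * Ring.inverse (leg2 M) * Ring.inverse (leg1Shift M)

/-- `a` is almost `ν`-rational: for some invertible `b ∈ (ℂ(ν̃) ⊗ U_q(𝔥))^c`, both `b⁻¹ a` and
`Δ(b) b₂(x)⁻¹ b₁(x q^{h₂})⁻¹` are `ν`-rational. -/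
def IsAlmostNuRational {p : QParam} (a : Fam1 p) : Prop :=
  IsNatural1 a ∧ ∃ b : Fam1 p, IsCartan b ∧ IsUnit b ∧
    IsNuRational1 (Ring.inverse b * a) ∧ IsNuRational2 (coboundary 1 b)

/-- `F₂₁⁻¹ R₁₂ F₁₂`. -/
def dynR {p : QParam} (F : Fam2 p) : Fam2 p := Ring.inverse (flip F) * matR p * F

/-- `M` solves the weak quantum dynamical coboundary problem: it is an invertible, almost
`ν`-rational element such that `F = Δ(M(x)) J M₂(x)⁻¹ M₁(x q^{h₂})⁻¹` is an (invertible)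
zero-weight solution of the dynamical cocycle equation and `R(x) = F₂₁⁻¹ R₁₂ F₁₂` satisfies
`R₁₂(x) B₂(x) = B₂(x) K₁₂² R₂₁(x)⁻¹`. -/
def IsWeakSolution {p : QParam} (M : Fam1 p) : Prop :=
  IsUnit M ∧ IsAlmostNuRational M ∧
    IsUnit (coboundary (cocycleJ p) M) ∧
    IsZeroWeight (coboundary (cocycleJ p) M) ∧
    SatisfiesQDCE (coboundary (cocycleJ p) M) ∧
    dynR (coboundary (cocycleJ p) M) * leg2 (elemB p) =
      leg2 (elemB p) * matK p ^ 2 * Ring.inverse (flip (dynR (coboundary (cocycleJ p) M)))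

/-- `M` solves the strong quantum dynamical coboundary problem: it solves the weak one, and
`Δ(M(x)) J M₂(x)⁻¹ M₁(x q^{h₂})⁻¹` is the standard solution. -/
def IsStrongSolution {p : QParam} (M : Fam1 p) : Prop :=
  IsWeakSolution M ∧ IsStandardSolution (coboundary (cocycleJ p) M)

/-! ### The Gauss product -/

/-- `L = a 0 * a 1 * a 2 * ⋯`: on every representation, for all small enough values `z ≠ 0` of
`ν̃`, all entries of the partial products and of `L` have no pole at `z`, and the values at `z`
of the partial products tend to the value of `L`. -/
def IsInfiniteProduct {p : QParam} (a : ℕ → Fam1 p) (L : Fam1 p) : Prop :=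
  ∀ V : Rep p, ∃ c : ℝ, 0 < c ∧ ∀ z : ℂ, 0 < ‖z‖ → ‖z‖ < c →
    ∀ l : Module.End ℂ V.V →ₗ[ℂ] ℂ,
      (∀ N : ℕ, (coeff l (((List.range N).map a).prod V)).denom.eval z ≠ 0) ∧
      (coeff l (L V)).denom.eval z ≠ 0 ∧
      Filter.Tendsto
        (fun N : ℕ => (coeff l (((List.range N).map a).prod V)).eval (RingHom.id ℂ) z)
        Filter.atTop (nhds ((coeff l (L V)).eval (RingHom.id ℂ) z))

/-- The extension to the completion of the algebra morphism `τ` of `U_q(𝔫⁺)` attached to the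
shift. For `sl(2)` it sends the only generator `e` to `0`, hence it is `a ↦ ε(a) 1`, where the
counit `ε(a)` is the action of `a` on the trivial representation. -/
def tau {p : QParam} (a : Fam1 p) : Fam1 p := fun V =>
  coeff (LinearMap.applyₗ (1 : ℂ)) (a (Rep.trivial p)) ⊗ₜ (1 : Module.End ℂ V.V)

/-- `M = M⁽⁰⁾ (M⁽⁻⁾)⁻¹ M⁽⁺⁾` with `M⁽⁺⁾ = ∏_{k ≥ 1} τ^{k-1}(C⁺)` and
`M⁽⁻⁾ = ∏_{k ≥ 1} (B(x)^{-k} C⁻ B(x)^k)⁻¹`, where `M⁽⁰⁾ ∈ (ℂ(ν̃) ⊗ U_q(𝔥))^c` and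
`C^±, M^(±) ∈ 1 ⊕ (ℂ(ν) ⊗ U_q^±)^c`. -/
def IsGaussProduct {p : QParam} (M0 Cp Cm M : Fam1 p) : Prop :=
  IsCartan M0 ∧ IsUnipotentUpper Cp ∧ IsUnipotentLower Cm ∧
  ∃ Mp Mm : Fam1 p, IsUnipotentUpper Mp ∧ IsUnipotentLower Mm ∧
    IsInfiniteProduct (fun j => tau^[j] Cp) Mp ∧
    IsInfiniteProduct
      (fun j => Ring.inverse (Ring.inverse (elemB p) ^ (j + 1) * Cm * elemB p ^ (j + 1))) Mm ∧
    M = M0 * Ring.inverse Mm * Mp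

/-- `C⁺(x) = e_{q⁻¹}^{-x e}`. -/
def elemCPlus (p : QParam) : Fam1 p := fun V =>
  qInvExp p (-(xVar • gen p (Uq.of p .e) V))

/-- `C⁻(x)`, the inverse of `e_{q⁻¹}^{(x q^{h+1})⁻¹ f}`. -/
def elemCMinus (p : QParam) : Fam1 p := Ring.inverse fun V =>
  qInvExp p (funH p (fun m => (xVar * RatFunc.C (p.pow (m + 1)))⁻¹) V * gen p (Uq.of p .f) V)

end DynCoboundary

end

/-!
# The Gauss product solves the strong dynamical coboundary problem for `U_q(sl(2))`

Here `M⁽⁺⁾ = C⁺` since the counit of `C⁺` is one, and `M⁽⁻⁾` is the solution, as a power series in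
`f` with coefficients in the functions of `h`, of the linear equation `B M⁽⁻⁾ = (C⁻)⁻¹ M⁽⁻⁾ B`
(`elemB_mul_elemMMinus`). This equation makes the partial products for `M⁽⁻⁾` telescope to
`M⁽⁻⁾ · B⁻ᴺ (M⁽⁻⁾)⁻¹ Bᴺ`, and the entries of the second factor off the diagonal contain the `N`-th
power of a positive power of `x` (`isInfiniteProduct_elemMMinus`).

The coboundary `F` of `M = (M⁽⁻⁾)⁻¹ M⁽⁺⁾` is compared with the standard solution through the ABRR
equation `B₂ F = R̂ F B₂`. As `Δ(C⁺) = C⁺₁(x q^{h₂}) C⁺₂`, one has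
`F = Δ(M⁽⁻⁾)⁻¹ N M⁽⁻⁾₁(x q^{h₂})` with `N` the conjugate of `M⁽⁻⁾₂` by `C⁺₁(x q^{h₂})`. The addition
theorem for the `q`-exponential gives `C⁺₁(x q^{h₂}) (C⁻₂)⁻¹ = (C⁻₂)⁻¹ R̂ C⁺₁(x q^{h₂})`, whence
`B₂ N = (C⁻₂)⁻¹ R̂ N B₂`. It remains to see that
`B₂ Δ(M⁽⁻⁾) = (C⁻₂)⁻¹ K⁻¹ Δᵒᵖ(M⁽⁻⁾) K B₂` (`leg2_elemB_mul_coprod_elemMMinus`), because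
`K⁻¹ Δᵒᵖ(M⁽⁻⁾) K = R̂ Δ(M⁽⁻⁾) R̂⁻¹`. Both sides satisfy one linear equation with respect to `Δ(B)`,
so they agree by a uniqueness principle (`eq_zero_of_intertwines`): if `β` acts on the weight spaces by
distinct scalars and `T` is unipotent, then `β X = T X β` has no nonzero strictly lower solution.

The same principle shows that the ABRR equation has only one solution that is unipotent in the
second factor. The solution `standardF` is a power series in `e ⊗ f`, so it has weight zero and
coefficients in `ℂ(x²)`, and the coboundary of `M` equals it (`coboundary_elemM_eq_standardF`). The
dynamical cocycle equation holds for the coboundary of any natural element as soon as it has weight zero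
(`satisfiesQDCE_coboundary`), and the equation for `F₂₁⁻¹ R F` follows from the ABRR equation and
`Δ(B) = B₁ B₂ K²` (`dynR_standardF`).
-/

open scoped TensorProduct

noncomputable section

namespace DynCoboundary

/-! ### `q`-exponentials of nilpotent elements -/

open Finset.HasAntidiagonal (antidiagonal mem_antidiagonal)

/-- Rearrangement of a product of truncated sums whose terms of total degree at least `N` vanish. -/
theorem sum_range_mul_eq_sum_antidiagonal {R : Type*} [AddCommMonoid R] (h : ℕ → ℕ → R) (N : ℕ)
    (h0 : ∀ j l, N ≤ j + l → h j l = 0) :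
    ∑ j ∈ Finset.range N, ∑ l ∈ Finset.range N, h j l =
      ∑ k ∈ Finset.range N, ∑ x ∈ antidiagonal k, h x.1 x.2 := by
  have h1 : ∀ k ∈ Finset.range N, ∑ x ∈ antidiagonal k, h x.1 x.2 =
      ∑ j ∈ Finset.range N, ∑ l ∈ Finset.range N, if j + l = k then h j l else 0 := by
    intro k hk
    rw [← Finset.sum_product', ← Finset.sum_filter]
    refine Finset.sum_congr ?_ fun _ _ => rfl
    ext ⟨a, b⟩
    simp only [mem_antidiagonal, Finset.mem_filter, Finset.mem_product, Finset.mem_range]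
    rw [Finset.mem_range] at hk
    omega
  rw [Finset.sum_congr rfl h1]
  symm
  rw [Finset.sum_comm]
  refine Finset.sum_congr rfl fun j _ => ?_
  rw [Finset.sum_comm]
  refine Finset.sum_congr rfl fun l _ => ?_
  rw [Finset.sum_ite_eq]
  split_ifs with h2
  · rfl
  · exact (h0 _ _ (by simpa using h2)).symm

/-- The base `q⁻²` of the `q`-exponential. -/
def QParam.base (p : QParam) : ℂ := p.pow (-2)

theorem QParam.pow_int_ne_one (p : QParam) {m : ℤ} (hm : m ≠ 0) : p.pow (m : ℂ) ≠ 1 := by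
  intro h
  apply hm
  apply p.pow_int_injective
  simp [h, p.pow_zero]

theorem QParam.pow_natCast_mul (p : QParam) (n : ℕ) (z : ℂ) : p.pow (n * z) = p.pow z ^ n := by
  rw [QParam.pow, QParam.pow, ← Complex.exp_nat_mul]
  congr 1
  ring

theorem QParam.base_pow (p : QParam) (n : ℕ) : p.pow (-(2 * n)) = p.base ^ n := by
  rw [QParam.base, ← p.pow_natCast_mul]
  congr 1
  ring

theorem QParam.base_ne_zero (p : QParam) : p.base ≠ 0 := p.pow_ne_zero _

theorem qInvNumber_eq (p : QParam) (n : ℕ) :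
    qInvNumber p n = (1 - p.base ^ n) / (1 - p.base) := by
  rw [qInvNumber, p.base_pow]; rfl

theorem QParam.one_sub_base_ne_zero (p : QParam) : 1 - p.base ≠ 0 := by
  have := p.pow_int_ne_one (m := -2) (by norm_num)
  rw [sub_ne_zero]
  intro h
  apply this
  rw [h, QParam.base]
  norm_num

theorem qInvNumber_succ_ne_zero (p : QParam) (n : ℕ) : qInvNumber p (n + 1) ≠ 0 := by
  rw [qInvNumber]
  refine div_ne_zero ?_ p.one_sub_base_ne_zero
  have := p.pow_int_ne_one (m := -(2 * (n + 1 : ℤ))) (by omega)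
  rw [sub_ne_zero]
  intro h
  apply this
  rw [h]
  push_cast
  rfl

theorem qInvNumber_add (p : QParam) (m n : ℕ) :
    qInvNumber p (m + n) = qInvNumber p m + p.base ^ m * qInvNumber p n := by
  simp only [qInvNumber_eq, pow_add]
  ring

theorem qInvNumber_zero (p : QParam) : qInvNumber p 0 = 0 := by simp [qInvNumber_eq]

theorem qInvFactorial_ne_zero (p : QParam) (n : ℕ) : qInvFactorial p n ≠ 0 :=
  Finset.prod_ne_zero_iff.2 fun i _ => qInvNumber_succ_ne_zero p i

theorem qInvFactorial_succ (p : QParam) (n : ℕ) :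
    qInvFactorial p (n + 1) = qInvFactorial p n * qInvNumber p (n + 1) :=
  Finset.prod_range_succ _ _

theorem qInvFactorial_zero (p : QParam) : qInvFactorial p 0 = 1 := Finset.prod_range_zero _

theorem qInvFactorial_succ_inv_mul (p : QParam) (n : ℕ) :
    (qInvFactorial p (n + 1))⁻¹ * qInvNumber p (n + 1) = (qInvFactorial p n)⁻¹ := by
  rw [qInvFactorial_succ, mul_inv, mul_assoc, inv_mul_cancel₀ (qInvNumber_succ_ne_zero p n),
    mul_one]

section QExp

variable {R : Type} [Ring R] [Algebra ℂ R]

theorem nilpotencyClass_le_of_pow_eq_zero {S : Type*} [MonoidWithZero S] {a : S} {N : ℕ}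
    (h : a ^ N = 0) : nilpotencyClass a ≤ N :=
  Nat.sInf_le h

theorem qInvExp_eq_sum (p : QParam) {a : R} {N : ℕ} (h : a ^ N = 0) :
    qInvExp p a = ∑ n ∈ Finset.range N, (qInvFactorial p n)⁻¹ • a ^ n := by
  have hle := nilpotencyClass_le_of_pow_eq_zero h
  refine Finset.sum_subset (Finset.range_subset_range.2 hle) fun n _ hn => ?_
  rw [pow_eq_zero_of_le (by simpa using hn) (pow_nilpotencyClass ⟨N, h⟩), smul_zero]

theorem map_qInvExp (p : QParam) {S : Type} [Ring S] [Algebra ℂ S] (φ : R →ₐ[ℂ] S) {a : R}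
    (ha : IsNilpotent a) : φ (qInvExp p a) = qInvExp p (φ a) := by
  obtain ⟨N, hN⟩ := ha
  rw [qInvExp_eq_sum p hN, qInvExp_eq_sum p (a := φ a) (N := N) (by rw [← map_pow, hN, map_zero])]
  simp

theorem qInvExp_zero (p : QParam) : qInvExp p (0 : R) = 1 := by
  rw [qInvExp_eq_sum p (N := 1) (by simp)]
  simp [qInvFactorial_zero]

theorem qInvExp_mem (p : QParam) (S : Subalgebra ℂ R) {a : R} (ha : a ∈ S) : qInvExp p a ∈ S :=
  sum_mem fun n _ => S.smul_mem (pow_mem ha n) _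

/-- The divided power `a ^ n / (n)_{q⁻¹}!`. -/
def divPow (p : QParam) (a : R) (n : ℕ) : R := (qInvFactorial p n)⁻¹ • a ^ n

theorem mul_divPow (p : QParam) (a : R) (n : ℕ) :
    a * divPow p a n = qInvNumber p (n + 1) • divPow p a (n + 1) := by
  rw [divPow, divPow, smul_smul, mul_comm (qInvNumber _ _), qInvFactorial_succ_inv_mul,
    mul_smul_comm, pow_succ']

theorem mul_pow_of_commute_up_to {a b : R} {c : ℂ} (h : b * a = c • (a * b)) (n : ℕ) :
    b * a ^ n = c ^ n • (a ^ n * b) := by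
  induction n with
  | zero => simp
  | succ n ih =>
    rw [pow_succ, ← mul_assoc, ih, smul_mul_assoc, mul_assoc, h, mul_smul_comm, smul_smul,
      ← mul_assoc, pow_succ]

theorem mul_divPow_of_commute_up_to (p : QParam) {a b : R} {c : ℂ} (h : b * a = c • (a * b))
    (n : ℕ) : b * divPow p a n = c ^ n • (divPow p a n * b) := by
  rw [divPow, mul_smul_comm, mul_pow_of_commute_up_to h, smul_comm, smul_mul_assoc]

/-- The `q`-binomial formula. -/
theorem divPow_add (p : QParam) {a b : R} (h : b * a = p.base • (a * b)) (n : ℕ) :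
    divPow p (a + b) n = ∑ x ∈ antidiagonal n, divPow p a x.1 * divPow p b x.2 := by
  induction n with
  | zero => simp [divPow, qInvFactorial_zero]
  | succ n ih =>
    have h1 : qInvNumber p (n + 1) • divPow p (a + b) (n + 1) = qInvNumber p (n + 1) •
        ∑ x ∈ antidiagonal (n + 1), divPow p a x.1 * divPow p b x.2 := by
      rw [← mul_divPow, ih, add_mul, Finset.mul_sum, Finset.mul_sum, Finset.smul_sum]
      have h2 : ∀ x ∈ antidiagonal (n + 1),
          qInvNumber p (n + 1) • (divPow p a x.1 * divPow p b x.2) =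
          qInvNumber p x.1 • (divPow p a x.1 * divPow p b x.2) +
          (p.base ^ x.1 * qInvNumber p x.2) • (divPow p a x.1 * divPow p b x.2) := by
        intro x hx
        rw [← mem_antidiagonal.1 hx, qInvNumber_add, add_smul]
      rw [Finset.sum_congr rfl h2, Finset.sum_add_distrib]
      congr 1
      · rw [Finset.Nat.sum_antidiagonal_succ]
        simp only [qInvNumber_zero, zero_smul, zero_add]
        refine Finset.sum_congr rfl fun x _ => ?_
        rw [← mul_assoc, mul_divPow, smul_mul_assoc]
      · rw [Finset.Nat.sum_antidiagonal_succ']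
        simp only [qInvNumber_zero, mul_zero, zero_smul, zero_add]
        refine Finset.sum_congr rfl fun x _ => ?_
        rw [← mul_assoc, mul_divPow_of_commute_up_to p h, smul_mul_assoc, mul_assoc, mul_divPow,
          mul_smul_comm, smul_smul]
    have h3 := congrArg (fun y => (qInvNumber p (n + 1))⁻¹ • y) h1
    simpa [smul_smul, inv_mul_cancel₀ (qInvNumber_succ_ne_zero p n)] using h3

theorem divPow_eq_zero (p : QParam) {a : R} {N n : ℕ} (h : a ^ N = 0) (hn : N ≤ n) :
    divPow p a n = 0 := by
  rw [divPow, pow_eq_zero_of_le hn h, smul_zero]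

/-- The addition theorem `e^{a + b} = e^a e^b` for `b a = q⁻² a b`. -/
theorem qInvExp_add (p : QParam) {a b : R} (h : b * a = p.base • (a * b)) (ha : IsNilpotent a)
    (hb : IsNilpotent b) :
    IsNilpotent (a + b) ∧ qInvExp p (a + b) = qInvExp p a * qInvExp p b := by
  obtain ⟨K, hK⟩ := ha
  obtain ⟨L, hL⟩ := hb
  have h0 : ∀ j l, K + L ≤ j + l → divPow p a j * divPow p b l = 0 := by
    intro j l hjl
    rcases le_total K j with h1 | h1
    · rw [divPow_eq_zero p hK h1, zero_mul]
    · rw [divPow_eq_zero p hL (show L ≤ l by omega), mul_zero]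
  have hab : (a + b) ^ (K + L) = 0 := by
    have h1 : divPow p (a + b) (K + L) = 0 := by
      rw [divPow_add p h]
      refine Finset.sum_eq_zero fun x hx => h0 _ _ (mem_antidiagonal.1 hx).ge
    rw [divPow, smul_eq_zero] at h1
    exact h1.resolve_left (inv_ne_zero (qInvFactorial_ne_zero p _))
  refine ⟨⟨_, hab⟩, ?_⟩
  rw [qInvExp_eq_sum p hab, qInvExp_eq_sum p (pow_eq_zero_of_le (Nat.le_add_right K L) hK),
    qInvExp_eq_sum p (pow_eq_zero_of_le (Nat.le_add_left L K) hL), Finset.sum_mul_sum]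
  exact ((sum_range_mul_eq_sum_antidiagonal (fun j l => divPow p a j * divPow p b l) _ h0).trans
    (Finset.sum_congr rfl fun k _ => (divPow_add p h k).symm)).symm

/-- Conjugation of `b` by `e^a` for `a b = q⁻² b a`. -/
theorem qInvExp_mul_of_commute_up_to (p : QParam) {a b : R} (h : a * b = p.base • (b * a))
    (ha : IsNilpotent a) :
    qInvExp p a * b = (b + (a * b - b * a)) * qInvExp p a := by
  obtain ⟨N, hN⟩ := ha
  have h1 : ∀ n, divPow p a n * b = p.base ^ n • (b * divPow p a n) := by
    intro n
    have h2 : b * a = p.base⁻¹ • (a * b) := by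
      rw [h, smul_smul, inv_mul_cancel₀ p.base_ne_zero, one_smul]
    rw [mul_divPow_of_commute_up_to p h2, smul_smul, ← mul_pow, mul_inv_cancel₀ p.base_ne_zero,
      one_pow, one_smul]
  have h3 : (a * b - b * a) = (p.base - 1) • (b * a) := by rw [h, sub_smul, one_smul]
  have h4 : ∀ n, (p.base ^ n - 1) • divPow p a n =
      (p.base - 1) • (qInvNumber p n • divPow p a n) := by
    intro n
    rw [smul_smul, qInvNumber_eq]
    congr 1
    have := p.one_sub_base_ne_zero
    field_simp
    ring
  have h5 : ∑ n ∈ Finset.range (N + 1), qInvNumber p n • divPow p a n =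
      a * ∑ n ∈ Finset.range (N + 1), divPow p a n := by
    rw [Finset.sum_range_succ', Finset.sum_range_succ, mul_add, Finset.mul_sum,
      divPow_eq_zero p hN le_rfl, mul_zero, add_zero, qInvNumber_zero, zero_smul, add_zero]
    exact Finset.sum_congr rfl fun n _ => (mul_divPow p a n).symm
  rw [h3, qInvExp_eq_sum p (N := N + 1) (pow_eq_zero_of_le (Nat.le_succ N) hN)]
  change (∑ n ∈ Finset.range (N + 1), divPow p a n) * b =
    _ * (∑ n ∈ Finset.range (N + 1), divPow p a n)
  rw [add_mul, smul_mul_assoc, mul_assoc, ← h5, Finset.sum_mul, Finset.mul_sum, Finset.mul_sum,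
    Finset.smul_sum, ← Finset.sum_add_distrib]
  refine Finset.sum_congr rfl fun n _ => ?_
  rw [h1, ← mul_smul_comm, ← mul_smul_comm, ← h4, ← mul_add, sub_smul, one_smul,
    add_sub_cancel]

/-- The commutator of `g` with a divided power of `a`, for `g` such that `[a, g]` is a difference of
two elements which commute with `a` up to powers of `q`. -/
theorem divPow_mul_sub (p : QParam) {a g s t : R} (h : a * g - g * a = s - t)
    (hs : a * s = p.base • (s * a)) (ht : t * a = p.base • (a * t)) (n : ℕ) :
    divPow p a (n + 1) * g - g * divPow p a (n + 1) = s * divPow p a n - divPow p a n * t := by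
  have key : ∀ n : ℕ, a ^ (n + 1) * g - g * a ^ (n + 1) =
      qInvNumber p (n + 1) • (s * a ^ n - a ^ n * t) := by
    intro n
    induction n with
    | zero => simpa [qInvNumber_eq, div_self p.one_sub_base_ne_zero] using h
    | succ n ih =>
      have h1 : a ^ (n + 1 + 1) * g - g * a ^ (n + 1 + 1) =
          a * (a ^ (n + 1) * g - g * a ^ (n + 1)) + (a * g - g * a) * a ^ (n + 1) := by
        rw [pow_succ' a (n + 1)]; noncomm_ring
      have h2 : a * (s * a ^ n) = p.base • (s * a ^ (n + 1)) := by
        rw [← mul_assoc, hs, smul_mul_assoc, mul_assoc, pow_succ']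
      have h5 : qInvNumber p 1 = 1 := by
        simp [qInvNumber_eq, div_self p.one_sub_base_ne_zero]
      have h3 : qInvNumber p (n + 1 + 1) = 1 + p.base * qInvNumber p (n + 1) := by
        rw [add_comm (n + 1) 1, qInvNumber_add, h5, pow_one]
      have h4 : qInvNumber p (n + 1 + 1) = qInvNumber p (n + 1) + p.base ^ (n + 1) := by
        rw [qInvNumber_add, h5, mul_one]
      rw [h1, ih, h, mul_smul_comm, mul_sub, h2, sub_mul, mul_pow_of_commute_up_to ht,
        ← mul_assoc, ← pow_succ', smul_sub, smul_smul, smul_sub]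
      nth_rewrite 1 [h3]
      rw [h4, add_smul, add_smul, one_smul, mul_comm (p.base)]
      abel
  simp only [divPow]
  rw [smul_mul_assoc, mul_smul_comm, ← smul_sub, key, smul_smul,
    qInvFactorial_succ_inv_mul, smul_sub, mul_smul_comm, smul_mul_assoc]

/-- If `[a, g] = s - t` with `a s = q⁻² s a` and `t a = q⁻² a t`, then
`e^a (g + t) = (g + s) e^a`. -/
theorem qInvExp_mul_add (p : QParam) {a g s t : R} (h : a * g - g * a = s - t)
    (hs : a * s = p.base • (s * a)) (ht : t * a = p.base • (a * t)) (ha : IsNilpotent a) :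
    qInvExp p a * (g + t) = (g + s) * qInvExp p a := by
  obtain ⟨N, hN⟩ := ha
  have e1 : qInvExp p a = ∑ n ∈ Finset.range (N + 1), divPow p a n :=
    qInvExp_eq_sum p (pow_eq_zero_of_le (Nat.le_succ N) hN)
  have e2 : qInvExp p a = ∑ n ∈ Finset.range N, divPow p a n := qInvExp_eq_sum p hN
  have h1 : qInvExp p a * g - g * qInvExp p a = s * qInvExp p a - qInvExp p a * t := by
    nth_rewrite 1 2 [e1]
    rw [e2, Finset.sum_range_succ', add_mul, mul_add, Finset.sum_mul, Finset.mul_sum,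
      Finset.mul_sum, Finset.sum_mul, ← Finset.sum_sub_distrib]
    rw [show ∀ A B C D : R, A + B - (C + D) = (A - C) + (B - D) by intros; abel,
      ← Finset.sum_sub_distrib, Finset.sum_congr rfl fun n _ => divPow_mul_sub p h hs ht n]
    simp [divPow]
  rw [mul_add, add_mul, ← sub_eq_zero]
  rw [← sub_eq_zero] at h1
  rw [← h1]
  abel

end QExp

/-! ### Inverses of unipotent elements -/

theorem inverse_eq_of_mul_eq_one {R : Type*} [MonoidWithZero R] {a b : R} (h1 : a * b = 1)
    (h2 : b * a = 1) : Ring.inverse a = b :=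
  Ring.inverse_unit (⟨a, b, h1, h2⟩ : Rˣ)

theorem map_ringInverse {R S : Type*} [Ring R] [Ring S] (φ : R →+* S) {a : R} (ha : IsUnit a) :
    φ (Ring.inverse a) = Ring.inverse (φ a) :=
  (inverse_eq_of_mul_eq_one (by rw [← map_mul, Ring.mul_inverse_cancel a ha, map_one])
    (by rw [← map_mul, Ring.inverse_mul_cancel a ha, map_one])).symm

theorem isUnit_of_isNilpotent_sub_one {R : Type*} [Ring R] {a : R} (h : IsNilpotent (a - 1)) :
    IsUnit a := by
  simpa using h.isUnit_add_one

theorem inverse_mem_of_isNilpotent {R : Type*} [Ring R] (S : Subring R) {a : R} (ha : a ∈ S)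
    (h : IsNilpotent (a - 1)) : Ring.inverse a ∈ S := by
  obtain ⟨N, hN⟩ := h
  have hN' : (1 - a) ^ N = 0 := by rw [← neg_sub, neg_pow, hN, mul_zero]
  have h1 := mul_neg_geom_sum (1 - a) N
  have h2 := geom_sum_mul_neg (1 - a) N
  rw [hN', sub_sub_cancel, sub_zero] at h1 h2
  rw [inverse_eq_of_mul_eq_one h1 h2]
  exact sum_mem fun i _ => pow_mem (sub_mem S.one_mem ha) _

theorem isNilpotent_qInvExp_sub_one (p : QParam) {R : Type} [Ring R] [Algebra ℂ R] {a : R}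
    (ha : IsNilpotent a) : IsNilpotent (qInvExp p a - 1) := by
  obtain ⟨N, hN⟩ := ha
  rw [qInvExp_eq_sum p (N := N + 1) (pow_eq_zero_of_le (Nat.le_succ N) hN),
    Finset.sum_range_succ', qInvFactorial_zero, pow_zero, inv_one, one_smul, add_sub_cancel_right]
  have h1 : ∑ n ∈ Finset.range N, (qInvFactorial p (n + 1))⁻¹ • a ^ (n + 1) =
      (∑ n ∈ Finset.range N, (qInvFactorial p (n + 1))⁻¹ • a ^ n) * a := by
    rw [Finset.sum_mul]
    exact Finset.sum_congr rfl fun n _ => by rw [pow_succ, smul_mul_assoc]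
  rw [h1]
  refine ⟨N, ?_⟩
  rw [Commute.mul_pow, hN, mul_zero]
  exact Commute.sum_left _ _ _ fun n _ => (Commute.pow_left (Commute.refl a) n).smul_left _

theorem isUnit_qInvExp (p : QParam) {R : Type} [Ring R] [Algebra ℂ R] {a : R}
    (ha : IsNilpotent a) : IsUnit (qInvExp p a) :=
  isUnit_of_isNilpotent_sub_one (isNilpotent_qInvExp_sub_one p ha)

/-! ### Weight gradings -/

/-- A complete finite system of orthogonal idempotents indexed by weights. -/
structure WeightGrading (R : Type*) [Ring R] where
  proj : ℤ → R
  supp : Finset ℤ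
  proj_mul_self : ∀ m, proj m * proj m = proj m
  proj_mul_of_ne : ∀ m n, m ≠ n → proj m * proj n = 0
  sum_proj : ∑ m ∈ supp, proj m = 1

/-- `a` maps weight `m` to weights at most `m - d`. -/
def IsLower {R : Type*} [Ring R] (G : WeightGrading R) (d : ℤ) (a : R) : Prop :=
  ∀ m m' : ℤ, ¬ m' + d ≤ m → G.proj m' * a * G.proj m = 0

section Grading

variable {R : Type*} [Ring R] {G : WeightGrading R}

theorem WeightGrading.ext_of_proj (G : WeightGrading R) {a b : R}
    (h : ∀ m m', G.proj m' * a * G.proj m = G.proj m' * b * G.proj m) : a = b := by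
  have key : ∀ c : R, c = ∑ m' ∈ G.supp, ∑ m ∈ G.supp, G.proj m' * c * G.proj m := by
    intro c
    simp_rw [← Finset.mul_sum, ← Finset.sum_mul, G.sum_proj, one_mul, mul_one]
  rw [key a, key b]
  exact Finset.sum_congr rfl fun _ _ => Finset.sum_congr rfl fun _ _ => h _ _

theorem IsLower.mono {d d' : ℤ} {a : R} (h : IsLower G d a) (hd : d' ≤ d) : IsLower G d' a :=
  fun m m' hm => h m m' (by omega)

theorem IsLower.add {d : ℤ} {a b : R} (ha : IsLower G d a) (hb : IsLower G d b) :
    IsLower G d (a + b) := fun m m' hm => by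
  rw [mul_add, add_mul, ha m m' hm, hb m m' hm, add_zero]

theorem IsLower.neg {d : ℤ} {a : R} (ha : IsLower G d a) : IsLower G d (-a) := fun m m' hm => by
  rw [mul_neg, neg_mul, ha m m' hm, neg_zero]

theorem IsLower.sub {d : ℤ} {a b : R} (ha : IsLower G d a) (hb : IsLower G d b) :
    IsLower G d (a - b) := by
  rw [sub_eq_add_neg]; exact ha.add hb.neg

theorem IsLower.zero (d : ℤ) : IsLower G d (0 : R) := fun m m' _ => by simp

theorem IsLower.sum {ι : Type*} {d : ℤ} {s : Finset ι} {a : ι → R}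
    (h : ∀ i ∈ s, IsLower G d (a i)) : IsLower G d (∑ i ∈ s, a i) :=
  Finset.sum_induction _ _ (fun _ _ => IsLower.add) (IsLower.zero d) h

theorem IsLower.of_mul_proj {a : R} (d : ℤ) (h : ∀ m, a * G.proj m = G.proj (m - d) * a) :
    IsLower G d a := fun m m' hm => by
  rw [mul_assoc, h, ← mul_assoc, G.proj_mul_of_ne _ _ (by omega), zero_mul]

theorem IsLower.of_commute {a : R} (h : ∀ m, Commute a (G.proj m)) : IsLower G 0 a :=
  IsLower.of_mul_proj 0 fun m => by rw [sub_zero]; exact h m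

theorem IsLower.one : IsLower G 0 (1 : R) := IsLower.of_commute fun _ => Commute.one_left _

theorem IsLower.mul {d d' : ℤ} {a b : R} (ha : IsLower G d a) (hb : IsLower G d' b) :
    IsLower G (d + d') (a * b) := fun m m' hm => by
  have h1 : a * b = ∑ n ∈ G.supp, a * G.proj n * (G.proj n * b) := by
    simp_rw [mul_assoc, ← mul_assoc (G.proj _), G.proj_mul_self, ← Finset.mul_sum,
      ← Finset.sum_mul, G.sum_proj, one_mul]
  rw [h1, Finset.mul_sum, Finset.sum_mul]
  refine Finset.sum_eq_zero fun n _ => ?_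
  rw [show G.proj m' * (a * G.proj n * (G.proj n * b)) * G.proj m =
    (G.proj m' * a * G.proj n) * (G.proj n * b * G.proj m) by simp only [mul_assoc]]
  by_cases hn : m' + d ≤ n
  · rw [hb m n (by omega), mul_zero]
  · rw [ha n m' hn, zero_mul]

theorem IsLower.weak_mul {d : ℤ} {a b : R} (ha : IsLower G 0 a) (hb : IsLower G d b) :
    IsLower G d (a * b) := by
  simpa using ha.mul hb

theorem IsLower.mul_weak {d : ℤ} {a b : R} (ha : IsLower G d a) (hb : IsLower G 0 b) :
    IsLower G d (a * b) := by
  simpa using ha.mul hb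

theorem IsLower.pow {d : ℤ} {a : R} (ha : IsLower G d a) (k : ℕ) : IsLower G (k * d) (a ^ k) := by
  induction k with
  | zero => simpa using IsLower.one
  | succ k ih =>
    rw [pow_succ]
    convert ih.mul ha using 1
    push_cast; ring

/-- Operators which do not raise weights form a subring. -/
def WeightGrading.lowerSubring (G : WeightGrading R) : Subring R where
  carrier := {a | IsLower G 0 a}
  mul_mem' := IsLower.weak_mul
  one_mem' := IsLower.one
  add_mem' := IsLower.add
  zero_mem' := IsLower.zero 0
  neg_mem' := IsLower.neg

theorem IsLower.isNilpotent {a : R} (ha : IsLower G 1 a) : IsNilpotent a := by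
  obtain ⟨M, hM⟩ := G.supp.bddAbove
  obtain ⟨L, hL⟩ := G.supp.bddBelow
  refine ⟨(M - L + 1).toNat, ?_⟩
  have h1 := ha.pow (M - L + 1).toNat
  have h2 : ∀ c : R, c = ∑ m' ∈ G.supp, ∑ m ∈ G.supp, G.proj m' * c * G.proj m := by
    intro c
    simp_rw [← Finset.mul_sum, ← Finset.sum_mul, G.sum_proj, one_mul, mul_one]
  rw [h2 (a ^ _)]
  refine Finset.sum_eq_zero fun m' hm' => Finset.sum_eq_zero fun m hm => h1 m m' ?_
  have := hM hm
  have := hL hm'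
  have := Int.self_le_toNat (M - L + 1)
  simp only [mul_one]
  omega

theorem IsLower.sub_one_mul {a b : R} (ha : IsLower G 1 (a - 1)) (hb : IsLower G 1 (b - 1)) :
    IsLower G 1 (a * b - 1) := by
  have : a * b - 1 = (a - 1) * (b - 1) + (a - 1) + (b - 1) := by noncomm_ring
  rw [this]
  exact (((ha.mul hb).mono (by norm_num)).add ha).add hb

theorem IsLower.of_sub_one {a : R} (ha : IsLower G 1 (a - 1)) : IsLower G 0 a := by
  simpa using (ha.mono zero_le_one).add IsLower.one

theorem IsLower.inverse {a : R} (ha : IsLower G 1 (a - 1)) : IsLower G 0 (Ring.inverse a) :=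
  inverse_mem_of_isNilpotent G.lowerSubring ha.of_sub_one ha.isNilpotent

theorem IsLower.inverse_sub_one {a : R} (ha : IsLower G 1 (a - 1)) :
    IsLower G 1 (Ring.inverse a - 1) := by
  have h : Ring.inverse a - 1 = - (Ring.inverse a * (a - 1)) := by
    rw [mul_sub, Ring.inverse_mul_cancel a (isUnit_of_isNilpotent_sub_one ha.isNilpotent), mul_one]
    abel
  rw [h]
  exact (ha.inverse.weak_mul ha).neg

theorem IsLower.conj {d : ℤ} {a b b' : R} (ha : IsLower G d a) (hb : ∀ m, Commute b (G.proj m))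
    (hb' : ∀ m, Commute b' (G.proj m)) : IsLower G d (b * a * b') := by
  exact ((IsLower.of_commute hb).weak_mul ha).mul_weak (IsLower.of_commute hb')

theorem IsLower.conj_sub_one {a b b' : R} (ha : IsLower G 1 (a - 1))
    (hb : ∀ m, Commute b (G.proj m)) (hb' : ∀ m, Commute b' (G.proj m)) (h : b * b' = 1) :
    IsLower G 1 (b * a * b' - 1) := by
  have : b * a * b' - 1 = b * (a - 1) * b' := by rw [mul_sub, mul_one, sub_mul, h]
  rw [this]
  exact ha.conj hb hb'

theorem IsLower.qInvExp_sub_one (p : QParam) {R : Type} [Ring R] [Algebra ℂ R]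
    {G : WeightGrading R} {a : R} (ha : IsLower G 1 a) : IsLower G 1 (qInvExp p a - 1) := by
  obtain ⟨N, hN⟩ := ha.isNilpotent
  rw [qInvExp_eq_sum p (N := N + 1) (pow_eq_zero_of_le (Nat.le_succ N) hN),
    Finset.sum_range_succ', qInvFactorial_zero, pow_zero, inv_one, one_smul, add_sub_cancel_right]
  refine IsLower.sum fun n _ m m' hm => ?_
  rw [mul_smul_comm, smul_mul_assoc, (ha.pow (n + 1)).mono (d' := 1) _ m m' hm, smul_zero]
  push_cast
  omega

/-- The grading with all weights negated. -/
def WeightGrading.opposite (G : WeightGrading R) : WeightGrading R where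
  proj m := G.proj (-m)
  supp := G.supp.image Neg.neg
  proj_mul_self m := G.proj_mul_self _
  proj_mul_of_ne m n h := G.proj_mul_of_ne _ _ (by omega)
  sum_proj := by
    rw [Finset.sum_image (fun a _ b _ h => neg_injective h)]
    simpa using G.sum_proj

/-- Uniqueness for the linear equation `β X = T X β`: if `T` is unipotent, and `β` acts on the
weight spaces by pairwise different scalars, then the only strictly lower solution is zero. -/
theorem eq_zero_of_intertwines {k : Type*} [Field k] [Algebra k R] {β T X : R} {b : ℤ → k}
    (hb : Function.Injective b) (hβl : ∀ m, G.proj m * β = b m • G.proj m)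
    (hβr : ∀ m, β * G.proj m = b m • G.proj m) (hT : IsLower G 1 (T - 1)) (hX : IsLower G 1 X)
    (h : β * X = T * X * β) : X = 0 := by
  -- Induction on the distance between the weights. If the entries of `X` over smaller distances
  -- vanish, then the equation says `b m' = b m` or that the entry from `m` to `m'` is zero.
  have key : ∀ n : ℕ, ∀ m m' : ℤ, m - m' ≤ n → G.proj m' * X * G.proj m = 0 := by
    intro n
    induction n with
    | zero => intro m m' hm; exact hX m m' (by push_cast at hm; omega)
    | succ n ih =>
      intro m m' hm
      have hmm : m ≠ m' ∨ m = m' := ne_or_eq _ _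
      rcases hmm with hne | rfl
      swap
      · exact hX m m (by omega)
      have h1 : G.proj m' * ((T - 1) * X) * G.proj m = 0 := by
        have hs : (T - 1) * X = ∑ l ∈ G.supp, (T - 1) * G.proj l * (G.proj l * X) := by
          simp_rw [mul_assoc, ← mul_assoc (G.proj _), G.proj_mul_self, ← Finset.mul_sum,
            ← Finset.sum_mul, G.sum_proj, one_mul]
        rw [hs, Finset.mul_sum, Finset.sum_mul]
        refine Finset.sum_eq_zero fun l _ => ?_
        rw [show G.proj m' * ((T - 1) * G.proj l * (G.proj l * X)) * G.proj m =
          (G.proj m' * (T - 1) * G.proj l) * (G.proj l * X * G.proj m) by simp only [mul_assoc]]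
        by_cases hl : m' + 1 ≤ l
        · rw [ih m l (by push_cast at hm; omega), mul_zero]
        · rw [hT l m' hl, zero_mul]
      have h2 : G.proj m' * (T * X) * G.proj m = G.proj m' * X * G.proj m := by
        rw [← sub_eq_zero, ← sub_mul, ← mul_sub, ← h1, sub_mul T 1 X, one_mul]
      have h3 : b m' • (G.proj m' * X * G.proj m) = b m • (G.proj m' * X * G.proj m) := by
        calc b m' • (G.proj m' * X * G.proj m) = G.proj m' * (β * X) * G.proj m := by
              rw [← mul_assoc, hβl, smul_mul_assoc, smul_mul_assoc]
          _ = G.proj m' * (T * X) * (β * G.proj m) := by rw [h]; simp only [mul_assoc]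
          _ = _ := by rw [hβr, mul_smul_comm, h2]
      rw [← sub_eq_zero, ← sub_smul, smul_eq_zero, sub_eq_zero] at h3
      exact h3.resolve_left fun h4 => hne (hb h4).symm
  refine G.ext_of_proj fun m m' => ?_
  rw [key (m - m').toNat m m' (Int.self_le_toNat _)]
  simp

end Grading

/-! ### Series solutions of linear equations -/

section Series

variable {ι k : Type} [Field k]

/-- The coefficients `c n`, functions on the weights `i ∈ ι`, of the solution
`X = 1 + ∑ c n fⁿ` of `β X = T X β`, where `T = 1 + ∑ t n fⁿ`, where `β` acts by the function `b`,
and where `f g(i) = g(σ i) f`. -/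
def seriesCoeff (σ : ι → ι) (t : ℕ → ι → k) (b : ι → k) : ℕ → ι → k
  | 0 => 1
  | n + 1 => fun i => (b i / b (σ^[n + 1] i) - 1)⁻¹ *
      ∑ j : Fin (n + 1), t (j + 1) i * seriesCoeff σ t b (n - j) (σ^[j + 1] i)
  decreasing_by omega

theorem seriesCoeff_zero (σ : ι → ι) (t : ℕ → ι → k) (b : ι → k) : seriesCoeff σ t b 0 = 1 := by
  rw [seriesCoeff]

theorem seriesCoeff_succ (σ : ι → ι) (t : ℕ → ι → k) (b : ι → k) (n : ℕ) (i : ι) :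
    seriesCoeff σ t b (n + 1) i = (b i / b (σ^[n + 1] i) - 1)⁻¹ *
      ∑ x ∈ antidiagonal n, t (x.1 + 1) i * seriesCoeff σ t b x.2 (σ^[x.1 + 1] i) := by
  rw [seriesCoeff]
  beta_reduce
  rw [Fin.sum_univ_eq_sum_range
    (fun j => t (j + 1) i * seriesCoeff σ t b (n - j) (σ^[j + 1] i)),
    Finset.Nat.sum_antidiagonal_eq_sum_range_succ
      (fun j l => t (j + 1) i * seriesCoeff σ t b l (σ^[j + 1] i))]

theorem seriesCoeff_spec {σ : ι → ι} {t : ℕ → ι → k} {b : ι → k} (ht : t 0 = 1)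
    (hb : ∀ i, b i ≠ 0) (hσ : ∀ n i, b i ≠ b (σ^[n + 1] i)) (n : ℕ) (i : ι) :
    b i * seriesCoeff σ t b n i = (∑ x ∈ antidiagonal n,
      t x.1 i * seriesCoeff σ t b x.2 (σ^[x.1] i)) * b (σ^[n] i) := by
  cases n with
  | zero => simp [ht, seriesCoeff_zero]
  | succ n =>
    rw [Finset.Nat.sum_antidiagonal_succ, ht]
    simp only [Pi.one_apply, one_mul, Function.iterate_zero, id_eq]
    have h1 : b i / b (σ^[n + 1] i) - 1 ≠ 0 := by
      rw [sub_ne_zero, Ne, div_eq_one_iff_eq (hb _)]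
      exact hσ n i
    have h2 := seriesCoeff_succ σ t b n i
    rw [eq_inv_mul_iff_mul_eq₀ h1] at h2
    rw [← h2]
    have h3 := hb (σ^[n + 1] i)
    field_simp
    ring

theorem seriesCoeff_mem {σ : ι → ι} {t : ℕ → ι → k} {b : ι → k} (S : Subfield k)
    (ht : ∀ n i, t n i ∈ S) (hb : ∀ n i, b i / b (σ^[n] i) ∈ S) (n : ℕ) (i : ι) :
    seriesCoeff σ t b n i ∈ S := by
  induction n using Nat.strong_induction_on generalizing i with
  | _ n ih =>
    cases n with
    | zero => rw [seriesCoeff_zero]; exact S.one_mem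
    | succ n =>
      rw [seriesCoeff_succ]
      refine S.mul_mem (S.inv_mem (S.sub_mem (hb _ _) S.one_mem)) (sum_mem fun x hx => ?_)
      refine S.mul_mem (ht _ _) (ih _ ?_ _)
      have := mem_antidiagonal.1 hx
      omega

/-- If `τ` acts on the data by the permutation `π` of the weights, then also on the solution. -/
theorem seriesCoeff_equivariant {σ : ι → ι} {t : ℕ → ι → k} {b : ι → k} (τ : k →+* k) (π : ι → ι)
    (hπ : Function.Semiconj π σ σ) (ht : ∀ n i, τ (t n i) = t n (π i))
    (hb : ∀ n i, τ (b i / b (σ^[n] i)) = b (π i) / b (σ^[n] (π i))) (n : ℕ) (i : ι) :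
    τ (seriesCoeff σ t b n i) = seriesCoeff σ t b n (π i) := by
  induction n using Nat.strong_induction_on generalizing i with
  | _ n ih =>
    cases n with
    | zero => rw [seriesCoeff_zero]; exact map_one τ
    | succ n =>
      rw [seriesCoeff_succ, seriesCoeff_succ, map_mul, map_inv₀, map_sub, hb, map_one, map_sum]
      congr 1
      refine Finset.sum_congr rfl fun x hx => ?_
      have := mem_antidiagonal.1 hx
      rw [map_mul, ht, ih x.2 (by omega), (hπ.iterate_right (x.1 + 1)) i]

/-- The coefficients of the `q`-exponential of `g f`, where `f g(i) = g(σ i) f`. -/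
def expCoeff (p : QParam) [Algebra ℂ k] (σ : ι → ι) (g : ι → k) (n : ℕ) (i : ι) : k :=
  (qInvFactorial p n)⁻¹ • ∏ l ∈ Finset.range n, g (σ^[l] i)

variable {R : Type} [Ring R]

theorem pow_mul_function {χ : (ι → k) →+* R} {f : R} {σ : ι → ι}
    (hf : ∀ g : ι → k, f * χ g = χ (g ∘ σ) * f) (n : ℕ) (g : ι → k) :
    f ^ n * χ g = χ (g ∘ σ^[n]) * f ^ n := by
  induction n generalizing g with
  | zero => simp
  | succ n ih =>
    rw [pow_succ, mul_assoc, hf, ← mul_assoc, ih, mul_assoc, Function.comp_assoc,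
      Function.iterate_succ']

theorem function_mul_pow {χ : (ι → k) →+* R} {f : R} {σ : ι → ι}
    (hf : ∀ g : ι → k, f * χ g = χ (g ∘ σ) * f) (g : ι → k) (n : ℕ) :
    (χ g * f) ^ n = χ (fun i => ∏ l ∈ Finset.range n, g (σ^[l] i)) * f ^ n := by
  induction n with
  | zero =>
    simp only [pow_zero, Finset.range_zero, Finset.prod_empty]
    rw [mul_one]
    exact χ.map_one.symm
  | succ n ih =>
    have : (fun i => ∏ l ∈ Finset.range (n + 1), g (σ^[l] i)) =
        (fun i => ∏ l ∈ Finset.range n, g (σ^[l] i)) * (g ∘ σ^[n]) := by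
      ext i; simp [Finset.prod_range_succ]
    rw [pow_succ, ih, this, map_mul, mul_assoc, ← mul_assoc (f ^ n), pow_mul_function hf,
      mul_assoc, mul_assoc, pow_succ]

/-- The element `∑ c n fⁿ`, for nilpotent `f`. -/
def evalSeries (χ : (ι → k) →+* R) (f : R) (c : ℕ → ι → k) : R :=
  ∑ n ∈ Finset.range (nilpotencyClass f), χ (c n) * f ^ n

theorem evalSeries_eq_sum (χ : (ι → k) →+* R) {f : R} (c : ℕ → ι → k) {N : ℕ} (h : f ^ N = 0) :
    evalSeries χ f c = ∑ n ∈ Finset.range N, χ (c n) * f ^ n := by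
  have hle := nilpotencyClass_le_of_pow_eq_zero h
  refine Finset.sum_subset (Finset.range_subset_range.2 hle) fun n _ hn => ?_
  rw [pow_eq_zero_of_le (by simpa using hn) (pow_nilpotencyClass ⟨N, h⟩), mul_zero]

theorem qInvExp_eq_evalSeries (p : QParam) [Algebra ℂ k] [Algebra ℂ R] {χ : (ι → k) →+* R} {f : R}
    {σ : ι → ι} (hf : ∀ g : ι → k, f * χ g = χ (g ∘ σ) * f) (hχ : ∀ (z : ℂ) g, χ (z • g) = z • χ g)
    (hn : IsNilpotent f) (g : ι → k) :
    qInvExp p (χ g * f) = evalSeries χ f (expCoeff p σ g) := by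
  obtain ⟨N, hN⟩ := hn
  rw [qInvExp_eq_sum p (N := N) (by rw [function_mul_pow hf, hN, mul_zero]),
    evalSeries_eq_sum χ _ hN]
  refine Finset.sum_congr rfl fun n _ => ?_
  rw [function_mul_pow hf, ← smul_mul_assoc, ← hχ]
  rfl

/-- The series with coefficients `seriesCoeff` solves `β X = T X β`. -/
theorem evalSeries_intertwines {χ : (ι → k) →+* R} {f : R} {σ : ι → ι}
    (hf : ∀ g : ι → k, f * χ g = χ (g ∘ σ) * f) (hn : IsNilpotent f) {t : ℕ → ι → k} {b : ι → k}
    (ht : t 0 = 1) (hb : ∀ i, b i ≠ 0) (hσ : ∀ n i, b i ≠ b (σ^[n + 1] i)) :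
    χ b * evalSeries χ f (seriesCoeff σ t b) =
      evalSeries χ f t * evalSeries χ f (seriesCoeff σ t b) * χ b := by
  obtain ⟨N, hN⟩ := hn
  set c := seriesCoeff σ t b with hc
  rw [evalSeries_eq_sum χ c hN, evalSeries_eq_sum χ t hN, Finset.sum_mul_sum,
    sum_range_mul_eq_sum_antidiagonal (fun j l => χ (t j) * f ^ j * (χ (c l) * f ^ l)),
    Finset.mul_sum, Finset.sum_mul]
  · refine Finset.sum_congr rfl fun n _ => ?_
    have h1 : ∀ x ∈ antidiagonal n, χ (t x.1) * f ^ x.1 * (χ (c x.2) * f ^ x.2) =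
        χ (t x.1 * (c x.2 ∘ σ^[x.1])) * f ^ n := by
      intro x hx
      rw [mul_assoc, ← mul_assoc (f ^ x.1), pow_mul_function hf, ← mem_antidiagonal.1 hx,
        pow_add, map_mul]
      simp only [mul_assoc]
    rw [Finset.sum_congr rfl h1, ← Finset.sum_mul, ← map_sum, mul_assoc, pow_mul_function hf,
      ← mul_assoc, ← mul_assoc, ← map_mul, ← map_mul]
    congr 2
    ext i
    simpa [Finset.sum_apply] using seriesCoeff_spec ht hb hσ n i
  · intro j l hjl
    rw [mul_assoc, ← mul_assoc (f ^ j), pow_mul_function hf, mul_assoc, ← pow_add,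
      pow_eq_zero_of_le hjl hN, mul_zero, mul_zero]

end Series

section Instances

-- Shortcuts to the instances on `ℂ(ν̃) ⊗ End V`, whose search through the tensor product is slow.

variable (V : Type) [AddCommGroup V] [Module ℂ V]

instance : Ring (Op V) := Algebra.TensorProduct.instRing
instance : Semiring (Op V) := Algebra.TensorProduct.instSemiring
instance : NonAssocSemiring (Op V) := inferInstance
instance : Mul (Op V) := inferInstance
instance : AddCommMonoid (Op V) := inferInstance
instance : Algebra ℂ (Op V) := inferInstance
instance : Algebra Fld (Op V) := inferInstance
instance : Module Fld (Op V) := inferInstance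

end Instances

/-! ### Weight projections -/

section Proj

variable {p : QParam} (V W : Rep p)

theorem Rep.proj_apply_of_mem {m : ℤ} {v : V.V} (hv : v ∈ weightSpace p V.ρ m) (n : ℤ) :
    V.proj n v = if n = m then v else 0 := by
  split_ifs with h
  · subst h
    exact Submodule.projection_apply_of_mem_left (V.isCompl p n) hv
  · refine (Submodule.projection_apply_eq_zero_iff (V.isCompl p n)).2 ?_
    exact Submodule.mem_iSup_of_mem m (Submodule.mem_iSup_of_mem (Ne.symm h) hv)

theorem Rep.proj_mem (m : ℤ) (v : V.V) : V.proj m v ∈ weightSpace p V.ρ m :=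
  Submodule.projection_apply_mem (V.isCompl p m) v

/-- Linear maps out of a representation are determined by their values on weight vectors. -/
theorem Rep.hom_ext {X : Type*} [AddCommGroup X] [Module ℂ X] {A B : V.V →ₗ[ℂ] X}
    (h : ∀ m, ∀ v ∈ weightSpace p V.ρ m, A v = B v) : A = B := by
  ext v
  have hv : v ∈ ⨆ m : ℤ, weightSpace p V.ρ m := by rw [V.iSup_weightSpace]; trivial
  induction hv using Submodule.iSup_induction' with
  | zero => simp
  | add x y _ _ hx hy => simp [hx, hy]
  | mem m v hv => exact h m v hv

theorem Rep.proj_mul_self (m : ℤ) : V.proj m * V.proj m = V.proj m := by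
  ext v
  rw [Module.End.mul_apply, V.proj_apply_of_mem (V.proj_mem m v), if_pos rfl]

theorem Rep.proj_mul_of_ne {m n : ℤ} (h : m ≠ n) : V.proj m * V.proj n = 0 := by
  ext v
  rw [Module.End.mul_apply, V.proj_apply_of_mem (V.proj_mem n v), if_neg h, LinearMap.zero_apply]

theorem Rep.mem_weights_of_mem {m : ℤ} {v : V.V} (hv : v ∈ weightSpace p V.ρ m) (h : v ≠ 0) :
    m ∈ V.weights := by
  simp only [Rep.weights, Set.Finite.mem_toFinset, Set.mem_ofPred_eq]
  exact fun h0 => h (by rw [h0] at hv; exact (Submodule.mem_bot ℂ).1 hv)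

theorem Rep.proj_eq_zero {m : ℤ} (h : m ∉ V.weights) : V.proj m = 0 := by
  ext v
  by_contra h0
  exact h (V.mem_weights_of_mem (V.proj_mem m v) h0)

theorem Rep.sum_proj : ∑ m ∈ V.weights, V.proj m = 1 := by
  refine V.hom_ext fun m v hv => ?_
  rw [LinearMap.sum_apply, Finset.sum_congr rfl fun n _ => V.proj_apply_of_mem hv n,
    Finset.sum_ite_eq', Module.End.one_apply]
  split_ifs with h
  · rfl
  · by_contra h0
    exact h (V.mem_weights_of_mem hv fun h1 => h0 h1.symm)

/-- An operator shifting weights by `d` intertwines the weight projections. -/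
theorem Rep.mul_proj_of_shift {A : Module.End ℂ V.V} {d : ℤ}
    (h : ∀ m, ∀ v ∈ weightSpace p V.ρ m, A v ∈ weightSpace p V.ρ (m + d)) (m : ℤ) :
    A * V.proj m = V.proj (m + d) * A := by
  refine V.hom_ext fun n v hv => ?_
  rw [Module.End.mul_apply, Module.End.mul_apply, V.proj_apply_of_mem hv,
    V.proj_apply_of_mem (h n v hv)]
  by_cases hmn : m = n
  · simp [hmn]
  · rw [if_neg hmn, if_neg (by omega), map_zero]

theorem Rep.e_mul_proj (m : ℤ) :
    V.ρ (Uq.of p .e) * V.proj m = V.proj (m + 2) * V.ρ (Uq.of p .e) := by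
  refine V.mul_proj_of_shift (fun m v hv => ?_) m
  rw [mem_weightSpace] at hv ⊢
  intro t
  have := congrArg (fun u => V.ρ u v) (Uq.k_mul_e p t)
  simp only [map_mul, map_smul, Module.End.mul_apply, LinearMap.smul_apply, hv] at this
  rw [this, smul_smul, ← p.pow_add]
  congr 2
  push_cast
  ring

theorem Rep.f_mul_proj (m : ℤ) :
    V.ρ (Uq.of p .f) * V.proj m = V.proj (m + -2) * V.ρ (Uq.of p .f) := by
  refine V.mul_proj_of_shift (fun m v hv => ?_) m
  rw [mem_weightSpace] at hv ⊢
  intro t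
  have := congrArg (fun u => V.ρ u v) (Uq.k_mul_f p t)
  simp only [map_mul, map_smul, Module.End.mul_apply, LinearMap.smul_apply, hv] at this
  rw [this, smul_smul, ← p.pow_add]
  congr 2
  push_cast
  ring

theorem Rep.k_mul_proj (t : ℂ) (m : ℤ) :
    V.ρ (Uq.of p (.k t)) * V.proj m = p.pow (t * m) • V.proj m := by
  ext v
  exact (mem_weightSpace p V.ρ m _).1 (V.proj_mem m v) t

theorem mul_proj_of_isIntertwiner {V W : Rep p} {φ : V.V →ₗ[ℂ] W.V} (hφ : IsIntertwiner φ) (m : ℤ) :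
    φ ∘ₗ V.proj m = W.proj m ∘ₗ φ := by
  refine V.hom_ext fun n v hv => ?_
  have hv' : φ v ∈ weightSpace p W.ρ n := by
    rw [mem_weightSpace] at hv ⊢
    intro t
    rw [← map_smul, ← hv]
    exact (LinearMap.congr_fun (hφ (Uq.of p (.k t))) v).symm
  rw [LinearMap.comp_apply, LinearMap.comp_apply, V.proj_apply_of_mem hv,
    W.proj_apply_of_mem hv']
  split_ifs <;> simp

theorem Rep.tensor_proj_mul (M m n : ℤ) :
    (V.tensor W).proj M * TensorProduct.map (V.proj m) (W.proj n) =
      if m + n = M then TensorProduct.map (V.proj m) (W.proj n) else 0 := by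
  refine TensorProduct.ext' fun v w => ?_
  have h : V.proj m v ⊗ₜ[ℂ] W.proj n w ∈ weightSpace p (V.tensor W).ρ (m + n) := by
    have hv := (mem_weightSpace p V.ρ m _).1 (V.proj_mem m v)
    have hw := (mem_weightSpace p W.ρ n _).1 (W.proj_mem n w)
    rw [mem_weightSpace]
    intro t
    change tensorAction p V W _ _ = _
    rw [tensorAction_k, TensorProduct.map_tmul, hv, hw, TensorProduct.smul_tmul_smul]
    push_cast
    rw [mul_add, p.pow_add]
  have h2 := (V.tensor W).proj_apply_of_mem h M
  rw [Module.End.mul_apply, TensorProduct.map_tmul, h2]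
  by_cases hM : m + n = M
  · rw [if_pos hM, if_pos hM.symm]; rfl
  · rw [if_neg hM, if_neg (Ne.symm hM)]; rfl

end Proj

/-! ### Functions of the weight -/

section FunH

variable {p : QParam} (V W : Rep p)

theorem tmul_eq_smul {V : Type} [AddCommGroup V] [Module ℂ V] (g : Fld) (A : Module.End ℂ V) :
    g ⊗ₜ[ℂ] A = g • ((1 : Fld) ⊗ₜ[ℂ] A) := by
  rw [TensorProduct.smul_tmul', smul_eq_mul, mul_one]

theorem C_smul {V : Type} [AddCommGroup V] [Module ℂ V] (z : ℂ) (a : Op V) :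
    (RatFunc.C z : Fld) • a = z • a := by
  rw [← algebraMap_smul Fld z a]; rfl

theorem projFam_mul_self (m : ℤ) : projFam p m V * projFam p m V = projFam p m V := by
  simp [projFam, V.proj_mul_self]

theorem projFam_mul_of_ne {m n : ℤ} (h : m ≠ n) : projFam p m V * projFam p n V = 0 := by
  simp [projFam, V.proj_mul_of_ne h]

theorem projFam_eq_zero {m : ℤ} (h : m ∉ V.weights) : projFam p m V = 0 := by
  simp [projFam, V.proj_eq_zero h]

theorem sum_projFam : ∑ m ∈ V.weights, projFam p m V = 1 := by
  simp only [projFam]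
  rw [← TensorProduct.tmul_sum, V.sum_proj]; rfl

/-- The decomposition of the operators on `V` by weights. -/
def Rep.grading : WeightGrading (Op V.V) where
  proj m := projFam p m V
  supp := V.weights
  proj_mul_self := projFam_mul_self V
  proj_mul_of_ne _ _ := projFam_mul_of_ne V
  sum_proj := sum_projFam V

/-- The image of a weight decomposition under a ring homomorphism. -/
def WeightGrading.map {R S : Type*} [Ring R] [Ring S] (G : WeightGrading R) (φ : R →+* S) :
    WeightGrading S where
  proj m := φ (G.proj m)
  supp := G.supp
  proj_mul_self m := by rw [← map_mul, G.proj_mul_self]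
  proj_mul_of_ne m n h := by rw [← map_mul, G.proj_mul_of_ne m n h, map_zero]
  sum_proj := by rw [← map_sum, G.sum_proj, map_one]

theorem funH_eq_sum (g : ℤ → Fld) {s : Finset ℤ} (hs : V.weights ⊆ s) :
    funH p g V = ∑ m ∈ s, g m ⊗ₜ V.proj m :=
  Finset.sum_subset hs fun m _ hm => by rw [V.proj_eq_zero hm, TensorProduct.tmul_zero]

theorem funH_mul_projFam (g : ℤ → Fld) (m : ℤ) :
    funH p g V * projFam p m V = g m • projFam p m V := by
  rw [funH_eq_sum V g (Finset.subset_insert m V.weights), Finset.sum_mul,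
    Finset.sum_eq_single_of_mem m (Finset.mem_insert_self _ _)]
  · rw [projFam, Algebra.TensorProduct.tmul_mul_tmul, V.proj_mul_self, mul_one, tmul_eq_smul]
  · intro n _ hn
    rw [projFam, Algebra.TensorProduct.tmul_mul_tmul, V.proj_mul_of_ne hn, TensorProduct.tmul_zero]

theorem projFam_mul_funH (g : ℤ → Fld) (m : ℤ) :
    projFam p m V * funH p g V = g m • projFam p m V := by
  rw [funH_eq_sum V g (Finset.subset_insert m V.weights), Finset.mul_sum,
    Finset.sum_eq_single_of_mem m (Finset.mem_insert_self _ _)]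
  · rw [projFam, Algebra.TensorProduct.tmul_mul_tmul, V.proj_mul_self, one_mul, tmul_eq_smul]
  · intro n _ hn
    rw [projFam, Algebra.TensorProduct.tmul_mul_tmul, V.proj_mul_of_ne hn.symm,
      TensorProduct.tmul_zero]

variable {V} in
theorem op_ext {a b : Op V.V} (h : ∀ m, a * projFam p m V = b * projFam p m V) : a = b := by
  rw [← mul_one a, ← mul_one b, ← sum_projFam, Finset.mul_sum, Finset.mul_sum]
  exact Finset.sum_congr rfl fun m _ => h m

/-- `g ↦ g(h)` as a ring homomorphism. -/
def funHAt : (ℤ → Fld) →+* Op V.V where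
  toFun g := funH p g V
  map_one' := by
    refine op_ext fun m => ?_
    rw [funH_mul_projFam, Pi.one_apply, one_smul, one_mul]
  map_mul' g g' := by
    refine op_ext fun m => ?_
    rw [mul_assoc, funH_mul_projFam, funH_mul_projFam, mul_smul_comm, funH_mul_projFam, smul_smul,
      Pi.mul_apply, mul_comm]
  map_zero' := by
    refine op_ext fun m => ?_
    rw [funH_mul_projFam, Pi.zero_apply, zero_smul, zero_mul]
  map_add' g g' := by
    refine op_ext fun m => ?_
    rw [add_mul, funH_mul_projFam, funH_mul_projFam, funH_mul_projFam, Pi.add_apply, add_smul]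

theorem funHAt_apply (g : ℤ → Fld) : funHAt V g = funH p g V := rfl

theorem funHAt_smul (z : ℂ) (g : ℤ → Fld) : funHAt V (z • g) = z • funHAt V g := by
  refine op_ext fun m => ?_
  rw [smul_mul_assoc, funHAt_apply, funHAt_apply, funH_mul_projFam, funH_mul_projFam,
    Pi.smul_apply, smul_assoc]

variable {V} in
theorem mul_funH_of_shift {a : Op V.V} {d : ℤ}
    (h : ∀ m, a * projFam p m V = projFam p (m + d) V * a) (g : ℤ → Fld) :
    a * funH p g V = funH p (fun m => g (m - d)) V * a := by
  refine op_ext fun m => ?_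
  rw [mul_assoc, funH_mul_projFam, mul_smul_comm, mul_assoc, h, ← mul_assoc, funH_mul_projFam,
    add_sub_cancel_right, smul_mul_assoc]

theorem gen_e_mul_projFam (m : ℤ) :
    gen p (Uq.of p .e) V * projFam p m V = projFam p (m + 2) V * gen p (Uq.of p .e) V := by
  simp [gen, projFam, V.e_mul_proj]

theorem gen_f_mul_projFam (m : ℤ) :
    gen p (Uq.of p .f) V * projFam p m V = projFam p (m + -2) V * gen p (Uq.of p .f) V := by
  simp only [gen, projFam, Algebra.TensorProduct.tmul_mul_tmul, V.f_mul_proj]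

theorem gen_k (t : ℂ) : gen p (Uq.of p (.k t)) = funH p fun m => RatFunc.C (p.pow (t * m)) := by
  funext V
  refine op_ext fun m => ?_
  rw [funH_mul_projFam, gen, projFam, Algebra.TensorProduct.tmul_mul_tmul, V.k_mul_proj, mul_one,
    TensorProduct.tmul_smul, C_smul]

theorem isLower_gen_f : IsLower V.grading 1 (gen p (Uq.of p .f) V) :=
  (IsLower.of_mul_proj 2 (gen_f_mul_projFam V)).mono (by norm_num)

theorem isLower_gen_e : IsLower V.grading.opposite 1 (gen p (Uq.of p .e) V) := by
  refine (IsLower.of_mul_proj 2 fun m => ?_).mono (d' := 1) (by norm_num)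
  have := gen_e_mul_projFam V (-m)
  rw [show -m + 2 = -(m - 2) by ring] at this
  exact this

theorem commute_funH_projFam (g : ℤ → Fld) (m : ℤ) : Commute (funH p g V) (projFam p m V) := by
  rw [Commute, SemiconjBy, funH_mul_projFam, projFam_mul_funH]

theorem isLower_funH (g : ℤ → Fld) : IsLower V.grading 0 (funH p g V) :=
  IsLower.of_commute (commute_funH_projFam V g)

end FunH

/-! ### Operators on tensor products -/

section Two

variable {p : QParam} (V W : Rep p)

theorem map_id_smul {X Y : Type} [Ring X] [Algebra ℂ X] [Ring Y] [Algebra ℂ Y] (φ : X →ₐ[ℂ] Y)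
    (g : Fld) (a : Fld ⊗[ℂ] X) :
    Algebra.TensorProduct.map (AlgHom.id ℂ Fld) φ (g • a) =
      g • Algebra.TensorProduct.map (AlgHom.id ℂ Fld) φ a := by
  induction a using TensorProduct.induction_on with
  | zero => simp
  | tmul x y => simp [TensorProduct.smul_tmul']
  | add x y hx hy => rw [smul_add, map_add, hx, hy, map_add, smul_add]

theorem opLeft_smul (V W : Type) [AddCommGroup V] [Module ℂ V] [AddCommGroup W] [Module ℂ W]
    (g : Fld) (a : Op V) : opLeft V W (g • a) = g • opLeft V W a :=
  map_id_smul _ g a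

theorem opRight_smul (V W : Type) [AddCommGroup V] [Module ℂ V] [AddCommGroup W] [Module ℂ W]
    (g : Fld) (a : Op W) : opRight V W (g • a) = g • opRight V W a :=
  map_id_smul _ g a

theorem opLeft_one (V W : Type) [AddCommGroup V] [Module ℂ V] [AddCommGroup W] [Module ℂ W] :
    opLeft V W 1 = 1 := (opLeft V W).map_one'

theorem opRight_one (V W : Type) [AddCommGroup V] [Module ℂ V] [AddCommGroup W] [Module ℂ W] :
    opRight V W 1 = 1 := (opRight V W).map_one'

theorem mapCoeff_one (V : Type) [AddCommGroup V] [Module ℂ V] (τ : Fld →ₐ[ℂ] Fld) :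
    mapCoeff V τ 1 = 1 := (mapCoeff V τ).map_one'

theorem opLeft_tmul (V W : Type) [AddCommGroup V] [Module ℂ V] [AddCommGroup W] [Module ℂ W]
    (g : Fld) (A : Module.End ℂ V) : opLeft V W (g ⊗ₜ A) = g ⊗ₜ TensorProduct.map A 1 := rfl

theorem opRight_tmul (V W : Type) [AddCommGroup V] [Module ℂ V] [AddCommGroup W] [Module ℂ W]
    (g : Fld) (A : Module.End ℂ W) : opRight V W (g ⊗ₜ A) = g ⊗ₜ TensorProduct.map 1 A := rfl

theorem opLeft_tmul_mul_opRight_tmul (V W : Type) [AddCommGroup V] [Module ℂ V] [AddCommGroup W]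
    [Module ℂ W] (g g' : Fld) (A : Module.End ℂ V) (B : Module.End ℂ W) :
    opLeft V W (g ⊗ₜ A) * opRight V W (g' ⊗ₜ B) = (g * g') ⊗ₜ TensorProduct.map A B := by
  rw [opLeft_tmul, opRight_tmul, Algebra.TensorProduct.tmul_mul_tmul, ← TensorProduct.map_mul,
    mul_one, one_mul]

theorem opRight_tmul_mul_opLeft_tmul (V W : Type) [AddCommGroup V] [Module ℂ V] [AddCommGroup W]
    [Module ℂ W] (g g' : Fld) (A : Module.End ℂ V) (B : Module.End ℂ W) :
    opRight V W (g' ⊗ₜ B) * opLeft V W (g ⊗ₜ A) = (g' * g) ⊗ₜ TensorProduct.map A B := by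
  rw [opLeft_tmul, opRight_tmul, Algebra.TensorProduct.tmul_mul_tmul, ← TensorProduct.map_mul,
    mul_one, one_mul]

theorem commute_opLeft_opRight (V W : Type) [AddCommGroup V] [Module ℂ V] [AddCommGroup W]
    [Module ℂ W] (a : Op V) (b : Op W) : Commute (opLeft V W a) (opRight V W b) := by
  induction a using TensorProduct.induction_on with
  | zero => rw [map_zero]; exact Commute.zero_left _
  | add x y hx hy => rw [map_add]; exact hx.add_left hy
  | tmul g A =>
    induction b using TensorProduct.induction_on with
    | zero => rw [map_zero]; exact Commute.zero_right _
    | add x y hx hy => rw [map_add]; exact hx.add_right hy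
    | tmul g' B =>
      rw [Commute, SemiconjBy, opLeft_tmul_mul_opRight_tmul, opRight_tmul_mul_opLeft_tmul, mul_comm]

/-- The projection onto `V[m] ⊗ W[n]`. -/
def projPair (m n : ℤ) : Op (V.V ⊗[ℂ] W.V) :=
  opLeft V.V W.V (projFam p m V) * opRight V.V W.V (projFam p n W)

theorem projPair_eq (m n : ℤ) :
    projPair V W m n = 1 ⊗ₜ TensorProduct.map (V.proj m) (W.proj n) := by
  rw [projPair, projFam, projFam, opLeft_tmul_mul_opRight_tmul, mul_one]

theorem sum_projPair : ∑ m ∈ V.weights, ∑ n ∈ W.weights, projPair V W m n = 1 := by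
  simp_rw [projPair, ← Finset.mul_sum, ← Finset.sum_mul, ← map_sum, sum_projFam, opLeft_one,
    opRight_one, one_mul]

variable {V W} in
theorem op_ext₂ {a b : Op (V.V ⊗[ℂ] W.V)}
    (h : ∀ m n, a * projPair V W m n = b * projPair V W m n) : a = b := by
  rw [← mul_one a, ← mul_one b, ← sum_projPair, Finset.mul_sum, Finset.mul_sum]
  simp_rw [Finset.mul_sum, h]

theorem projPair_mul_self (m n : ℤ) : projPair V W m n * projPair V W m n = projPair V W m n := by
  simp [projPair_eq, ← TensorProduct.map_mul, V.proj_mul_self, W.proj_mul_self]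

theorem projPair_mul_of_ne_left {m m' : ℤ} (h : m ≠ m') (n n' : ℤ) :
    projPair V W m n * projPair V W m' n' = 0 := by
  simp [projPair_eq, ← TensorProduct.map_mul, V.proj_mul_of_ne h]

theorem projPair_mul_of_ne_right {n n' : ℤ} (h : n ≠ n') (m m' : ℤ) :
    projPair V W m n * projPair V W m' n' = 0 := by
  simp [projPair_eq, ← TensorProduct.map_mul, W.proj_mul_of_ne h]

theorem funHH_eq_sum (g : ℤ → ℤ → Fld) {s t : Finset ℤ} (hs : V.weights ⊆ s) (ht : W.weights ⊆ t) :
    funHH p g V W =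
      ∑ m ∈ s, ∑ n ∈ t, g m n ⊗ₜ TensorProduct.map (V.proj m) (W.proj n) := by
  rw [funHH]
  refine (Finset.sum_subset hs fun m _ hm => ?_).trans (Finset.sum_congr rfl fun m _ =>
    Finset.sum_subset ht fun n _ hn => ?_)
  · exact Finset.sum_eq_zero fun n _ => by
      rw [V.proj_eq_zero hm, TensorProduct.map_zero_left, TensorProduct.tmul_zero]
  · rw [W.proj_eq_zero hn, TensorProduct.map_zero_right, TensorProduct.tmul_zero]

theorem funHH_mul_projPair (g : ℤ → ℤ → Fld) (m n : ℤ) :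
    funHH p g V W * projPair V W m n = g m n • projPair V W m n := by
  rw [funHH_eq_sum V W g (Finset.subset_insert m V.weights) (Finset.subset_insert n W.weights),
    Finset.sum_mul, Finset.sum_eq_single_of_mem m (Finset.mem_insert_self _ _), Finset.sum_mul,
    Finset.sum_eq_single_of_mem n (Finset.mem_insert_self _ _)]
  · rw [tmul_eq_smul, ← projPair_eq, smul_mul_assoc, projPair_mul_self]
  · intro n' _ hn
    rw [tmul_eq_smul, ← projPair_eq, smul_mul_assoc, projPair_mul_of_ne_right V W hn, smul_zero]
  · intro m' _ hm
    rw [Finset.sum_mul]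
    refine Finset.sum_eq_zero fun n' _ => ?_
    rw [tmul_eq_smul, ← projPair_eq, smul_mul_assoc, projPair_mul_of_ne_left V W hm, smul_zero]

/-- `g ↦ g(h ⊗ 1, 1 ⊗ h)` as a ring homomorphism. -/
def funHHAt : (ℤ × ℤ → Fld) →+* Op (V.V ⊗[ℂ] W.V) where
  toFun g := funHH p (fun m n => g (m, n)) V W
  map_one' := by
    refine op_ext₂ fun m n => ?_
    rw [funHH_mul_projPair, Pi.one_apply, one_smul, one_mul]
  map_mul' g g' := by
    refine op_ext₂ fun m n => ?_
    rw [mul_assoc, funHH_mul_projPair, funHH_mul_projPair, mul_smul_comm, funHH_mul_projPair,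
      smul_smul, Pi.mul_apply, mul_comm]
  map_zero' := by
    refine op_ext₂ fun m n => ?_
    rw [funHH_mul_projPair, Pi.zero_apply, zero_smul, zero_mul]
  map_add' g g' := by
    refine op_ext₂ fun m n => ?_
    rw [add_mul, funHH_mul_projPair, funHH_mul_projPair, funHH_mul_projPair, Pi.add_apply, add_smul]

theorem funHHAt_apply (g : ℤ × ℤ → Fld) : funHHAt V W g = funHH p (fun m n => g (m, n)) V W := rfl

theorem funHHAt_smul (z : ℂ) (g : ℤ × ℤ → Fld) : funHHAt V W (z • g) = z • funHHAt V W g := by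
  refine op_ext₂ fun m n => ?_
  rw [smul_mul_assoc, funHHAt_apply, funHHAt_apply, funHH_mul_projPair, funHH_mul_projPair,
    Pi.smul_apply, smul_assoc]

theorem funHH_mul (g g' : ℤ → ℤ → Fld) : funHH p g * funHH p g' = funHH p (g * g') := by
  funext V W
  exact ((funHHAt V W).map_mul (fun x => g x.1 x.2) (fun x => g' x.1 x.2)).symm

theorem funHH_one : funHH p 1 = 1 := by
  funext V W
  exact (funHHAt V W).map_one

variable {V W} in
theorem mul_funHH_of_shift {a : Op (V.V ⊗[ℂ] W.V)} {d d' : ℤ}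
    (h : ∀ m n, a * projPair V W m n = projPair V W (m + d) (n + d') * a) (g : ℤ → ℤ → Fld) :
    a * funHH p g V W = funHH p (fun m n => g (m - d) (n - d')) V W * a := by
  refine op_ext₂ fun m n => ?_
  rw [mul_assoc, funHH_mul_projPair, mul_smul_comm, mul_assoc, h, ← mul_assoc, funHH_mul_projPair,
    add_sub_cancel_right, add_sub_cancel_right, smul_mul_assoc]

theorem opLeft_mul_projPair {a : Op V.V} {d : ℤ}
    (h : ∀ m, a * projFam p m V = projFam p (m + d) V * a) (m n : ℤ) :
    opLeft V.V W.V a * projPair V W m n = projPair V W (m + d) (n + 0) * opLeft V.V W.V a := by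
  rw [projPair, projPair, ← mul_assoc, ← map_mul, h, map_mul, mul_assoc, mul_assoc, add_zero,
    (commute_opLeft_opRight V.V W.V a _).eq]

theorem opRight_mul_projPair {a : Op W.V} {d : ℤ}
    (h : ∀ m, a * projFam p m W = projFam p (m + d) W * a) (m n : ℤ) :
    opRight V.V W.V a * projPair V W m n = projPair V W (m + 0) (n + d) * opRight V.V W.V a := by
  rw [projPair, projPair, ← mul_assoc, ← (commute_opLeft_opRight V.V W.V _ a).eq, mul_assoc,
    ← map_mul, h, map_mul, mul_assoc, add_zero]

theorem leg1_funH (g : ℤ → Fld) : leg1 (funH p g) = funHH p fun m _ => g m := by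
  funext V W
  refine op_ext₂ fun m n => ?_
  rw [leg1, projPair, ← mul_assoc, ← map_mul, funH_mul_projFam, opLeft_smul, smul_mul_assoc,
    ← projPair, funHH_mul_projPair]

theorem leg2_funH (g : ℤ → Fld) : leg2 (funH p g) = funHH p fun _ n => g n := by
  funext V W
  refine op_ext₂ fun m n => ?_
  rw [leg2, projPair, (commute_opLeft_opRight V.V W.V _ _).eq, ← mul_assoc, ← map_mul,
    funH_mul_projFam, opRight_smul, smul_mul_assoc, ← (commute_opLeft_opRight V.V W.V _ _).eq,
    ← projPair, funHH_mul_projPair]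

theorem projFam_tensor_mul_projPair (M m n : ℤ) :
    projFam p M (V.tensor W) * projPair V W m n =
      if m + n = M then projPair V W m n else 0 := by
  rw [projPair_eq]
  have h := Rep.tensor_proj_mul V W M m n
  have h2 : projFam p M (V.tensor W) * (1 ⊗ₜ TensorProduct.map (V.proj m) (W.proj n)) =
      (1 : Fld) ⊗ₜ ((V.tensor W).proj M * TensorProduct.map (V.proj m) (W.proj n)) := by
    rw [projFam, Algebra.TensorProduct.tmul_mul_tmul, one_mul]
  rw [h2, h]
  split_ifs
  · rfl
  · rw [TensorProduct.tmul_zero]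

theorem coprod_funH (g : ℤ → Fld) : coprod (funH p g) = funHH p fun m n => g (m + n) := by
  funext V W
  refine op_ext₂ fun m n => ?_
  have h : projPair V W m n = projFam p (m + n) (V.tensor W) * projPair V W m n := by
    rw [projFam_tensor_mul_projPair, if_pos rfl]
  rw [funHH_mul_projPair, h, ← mul_assoc]
  change funH p g (V.tensor W) * _ * _ = _
  rw [funH_mul_projFam, smul_mul_assoc]

theorem projFam_eq_funH (m : ℤ) : projFam p m = funH p (Pi.single m 1) := by
  funext V
  refine op_ext fun n => ?_
  rw [funH_mul_projFam]
  by_cases h : n = m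
  · subst h; rw [projFam_mul_self, Pi.single_eq_same, one_smul]
  · rw [projFam_mul_of_ne V (Ne.symm h), Pi.single_eq_of_ne h, zero_smul]

/-! ### The dynamical shift -/

theorem mapCoeff_tmul {M : Type} [AddCommGroup M] [Module ℂ M] (τ : Fld →ₐ[ℂ] Fld) (g : Fld)
    (A : Module.End ℂ M) : mapCoeff M τ (g ⊗ₜ A) = τ g ⊗ₜ A := rfl

variable {M : Type} [AddCommGroup M] [Module ℂ M]

theorem dynShift_mul_projFam (a : Op M) (n : ℤ) :
    dynShift a W * opRight M W.V (projFam p n W) =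
      opLeft M W.V (mapCoeff M (shiftFld p n) a) * opRight M W.V (projFam p n W) := by
  by_cases hn : n ∈ W.weights
  · rw [dynShift, Finset.sum_mul, Finset.sum_eq_single_of_mem n hn]
    · rw [mul_assoc, ← map_mul, projFam_mul_self]
    · intro m _ hm
      rw [mul_assoc, ← map_mul, projFam_mul_of_ne W hm, map_zero, mul_zero]
  · rw [projFam_eq_zero W hn, map_zero, mul_zero, mul_zero]

theorem op_ext_right {a b : Op (M ⊗[ℂ] W.V)}
    (h : ∀ n, a * opRight M W.V (projFam p n W) = b * opRight M W.V (projFam p n W)) : a = b := by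
  rw [← mul_one a, ← mul_one b, ← opRight_one, ← sum_projFam, map_sum, Finset.mul_sum,
    Finset.mul_sum]
  exact Finset.sum_congr rfl fun m _ => h m

/-- `a(x) ↦ a(x q^{h_W})` as a homomorphism of algebras. -/
def dynShiftHom (M : Type) [AddCommGroup M] [Module ℂ M] : Op M →ₐ[ℂ] Op (M ⊗[ℂ] W.V) where
  toFun a := dynShift a W
  map_one' := by
    refine op_ext_right W fun n => ?_
    rw [dynShift_mul_projFam, mapCoeff_one, opLeft_one]
  map_mul' a b := by
    refine op_ext_right W fun n => ?_
    rw [dynShift_mul_projFam, mul_assoc, dynShift_mul_projFam, map_mul, map_mul,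
      (commute_opLeft_opRight M W.V _ _).eq, ← mul_assoc, dynShift_mul_projFam, mul_assoc,
      (commute_opLeft_opRight M W.V (mapCoeff M (shiftFld p n) b) _).eq, ← mul_assoc]
  map_zero' := by
    refine op_ext_right W fun n => ?_
    rw [dynShift_mul_projFam, map_zero, map_zero, zero_mul]
  map_add' a b := by
    refine op_ext_right W fun n => ?_
    rw [dynShift_mul_projFam, add_mul, dynShift_mul_projFam, dynShift_mul_projFam, map_add,
      map_add, add_mul]
  commutes' z := by
    refine op_ext_right W fun n => ?_
    rw [dynShift_mul_projFam, AlgHom.commutes, AlgHom.commutes]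

theorem dynShift_one_tmul (A : Module.End ℂ M) :
    dynShift (1 ⊗ₜ A) W = opLeft M W.V ((1 : Fld) ⊗ₜ A) := by
  refine op_ext_right W fun n => ?_
  rw [dynShift_mul_projFam, mapCoeff_tmul, map_one]

theorem leg1Shift_gen (u : Uq p) : leg1Shift (gen p u) = leg1 (gen p u) := by
  funext V W
  exact dynShift_one_tmul W _

theorem mapCoeff_funH (τ : Fld →ₐ[ℂ] Fld) (g : ℤ → Fld) :
    mapCoeff V.V τ (funH p g V) = funH p (fun m => τ (g m)) V := by
  rw [funH, map_sum]
  exact Finset.sum_congr rfl fun m _ => mapCoeff_tmul _ _ _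

theorem leg1Shift_funH (g : ℤ → Fld) :
    leg1Shift (funH p g) = funHH p fun m n => shiftFld p n (g m) := by
  funext V W
  refine op_ext₂ fun m n => ?_
  rw [funHH_mul_projPair, projPair, (commute_opLeft_opRight V.V W.V _ _).eq, ← mul_assoc]
  change dynShift _ _ * _ * _ = _
  rw [dynShift_mul_projFam, mapCoeff_funH, mul_assoc, ← (commute_opLeft_opRight V.V W.V _ _).eq,
    ← mul_assoc, ← map_mul, funH_mul_projFam, opLeft_smul, smul_mul_assoc]

/-- `a(x q^{h_W})` commutes with the operators on `W` which preserve weights. -/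
theorem commute_dynShift_opRight {a : Op M} {b : Op W.V}
    (hb : ∀ m, Commute b (projFam p m W)) : Commute (dynShift a W) (opRight M W.V b) := by
  refine Commute.sum_left _ _ _ fun m _ => ?_
  refine Commute.mul_left (commute_opLeft_opRight M W.V _ _) ?_
  rw [Commute, SemiconjBy, ← map_mul, ← map_mul, (hb m).eq]

theorem subst_algebraMap (P : Polynomial ℂ) (hP : P.natDegree ≠ 0) (f : Polynomial ℂ) :
    subst P hP (algebraMap _ Fld f) = algebraMap _ Fld (Polynomial.aeval P f) := by
  have := RatFunc.map_apply_div (φ := (Polynomial.aeval P : Polynomial ℂ →ₐ[ℂ] Polynomial ℂ))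
    (hφ := subst_le P hP) (p := f) (q := 1)
  simp only [map_one, div_one] at this
  exact this

theorem subst_X (P : Polynomial ℂ) (hP : P.natDegree ≠ 0) :
    subst P hP RatFunc.X = algebraMap _ Fld P := by
  rw [← RatFunc.algebraMap_X, subst_algebraMap, Polynomial.aeval_X]

theorem shiftFld_xVar (n : ℤ) : shiftFld p n xVar = RatFunc.C (p.pow n) * xVar := by
  rw [shiftFld, xVar, map_pow, subst_X, map_mul, RatFunc.algebraMap_X, RatFunc.algebraMap_C,
    mul_pow, ← map_pow, ← p.pow_natCast_mul]
  congr 3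
  push_cast
  ring

theorem algHom_C (τ : Fld →ₐ[ℂ] Fld) (z : ℂ) : τ (RatFunc.C z) = RatFunc.C z := by
  have := τ.commutes z
  rwa [RatFunc.algebraMap_eq_C] at this

theorem powFld_X (n : ℕ) (hn : n ≠ 0) : powFld n hn RatFunc.X = RatFunc.X ^ n := by
  rw [powFld, subst_X, map_pow, RatFunc.algebraMap_X]

end Two

/-! ### Homomorphisms between the completions -/

section Homs

variable {p : QParam}

/-- `a ↦ a₁` as a homomorphism. -/
def leg1Hom (p : QParam) : Fam1 p →+* Fam2 p where
  toFun := leg1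
  map_one' := by funext V W; exact opLeft_one _ _
  map_mul' a b := by funext V W; exact map_mul (opLeft V.V W.V) _ _
  map_zero' := by funext V W; exact map_zero (opLeft V.V W.V)
  map_add' a b := by funext V W; exact map_add (opLeft V.V W.V) _ _

/-- `a ↦ a₂` as a homomorphism. -/
def leg2Hom (p : QParam) : Fam1 p →+* Fam2 p where
  toFun := leg2
  map_one' := by funext V W; exact opRight_one _ _
  map_mul' a b := by funext V W; exact map_mul (opRight V.V W.V) _ _
  map_zero' := by funext V W; exact map_zero (opRight V.V W.V)
  map_add' a b := by funext V W; exact map_add (opRight V.V W.V) _ _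

/-- `a ↦ Δ(a)` as a homomorphism. -/
def coprodHom (p : QParam) : Fam1 p →+* Fam2 p where
  toFun := coprod
  map_one' := rfl
  map_mul' _ _ := rfl
  map_zero' := rfl
  map_add' _ _ := rfl

/-- `a ↦ a₁(x q^{h₂})` as a homomorphism. -/
def leg1ShiftHom (p : QParam) : Fam1 p →+* Fam2 p where
  toFun := leg1Shift
  map_one' := by funext V W; exact (dynShiftHom W V.V).map_one'
  map_mul' a b := by funext V W; exact map_mul (dynShiftHom W V.V) _ _
  map_zero' := by funext V W; exact map_zero (dynShiftHom W V.V)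
  map_add' a b := by funext V W; exact map_add (dynShiftHom W V.V) _ _

/-- `a ↦ a₂₁` as a homomorphism. -/
def flipHom (p : QParam) : Fam2 p →+* Fam2 p where
  toFun := flip
  map_one' := by funext V W; exact (opConj (TensorProduct.comm ℂ W.V V.V)).map_one'
  map_mul' a b := by funext V W; exact map_mul (opConj (TensorProduct.comm ℂ W.V V.V)) _ _
  map_zero' := by funext V W; exact map_zero (opConj (TensorProduct.comm ℂ W.V V.V))
  map_add' a b := by funext V W; exact map_add (opConj (TensorProduct.comm ℂ W.V V.V)) _ _

theorem leg1_mul (a b : Fam1 p) : leg1 (a * b) = leg1 a * leg1 b := map_mul (leg1Hom p) a b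
theorem leg2_mul (a b : Fam1 p) : leg2 (a * b) = leg2 a * leg2 b := map_mul (leg2Hom p) a b
theorem coprod_mul (a b : Fam1 p) : coprod (a * b) = coprod a * coprod b := rfl
theorem leg1Shift_mul (a b : Fam1 p) : leg1Shift (a * b) = leg1Shift a * leg1Shift b :=
  map_mul (leg1ShiftHom p) a b
theorem flip_mul (a b : Fam2 p) : flip (a * b) = flip a * flip b := map_mul (flipHom p) a b
theorem flip_add (a b : Fam2 p) : flip (a + b) = flip a + flip b := map_add (flipHom p) a b

theorem commute_leg1_leg2 (a b : Fam1 p) : Commute (leg1 a) (leg2 b) := by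
  rw [Commute, SemiconjBy]
  funext V W
  exact commute_opLeft_opRight V.V W.V _ _

theorem opConj_tmul {V W : Type} [AddCommGroup V] [Module ℂ V] [AddCommGroup W] [Module ℂ W]
    (φ : V ≃ₗ[ℂ] W) (g : Fld) (A : Module.End ℂ V) :
    opConj φ (g ⊗ₜ A) = g ⊗ₜ φ.conj A := rfl

theorem opConj_smul {V W : Type} [AddCommGroup V] [Module ℂ V] [AddCommGroup W] [Module ℂ W]
    (φ : V ≃ₗ[ℂ] W) (g : Fld) (a : Op V) : opConj φ (g • a) = g • opConj φ a :=
  map_id_smul _ g a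

theorem flip_flip (a : Fam2 p) : flip (flip a) = a := by
  funext V W
  change opConj _ (opConj _ (a V W)) = _
  induction a V W using TensorProduct.induction_on with
  | zero => simp
  | add x y hx hy => rw [map_add, map_add, hx, hy]
  | tmul g A =>
    rw [opConj_tmul, opConj_tmul]
    congr 1
    ext v w
    simp [LinearEquiv.conj_apply]

theorem flip_leg1 (a : Fam1 p) : flip (leg1 a) = leg2 a := by
  funext V W
  change opConj _ (opLeft _ _ (a W)) = opRight _ _ (a W)
  induction a W using TensorProduct.induction_on with
  | zero => simp
  | add x y hx hy => simp only [map_add, hx, hy]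
  | tmul g A =>
    rw [opLeft_tmul, opRight_tmul, opConj_tmul]
    congr 1
    ext v w
    simp [LinearEquiv.conj_apply]

theorem flip_leg2 (a : Fam1 p) : flip (leg2 a) = leg1 a := by rw [← flip_leg1, flip_flip]

theorem flip_funHH (g : ℤ → ℤ → Fld) : flip (funHH p g) = funHH p fun m n => g n m := by
  funext V W
  refine op_ext₂ fun m n => ?_
  have h1 : projPair V W m n = opConj (TensorProduct.comm ℂ W.V V.V) (projPair W V n m) := by
    have h2 := congrFun (congrFun (flip_leg1 (projFam p n)) V) W
    have h3 := congrFun (congrFun (flip_leg2 (projFam p m)) V) W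
    simp only [flip, leg1, leg2] at h2 h3
    rw [projPair, projPair, map_mul, h2, h3, (commute_opLeft_opRight V.V W.V _ _).eq]
  rw [funHH_mul_projPair, h1]
  change opConj _ _ * _ = _
  rw [← map_mul, funHH_mul_projPair, opConj_smul]

end Homs

/-! ### Monomials in the Chevalley generators -/

section Monomials

variable {p : QParam}

/-- `e ⊗ 1`. -/
def genE1 (p : QParam) : Fam2 p := leg1 (gen p (Uq.of p .e))
/-- `1 ⊗ e`. -/
def genE2 (p : QParam) : Fam2 p := leg2 (gen p (Uq.of p .e))
/-- `f ⊗ 1`. -/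
def genF1 (p : QParam) : Fam2 p := leg1 (gen p (Uq.of p .f))
/-- `1 ⊗ f`. -/
def genF2 (p : QParam) : Fam2 p := leg2 (gen p (Uq.of p .f))

theorem genE1_mul_funHH (g : ℤ → ℤ → Fld) :
    genE1 p * funHH p g = funHH p (fun m n => g (m - 2) n) * genE1 p := by
  funext V W
  have := mul_funHH_of_shift (opLeft_mul_projPair V W (gen_e_mul_projFam V)) g
  simp only [sub_zero] at this
  exact this

theorem genE2_mul_funHH (g : ℤ → ℤ → Fld) :
    genE2 p * funHH p g = funHH p (fun m n => g m (n - 2)) * genE2 p := by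
  funext V W
  have := mul_funHH_of_shift (opRight_mul_projPair V W (gen_e_mul_projFam W)) g
  simp only [sub_zero] at this
  exact this

theorem genF1_mul_funHH (g : ℤ → ℤ → Fld) :
    genF1 p * funHH p g = funHH p (fun m n => g (m + 2) n) * genF1 p := by
  funext V W
  have := mul_funHH_of_shift (opLeft_mul_projPair V W (gen_f_mul_projFam V)) g
  simp only [sub_zero, sub_neg_eq_add] at this
  exact this

theorem genF2_mul_funHH (g : ℤ → ℤ → Fld) :
    genF2 p * funHH p g = funHH p (fun m n => g m (n + 2)) * genF2 p := by
  funext V W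
  have := mul_funHH_of_shift (opRight_mul_projPair V W (gen_f_mul_projFam W)) g
  simp only [sub_zero, sub_neg_eq_add] at this
  exact this

theorem gen_f_mul_funH (g : ℤ → Fld) :
    gen p (Uq.of p .f) * funH p g = funH p (fun m => g (m + 2)) * gen p (Uq.of p .f) := by
  funext V
  have := mul_funH_of_shift (gen_f_mul_projFam V) g
  simp only [sub_neg_eq_add] at this
  exact this

theorem genE1_mul_genE2 : genE1 p * genE2 p = genE2 p * genE1 p := commute_leg1_leg2 _ _
theorem genE1_mul_genF2 : genE1 p * genF2 p = genF2 p * genE1 p := commute_leg1_leg2 _ _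
theorem genF1_mul_genF2 : genF1 p * genF2 p = genF2 p * genF1 p := commute_leg1_leg2 _ _

theorem smul_funHH (z : ℂ) (g : ℤ → ℤ → Fld) :
    z • funHH p g = funHH p fun m n => RatFunc.C z * g m n := by
  funext V W
  refine op_ext₂ fun m n => ?_
  rw [Pi.smul_apply, Pi.smul_apply, smul_mul_assoc, funHH_mul_projPair, funHH_mul_projPair,
    ← C_smul, smul_smul]

theorem smul_eq_funH_mul (c : Fld) (a : Fam1 p) : c • a = funH p (fun _ => c) * a := by
  funext V
  have : funH p (fun _ => c) V = c • 1 := op_ext fun m => by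
    rw [funH_mul_projFam, smul_mul_assoc, one_mul]
  rw [Pi.mul_apply, this, smul_mul_assoc, one_mul]; rfl

theorem comul_of (p : QParam) (g : Gen) : comul p (Uq.of p g) = comulGen p g := by
  simp [comul, Uq.of]

theorem tensorAction_tmul (V W : Rep p) (u u' : Uq p) :
    ((Module.endTensorEndAlgHom (R := ℂ) (S := ℂ) (A := ℂ) (M := V.V) (N := W.V)).comp
      (Algebra.TensorProduct.map V.ρ W.ρ)) (u ⊗ₜ u') = TensorProduct.map (V.ρ u) (W.ρ u') := by
  refine TensorProduct.ext' fun v w => ?_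
  simp [Module.endTensorEndAlgHom_apply]

theorem gen_tensor_eq (V W : Rep p) (u u' : Uq p) :
    (1 : Fld) ⊗ₜ[ℂ] TensorProduct.map (V.ρ u) (W.ρ u') =
      leg1 (gen p u) V W * leg2 (gen p u') V W := by
  rw [leg1, leg2, gen, gen, opLeft_tmul_mul_opRight_tmul, mul_one]

theorem gen_one : gen p 1 = 1 := by
  funext V
  simp [gen]; rfl

theorem leg1_one : leg1 (1 : Fam1 p) = 1 := (leg1Hom p).map_one
theorem leg2_one : leg2 (1 : Fam1 p) = 1 := (leg2Hom p).map_one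
theorem leg1Shift_one : leg1Shift (1 : Fam1 p) = 1 := (leg1ShiftHom p).map_one

theorem coprod_gen_e :
    coprod (gen p (Uq.of p .e)) = genE1 p * funHH p (fun _ n => RatFunc.C (p.pow n)) + genE2 p := by
  have hk : funHH p (fun _ n => RatFunc.C (p.pow n)) = leg2 (gen p (Uq.of p (.k 1))) := by
    rw [gen_k, leg2_funH]; simp
  rw [hk]
  funext V W
  have h : coprod (gen p (Uq.of p .e)) V W = 1 ⊗ₜ (tensorAction p V W (Uq.of p .e)) := rfl
  rw [h, tensorAction, AlgHom.comp_apply, comul_of, comulGen, map_add, tensorAction_tmul,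
    tensorAction_tmul, TensorProduct.tmul_add, gen_tensor_eq, gen_tensor_eq, gen_one, leg1_one]
  change _ + 1 * _ = _
  rw [one_mul]
  rfl

theorem coprod_gen_f :
    coprod (gen p (Uq.of p .f)) =
      genF1 p + funHH p (fun m _ => RatFunc.C (p.pow (-m))) * genF2 p := by
  have hk : funHH p (fun m _ => RatFunc.C (p.pow (-m))) = leg1 (gen p (Uq.of p (.k (-1)))) := by
    rw [gen_k, leg1_funH]; simp
  rw [hk]
  funext V W
  have h : coprod (gen p (Uq.of p .f)) V W = 1 ⊗ₜ (tensorAction p V W (Uq.of p .f)) := rfl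
  rw [h, tensorAction, AlgHom.comp_apply, comul_of, comulGen, map_add, tensorAction_tmul,
    tensorAction_tmul, TensorProduct.tmul_add, gen_tensor_eq, gen_tensor_eq, gen_one, leg2_one]
  change _ * 1 + _ = _
  rw [mul_one]
  rfl

theorem genE1_mul_genF1_sub : genE1 p * genF1 p - genF1 p * genE1 p =
    funHH p fun m _ => RatFunc.C ((p.q - p.q⁻¹)⁻¹ * (p.pow m - p.pow (-m))) := by
  have h : gen p (Uq.of p .e) * gen p (Uq.of p .f) - gen p (Uq.of p .f) * gen p (Uq.of p .e) =
      funH p fun m => RatFunc.C ((p.q - p.q⁻¹)⁻¹ * (p.pow m - p.pow (-m))) := by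
    have h1 : gen p (Uq.of p .e) * gen p (Uq.of p .f) - gen p (Uq.of p .f) * gen p (Uq.of p .e) =
        (p.q - p.q⁻¹)⁻¹ • (gen p (Uq.of p (.k 1)) - gen p (Uq.of p (.k (-1)))) := by
      funext V
      have := congrArg (fun u => (1 : Fld) ⊗ₜ[ℂ] V.ρ u) (Uq.e_f p)
      simp only [map_sub, map_mul, map_smul, TensorProduct.tmul_sub,
        TensorProduct.tmul_smul] at this
      simp only [gen, Pi.sub_apply, Pi.mul_apply, Pi.smul_apply,
        Algebra.TensorProduct.tmul_mul_tmul, one_mul]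
      exact this
    rw [h1, gen_k, gen_k]
    funext V
    refine op_ext fun m => ?_
    simp only [Pi.sub_apply, Pi.smul_apply]
    rw [smul_mul_assoc, sub_mul, funH_mul_projFam, funH_mul_projFam, funH_mul_projFam, ← sub_smul,
      ← C_smul, smul_smul, map_mul, map_sub, one_mul, neg_one_mul]
  rw [← leg1_funH, ← h]
  change _ = leg1Hom p _
  rw [map_sub, map_mul, map_mul]
  rfl

end Monomials

/-! ### Scalars -/

section Scalars

variable {p : QParam}

/-- The scalar `x ^ k q ^ z`. -/
def xq (p : QParam) (k : ℤ) (z : ℂ) : Fld := xVar ^ k * RatFunc.C (p.pow z)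

theorem xVar_ne_zero : xVar ≠ 0 := pow_ne_zero _ RatFunc.X_ne_zero

theorem xq_mul (k l : ℤ) (y z : ℂ) : xq p k y * xq p l z = xq p (k + l) (y + z) := by
  rw [xq, xq, xq, p.pow_add, map_mul, zpow_add₀ xVar_ne_zero]
  ring

theorem xq_zero : xq p 0 0 = 1 := by simp [xq, p.pow_zero]

theorem xq_mul_neg (k : ℤ) (z : ℂ) : xq p k z * xq p (-k) (-z) = 1 := by
  rw [xq_mul, add_neg_cancel, add_neg_cancel, xq_zero]

theorem xq_inv (k : ℤ) (z : ℂ) : (xq p k z)⁻¹ = xq p (-k) (-z) :=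
  inv_eq_of_mul_eq_one_right (xq_mul_neg k z)

theorem xq_div (k l : ℤ) (y z : ℂ) : xq p k y / xq p l z = xq p (k - l) (y - z) := by
  rw [div_eq_mul_inv, xq_inv, xq_mul, sub_eq_add_neg, sub_eq_add_neg]

theorem xq_ne_zero (k : ℤ) (z : ℂ) : xq p k z ≠ 0 := left_ne_zero_of_mul_eq_one (xq_mul_neg k z)

theorem C_pow_eq (z : ℂ) : (RatFunc.C (p.pow z) : Fld) = xq p 0 z := by simp [xq]

theorem xq_congr {k l : ℤ} {y z : ℂ} (h : k = l) (h' : y = z) : xq p k y = xq p l z := by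
  rw [h, h']

theorem C_base : (RatFunc.C p.base : Fld) = xq p 0 (-2) := C_pow_eq _

theorem elemB_eq (p : QParam) : elemB p = funH p fun m => xq p m (m ^ 2 / 2) := rfl

theorem matK_eq (p : QParam) : matK p = funHH p fun m n => xq p 0 (m * n / 2) := by
  simp only [← C_pow_eq]; rfl

theorem shiftFld_xq (n k : ℤ) (z : ℂ) : shiftFld p n (xq p k z) = xq p k (z + n * k) := by
  rw [xq, map_mul, algHom_C, map_zpow₀, shiftFld_xVar, mul_zpow, ← map_zpow₀, xq, p.pow_add,
    map_mul]
  have : p.pow n ^ k = p.pow (n * k) := by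
    rw [QParam.pow, QParam.pow, ← Complex.exp_int_mul]
    congr 1; ring
  rw [this]
  ring

end Scalars

/-! ### `q`-exponentials in the completions -/

section Exp

variable {p : QParam}

/-- The pointwise `q`-exponential of a family of nilpotent operators. -/
def exp1 (p : QParam) (a : Fam1 p) : Fam1 p := fun V => qInvExp p (a V)

/-- The pointwise `q`-exponential of a family of nilpotent operators. -/
def exp2 (p : QParam) (a : Fam2 p) : Fam2 p := fun V W => qInvExp p (a V W)

theorem exp2_add {a b : Fam2 p} (h : b * a = p.base • (a * b))
    (ha : ∀ V W, IsNilpotent (a V W)) (hb : ∀ V W, IsNilpotent (b V W)) :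
    exp2 p (a + b) = exp2 p a * exp2 p b := by
  funext V W
  exact (qInvExp_add p (congrFun (congrFun h V) W) (ha V W) (hb V W)).2

theorem exp2_mul_of_commute_up_to {a b : Fam2 p} (h : a * b = p.base • (b * a))
    (ha : ∀ V W, IsNilpotent (a V W)) :
    exp2 p a * b = (b + (a * b - b * a)) * exp2 p a := by
  funext V W
  exact qInvExp_mul_of_commute_up_to p (congrFun (congrFun h V) W) (ha V W)

theorem exp2_mul_add {a g s t : Fam2 p} (h : a * g - g * a = s - t)
    (hs : a * s = p.base • (s * a)) (ht : t * a = p.base • (a * t))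
    (ha : ∀ V W, IsNilpotent (a V W)) :
    exp2 p a * (g + t) = (g + s) * exp2 p a := by
  funext V W
  exact qInvExp_mul_add p (congrFun (congrFun h V) W) (congrFun (congrFun hs V) W)
    (congrFun (congrFun ht V) W) (ha V W)

theorem isUnit_exp1 {a : Fam1 p} (ha : ∀ V, IsNilpotent (a V)) : IsUnit (exp1 p a) :=
  Pi.isUnit_iff.2 fun V => isUnit_qInvExp p (ha V)

theorem isUnit_exp2 {a : Fam2 p} (ha : ∀ V W, IsNilpotent (a V W)) : IsUnit (exp2 p a) :=
  Pi.isUnit_iff.2 fun V => Pi.isUnit_iff.2 fun W => isUnit_qInvExp p (ha V W)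

/-- `q`-exponentials are compatible with conjugation. -/
theorem mul_exp2_of_mul_eq {a b k k' : Fam2 p} (hk : k * k' = 1) (hk' : k' * k = 1)
    (h : k * a = b * k) (ha : ∀ V W, IsNilpotent (a V W)) : k * exp2 p a = exp2 p b * k := by
  funext V W
  have hb : b V W = k V W * a V W * k' V W := by
    have h1 : b = k * a * k' := by rw [h, mul_assoc, hk, mul_one]
    rw [h1]; rfl
  let κ : (Op (V.V ⊗[ℂ] W.V))ˣ := ⟨k V W, k' V W, congrFun (congrFun hk V) W,
    congrFun (congrFun hk' V) W⟩
  have h2 : ∀ n, b V W ^ n = k V W * a V W ^ n * k' V W := fun n => by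
    rw [hb]; exact Units.conj_pow κ (a V W) n
  obtain ⟨N, hN⟩ := ha V W
  have hN' : b V W ^ N = 0 := by rw [h2, hN, mul_zero, zero_mul]
  change k V W * qInvExp p (a V W) = qInvExp p (b V W) * k V W
  rw [qInvExp_eq_sum p hN, qInvExp_eq_sum p hN', Finset.mul_sum, Finset.sum_mul]
  refine Finset.sum_congr rfl fun n _ => ?_
  have h3 : k' V W * k V W = 1 := congrFun (congrFun hk' V) W
  rw [h2, smul_mul_assoc, mul_assoc (k V W * _), h3, mul_one, mul_smul_comm]

theorem leg1_exp1 {a : Fam1 p} (ha : ∀ V, IsNilpotent (a V)) :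
    leg1 (exp1 p a) = exp2 p (leg1 a) := by
  funext V W; exact map_qInvExp p (opLeft V.V W.V) (ha V)

theorem leg2_exp1 {a : Fam1 p} (ha : ∀ V, IsNilpotent (a V)) :
    leg2 (exp1 p a) = exp2 p (leg2 a) := by
  funext V W; exact map_qInvExp p (opRight V.V W.V) (ha W)

theorem leg1Shift_exp1 {a : Fam1 p} (ha : ∀ V, IsNilpotent (a V)) :
    leg1Shift (exp1 p a) = exp2 p (leg1Shift a) := by
  funext V W; exact map_qInvExp p (dynShiftHom W V.V) (ha V)

theorem coprod_exp1 (a : Fam1 p) : coprod (exp1 p a) = exp2 p (coprod a) := rfl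

theorem isNilpotent_leg1 {a : Fam1 p} (ha : ∀ V, IsNilpotent (a V)) (V W : Rep p) :
    IsNilpotent (leg1 a V W) := (ha V).map (opLeft V.V W.V)

theorem isNilpotent_leg2 {a : Fam1 p} (ha : ∀ V, IsNilpotent (a V)) (V W : Rep p) :
    IsNilpotent (leg2 a V W) := (ha W).map (opRight V.V W.V)

theorem isNilpotent_leg1Shift {a : Fam1 p} (ha : ∀ V, IsNilpotent (a V)) (V W : Rep p) :
    IsNilpotent (leg1Shift a V W) := (ha V).map (dynShiftHom W V.V)

end Exp

/-! ### Relations between the factors of the Gauss decomposition -/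

section Relations

variable {p : QParam}

theorem funHH_mul_mul (g g' : ℤ → ℤ → Fld) (a : Fam2 p) :
    funHH p g * (funHH p g' * a) = funHH p (g * g') * a := by rw [← mul_assoc, funHH_mul]
theorem genE1_mul_funHH_mul (g : ℤ → ℤ → Fld) (a : Fam2 p) : genE1 p * (funHH p g * a) =
    funHH p (fun m n => g (m - 2) n) * (genE1 p * a) := by
  rw [← mul_assoc, genE1_mul_funHH, mul_assoc]
theorem genE2_mul_funHH_mul (g : ℤ → ℤ → Fld) (a : Fam2 p) : genE2 p * (funHH p g * a) =
    funHH p (fun m n => g m (n - 2)) * (genE2 p * a) := by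
  rw [← mul_assoc, genE2_mul_funHH, mul_assoc]
theorem genF1_mul_funHH_mul (g : ℤ → ℤ → Fld) (a : Fam2 p) : genF1 p * (funHH p g * a) =
    funHH p (fun m n => g (m + 2) n) * (genF1 p * a) := by
  rw [← mul_assoc, genF1_mul_funHH, mul_assoc]
theorem genF2_mul_funHH_mul (g : ℤ → ℤ → Fld) (a : Fam2 p) : genF2 p * (funHH p g * a) =
    funHH p (fun m n => g m (n + 2)) * (genF2 p * a) := by
  rw [← mul_assoc, genF2_mul_funHH, mul_assoc]
theorem smul_funHH_mul (z : ℂ) (g : ℤ → ℤ → Fld) (a : Fam2 p) :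
    z • (funHH p g * a) = funHH p (fun m n => RatFunc.C z * g m n) * a := by
  rw [← smul_mul_assoc, smul_funHH]

theorem funHH_congr {g g' : ℤ → ℤ → Fld} (h : ∀ m n, g m n = g' m n) : funHH p g = funHH p g' := by
  congr 1; funext m n; exact h m n

theorem funHH_mul_eq_one {g g' : ℤ → ℤ → Fld} (h : ∀ m n, g m n * g' m n = 1) :
    funHH p g * funHH p g' = 1 := by
  rw [funHH_mul, ← funHH_one]
  exact funHH_congr h

theorem funHH_commute (g g' : ℤ → ℤ → Fld) : Commute (funHH p g) (funHH p g') := by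
  rw [Commute, SemiconjBy, funHH_mul, funHH_mul, mul_comm]

/-- The exponent `-x e` of `C⁺`. -/
def expoE (p : QParam) : Fam1 p := funH p (fun _ => -xq p 1 0) * gen p (Uq.of p .e)

/-- The exponent `(x q^{h + 1})⁻¹ f` of the inverse of `C⁻`. -/
def expoF (p : QParam) : Fam1 p := funH p (fun m => xq p (-1) (-(m + 1))) * gen p (Uq.of p .f)

/-- The exponent `(q - q⁻¹) e ⊗ f` of `R̂`. -/
def expoR (p : QParam) : Fam2 p :=
  funHH p (fun _ _ => RatFunc.C (p.q - p.q⁻¹)) * (genE1 p * genF2 p)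

/-- The inverse of `C⁻`. -/
def invCMinus (p : QParam) : Fam1 p := exp1 p (expoF p)

/-- `K⁻¹`. -/
def invK (p : QParam) : Fam2 p := funHH p fun m n => xq p 0 (-(m * n / 2))

theorem elemCPlus_eq : elemCPlus p = exp1 p (expoE p) := by
  have h : expoE p = -(xVar • gen p (Uq.of p .e)) := by
    rw [← neg_smul, smul_eq_funH_mul, expoE]
    simp [xq, p.pow_zero]
  rw [h]; rfl

theorem elemCMinus_eq : elemCMinus p = Ring.inverse (invCMinus p) := by
  have h : expoF p =
      funH p (fun m => (xVar * RatFunc.C (p.pow (m + 1)))⁻¹) * gen p (Uq.of p .f) := by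
    rw [expoF]
    congr 2
    funext m
    rw [← xq_inv, xq, zpow_one]
  rw [invCMinus, h]; rfl

theorem matRhat_eq : matRhat p = exp2 p (expoR p) := by
  have h : expoR p = (p.q - p.q⁻¹) • (genE1 p * genF2 p) := by
    rw [expoR, ← one_mul (genE1 p * genF2 p), ← funHH_one, smul_funHH_mul]
    simp only [Pi.one_apply, mul_one]
    rw [funHH_one, one_mul]
  rw [h]; rfl

theorem isLower_expoF (V : Rep p) : IsLower V.grading 1 (expoF p V) :=
  (isLower_funH V _).weak_mul (isLower_gen_f V)

theorem isLower_expoE (V : Rep p) : IsLower V.grading.opposite 1 (expoE p V) := by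
  have h : IsLower V.grading.opposite 0 (funH p (fun _ => -xq p 1 0) V) :=
    IsLower.of_commute fun m => commute_funH_projFam V _ _
  exact h.weak_mul (isLower_gen_e V)

theorem isNilpotent_expoF (V : Rep p) : IsNilpotent (expoF p V) := (isLower_expoF V).isNilpotent
theorem isNilpotent_expoE (V : Rep p) : IsNilpotent (expoE p V) := (isLower_expoE V).isNilpotent

/-- The decomposition of operators on `V ⊗ W` by the weights of `W`. -/
def Rep.gradingRight (V W : Rep p) : WeightGrading (Op (V.V ⊗[ℂ] W.V)) :=
  W.grading.map (opRight V.V W.V).toRingHom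

theorem Rep.gradingRight_proj (V W : Rep p) (m : ℤ) :
    (V.gradingRight W).proj m = leg2 (projFam p m) V W := rfl

theorem leg2_projFam (m : ℤ) :
    leg2 (projFam p m) = funHH p fun _ n => (Pi.single m 1 : ℤ → Fld) n := by
  rw [projFam_eq_funH, leg2_funH]

theorem commute_funHH_gradingRight (V W : Rep p) (g : ℤ → ℤ → Fld) (m : ℤ) :
    Commute (funHH p g V W) ((V.gradingRight W).proj m) := by
  rw [Rep.gradingRight_proj, leg2_projFam]
  exact congrFun (congrFun (funHH_commute g _).eq V) W

theorem commute_leg1_gradingRight (V W : Rep p) (a : Fam1 p) (m : ℤ) :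
    Commute (leg1 a V W) ((V.gradingRight W).proj m) :=
  commute_opLeft_opRight _ _ _ _

theorem isLower_leg2 {d : ℤ} {a : Fam1 p} {W : Rep p} (V : Rep p) (h : IsLower W.grading d (a W)) :
    IsLower (V.gradingRight W) d (leg2 a V W) := fun m m' hm => by
  have := congrArg (opRight V.V W.V) (h m m' hm)
  rw [map_mul, map_mul, map_zero] at this
  exact this

theorem isLower_genF2 (V W : Rep p) : IsLower (V.gradingRight W) 1 (genF2 p V W) :=
  isLower_leg2 V (isLower_gen_f W)

theorem isLower_genE1_genF2 (V W : Rep p) :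
    IsLower (V.gradingRight W) 1 ((genE1 p * genF2 p) V W) :=
  (IsLower.of_commute (commute_leg1_gradingRight V W _)).weak_mul (isLower_genF2 V W)

theorem isLower_expoR (V W : Rep p) : IsLower (V.gradingRight W) 1 (expoR p V W) :=
  (IsLower.of_commute (commute_funHH_gradingRight V W _)).weak_mul (isLower_genE1_genF2 V W)

theorem isNilpotent_expoR (V W : Rep p) : IsNilpotent (expoR p V W) :=
  (isLower_expoR V W).isNilpotent

theorem matK_mul_invK : matK p * invK p = 1 := by
  rw [matK_eq, invK]
  exact funHH_mul_eq_one fun m n => xq_mul_neg _ _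

theorem invK_mul_matK : invK p * matK p = 1 := by
  rw [← matK_mul_invK, matK_eq, invK, (funHH_commute _ _).eq]

theorem leg1Shift_expoE : leg1Shift (expoE p) = funHH p (fun _ n => -xq p 1 n) * genE1 p := by
  rw [expoE, leg1Shift_mul, leg1Shift_funH, leg1Shift_gen]
  congr 1
  refine funHH_congr fun m n => ?_
  rw [map_neg, shiftFld_xq]
  simp

theorem leg2_expoE : leg2 (expoE p) = funHH p (fun _ _ => -xq p 1 0) * genE2 p := by
  rw [expoE, leg2_mul, leg2_funH]; rfl

theorem leg1_expoF : leg1 (expoF p) = funHH p (fun m _ => xq p (-1) (-(m + 1))) * genF1 p := by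
  rw [expoF, leg1_mul, leg1_funH]; rfl

theorem leg2_expoF : leg2 (expoF p) = funHH p (fun _ n => xq p (-1) (-(n + 1))) * genF2 p := by
  rw [expoF, leg2_mul, leg2_funH]; rfl

theorem leg1Shift_expoF :
    leg1Shift (expoF p) = funHH p (fun m n => xq p (-1) (-(m + n + 1))) * genF1 p := by
  rw [expoF, leg1Shift_mul, leg1Shift_funH, leg1Shift_gen]
  congr 1
  refine funHH_congr fun m n => ?_
  rw [shiftFld_xq]
  refine xq_congr rfl ?_
  push_cast; ring

/-- `Δ(C⁺) = C⁺₁(x q^{h₂}) C⁺₂`. -/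
theorem coprod_elemCPlus : coprod (elemCPlus p) = leg1Shift (elemCPlus p) * leg2 (elemCPlus p) := by
  rw [elemCPlus_eq, leg1Shift_exp1 isNilpotent_expoE, leg2_exp1 isNilpotent_expoE, coprod_exp1,
    ← exp2_add _ (isNilpotent_leg1Shift isNilpotent_expoE) (isNilpotent_leg2 isNilpotent_expoE)]
  · congr 1
    rw [leg1Shift_expoE, leg2_expoE, expoE, coprod_mul, coprod_funH, coprod_gen_e, mul_add,
      genE1_mul_funHH, ← mul_assoc, funHH_mul]
    congr 2
    refine funHH_congr fun m n => ?_
    rw [Pi.mul_apply, Pi.mul_apply, C_pow_eq, neg_mul, xq_mul]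
    simp
  · rw [leg1Shift_expoE, leg2_expoE]
    simp only [mul_assoc, genE1_mul_funHH_mul, genE2_mul_funHH_mul, funHH_mul_mul, smul_funHH_mul,
      ← genE1_mul_genE2]
    congr 1
    refine funHH_congr fun m n => ?_
    simp only [Pi.mul_apply, neg_mul_neg, xq_mul, C_base]
    refine xq_congr (by ring) ?_
    push_cast; ring

theorem C_q_eq : (RatFunc.C (p.q - p.q⁻¹) : Fld) = xq p 0 1 - xq p 0 (-1) := by
  have h : p.q⁻¹ = p.pow (-1) := by
    rw [inv_eq_iff_eq_inv, eq_comm]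
    refine inv_eq_of_mul_eq_one_right ?_
    rw [QParam.q, ← p.pow_add]; simp [p.pow_zero]
  rw [map_sub, h, QParam.q, C_pow_eq, C_pow_eq]

/-- `C⁺₁(x q^{h₂}) C⁻₂(x)⁻¹ = C⁻₂(x)⁻¹ R̂ C⁺₁(x q^{h₂})`: conjugation by `C⁺₁(x q^{h₂})` sends the
exponent of `C⁻₂(x)⁻¹` to its sum with the exponent of `R̂`, and the exponential of this sum is a
product by the addition theorem. -/
theorem leg1Shift_elemCPlus_mul : leg1Shift (elemCPlus p) * leg2 (invCMinus p) =
    leg2 (invCMinus p) * matRhat p * leg1Shift (elemCPlus p) := by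
  have hn := isNilpotent_leg2 (p := p) isNilpotent_expoF
  have hc : leg1Shift (expoE p) * leg2 (expoF p) =
      p.base • (leg2 (expoF p) * leg1Shift (expoE p)) := by
    rw [leg1Shift_expoE, leg2_expoF]
    simp only [mul_assoc, genE1_mul_funHH_mul, genF2_mul_funHH_mul, funHH_mul_mul, smul_funHH_mul,
      ← genE1_mul_genF2]
    congr 1
    refine funHH_congr fun m n => ?_
    simp only [Pi.mul_apply, neg_mul, mul_neg, xq_mul, C_base, neg_inj]
    refine xq_congr (by ring) ?_
    push_cast; ring
  have hv : leg1Shift (expoE p) * leg2 (expoF p) - leg2 (expoF p) * leg1Shift (expoE p) =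
      expoR p := by
    rw [leg1Shift_expoE, leg2_expoF, expoR, C_q_eq]
    simp only [mul_assoc, genE1_mul_funHH_mul, genF2_mul_funHH_mul, funHH_mul_mul,
      ← genE1_mul_genF2]
    rw [sub_eq_iff_eq_add, ← sub_eq_zero]
    rw [← add_mul, ← sub_mul]
    have h0 : ∀ a b c : ℤ → ℤ → Fld, (∀ m n, a m n - (b m n + c m n) = 0) →
        (funHH p a - (funHH p b + funHH p c)) = 0 := by
      intro a b c h
      funext V W
      refine op_ext₂ fun m n => ?_
      simp only [Pi.sub_apply, Pi.add_apply, Pi.zero_apply, zero_mul, sub_mul, add_mul,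
        funHH_mul_projPair, ← sub_smul, ← add_smul, h, zero_smul]
    rw [h0, zero_mul]
    intro m n
    simp only [Pi.mul_apply, neg_mul, mul_neg, xq_mul]
    rw [show xq p (1 + -1) ((n : ℂ) + -(n + 1)) = xq p 0 (-1) from xq_congr (by ring) (by ring),
      show xq p (-1 + 1) (-((n : ℂ) + 1) + (n + 2 : ℤ)) = xq p 0 1 from
        xq_congr (by ring) (by push_cast; ring)]
    ring
  have h1 := exp2_mul_of_commute_up_to hc (isNilpotent_leg1Shift isNilpotent_expoE)
  rw [hv] at h1
  have hu : IsUnit (exp2 p (leg1Shift (expoE p))) :=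
    isUnit_exp2 (isNilpotent_leg1Shift isNilpotent_expoE)
  rw [elemCPlus_eq, leg1Shift_exp1 isNilpotent_expoE, invCMinus, leg2_exp1 isNilpotent_expoF,
    mul_exp2_of_mul_eq (Ring.mul_inverse_cancel _ hu) (Ring.inverse_mul_cancel _ hu) h1 hn,
    matRhat_eq, exp2_add _ hn isNilpotent_expoR]
  rw [leg2_expoF, expoR]
  simp only [mul_assoc, genE1_mul_funHH_mul, genF2_mul_funHH_mul, funHH_mul_mul, smul_funHH_mul]
  rw [← mul_assoc (genF2 p), ← genE1_mul_genF2, mul_assoc]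
  congr 1
  refine funHH_congr fun m n => ?_
  simp only [Pi.mul_apply, C_base]
  rw [mul_comm (RatFunc.C _), ← mul_assoc, xq_mul]
  congr 1
  refine xq_congr (by ring) ?_
  push_cast; ring

/-- `K C⁻₁(x)⁻¹ = C⁻₁(x q^{h₂})⁻¹ K`. -/
theorem matK_mul_leg1_invCMinus :
    matK p * leg1 (invCMinus p) = leg1Shift (invCMinus p) * matK p := by
  rw [invCMinus, leg1_exp1 isNilpotent_expoF, leg1Shift_exp1 isNilpotent_expoF]
  refine mul_exp2_of_mul_eq matK_mul_invK invK_mul_matK ?_ (isNilpotent_leg1 isNilpotent_expoF)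
  rw [leg1_expoF, leg1Shift_expoF, matK_eq, funHH_mul_mul, mul_assoc, genF1_mul_funHH,
    funHH_mul_mul]
  congr 1
  refine funHH_congr fun m n => ?_
  simp only [Pi.mul_apply, xq_mul]
  refine xq_congr (by ring) ?_
  push_cast; ring

/-- `Δ(C⁻)⁻¹ = K² C⁻₂(x)⁻¹ K⁻² C⁻₁(x q^{h₂})⁻¹`, by the addition theorem for the two terms
of `Δ(f)`. -/
theorem coprod_invCMinus : coprod (invCMinus p) =
    matK p * matK p * leg2 (invCMinus p) * (invK p * invK p) * leg1Shift (invCMinus p) := by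
  set b : Fam2 p := funHH p (fun m n => xq p (-1) (-(2 * m + n + 1))) * genF2 p with hb
  have hn := isNilpotent_leg2 (p := p) isNilpotent_expoF
  have h1 : matK p * matK p * (invK p * invK p) = 1 := by
    rw [mul_assoc, ← mul_assoc (matK p) (invK p), matK_mul_invK, one_mul, matK_mul_invK]
  have h2 : invK p * invK p * (matK p * matK p) = 1 := by
    rw [mul_assoc, ← mul_assoc (invK p) (matK p), invK_mul_matK, one_mul, invK_mul_matK]
  have h3 : matK p * matK p * leg2 (expoF p) = b * (matK p * matK p) := by
    rw [leg2_expoF, hb, matK_eq, funHH_mul, funHH_mul_mul, mul_assoc (funHH p _) (genF2 p),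
      genF2_mul_funHH, funHH_mul_mul]
    congr 1
    refine funHH_congr fun m n => ?_
    simp only [Pi.mul_apply, xq_mul]
    refine xq_congr (by ring) ?_
    push_cast; ring
  have h4 : matK p * matK p * leg2 (invCMinus p) * (invK p * invK p) = exp2 p b := by
    rw [invCMinus, leg2_exp1 isNilpotent_expoF, mul_exp2_of_mul_eq h1 h2 h3 hn, mul_assoc, h1,
      mul_one]
  have hbn : ∀ V W, IsNilpotent (b V W) := fun V W => IsLower.isNilpotent (G := V.gradingRight W)
    ((IsLower.of_commute (commute_funHH_gradingRight V W _)).weak_mul (isLower_genF2 V W))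
  rw [h4, invCMinus, leg1Shift_exp1 isNilpotent_expoF, coprod_exp1,
    ← exp2_add _ hbn (isNilpotent_leg1Shift isNilpotent_expoF)]
  · congr 1
    rw [expoF, coprod_mul, coprod_funH, coprod_gen_f, ← expoF, leg1Shift_expoF, mul_add,
      funHH_mul_mul, add_comm, hb]
    congr 2
    · refine funHH_congr fun m n => ?_
      simp only [Pi.mul_apply, C_pow_eq, xq_mul]
      refine xq_congr (by ring) ?_
      push_cast; ring
    · refine funHH_congr fun m n => ?_
      refine xq_congr (by ring) ?_
      push_cast; ring
  · rw [leg1Shift_expoF, hb]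
    simp only [mul_assoc, genF1_mul_funHH_mul, genF2_mul_funHH_mul, funHH_mul_mul, smul_funHH_mul,
      ← genF1_mul_genF2]
    congr 1
    refine funHH_congr fun m n => ?_
    simp only [Pi.mul_apply, xq_mul, C_base]
    refine xq_congr (by ring) ?_
    push_cast; ring

/-- `R̂ Δ(f) = (f ⊗ 1 + q^h ⊗ f) R̂`. -/
theorem matRhat_mul_coprod_gen_f : matRhat p * coprod (gen p (Uq.of p .f)) =
    (genF1 p + funHH p (fun m _ => RatFunc.C (p.pow m)) * genF2 p) * matRhat p := by
  rw [matRhat_eq, coprod_gen_f]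
  have hE : genE1 p * genF1 p = genF1 p * genE1 p +
      funHH p fun m _ => RatFunc.C ((p.q - p.q⁻¹)⁻¹ * (p.pow m - p.pow (-m))) := by
    rw [← genE1_mul_genF1_sub]; abel
  have hq : p.q - p.q⁻¹ ≠ 0 := by
    intro h
    have h1 : (RatFunc.C (p.q - p.q⁻¹) : Fld) * xq p 0 (-1) = RatFunc.C (p.base - 1) * -1 := by
      rw [C_q_eq, map_sub, C_base, sub_mul, xq_mul, xq_mul, map_one, sub_mul, one_mul, add_zero,
        add_neg_cancel, xq_zero, show (-1 : ℂ) + -1 = -2 by norm_num]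
      ring
    rw [h, map_zero, zero_mul, zero_eq_mul] at h1
    rcases h1 with h1 | h1
    · rw [map_eq_zero] at h1
      exact p.one_sub_base_ne_zero (by rw [← neg_sub, h1, neg_zero])
    · norm_num at h1
  refine exp2_mul_add ?_ ?_ ?_ isNilpotent_expoR
  · rw [expoR, mul_assoc, mul_assoc, ← genF1_mul_genF2, ← mul_assoc (genE1 p), hE, add_mul,
      mul_add, genF1_mul_funHH_mul, mul_assoc (genF1 p), add_sub_cancel_left, funHH_mul_mul,
      ← sub_mul]
    congr 1
    funext V W
    refine op_ext₂ fun m n => ?_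
    simp only [Pi.sub_apply, sub_mul, funHH_mul_projPair, ← sub_smul, Pi.mul_apply]
    rw [← map_mul, ← mul_assoc, mul_inv_cancel₀ hq, one_mul, map_sub]
  · rw [expoR]
    simp only [mul_assoc, genE1_mul_funHH_mul, genF2_mul_funHH_mul, funHH_mul_mul, smul_funHH_mul]
    rw [← mul_assoc (genF2 p) (genE1 p), ← genE1_mul_genF2, mul_assoc]
    congr 1
    refine funHH_congr fun m n => ?_
    simp only [Pi.mul_apply, C_base, C_pow_eq]
    rw [mul_left_comm, mul_comm (xq p 0 m), mul_comm (xq p 0 (-2)), mul_assoc, xq_mul]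
    congr 1
    refine xq_congr (by ring) ?_
    push_cast; ring
  · rw [expoR]
    simp only [mul_assoc, genE1_mul_funHH_mul, genF2_mul_funHH_mul, funHH_mul_mul, smul_funHH_mul]
    rw [← mul_assoc (genF2 p) (genE1 p), ← genE1_mul_genF2, mul_assoc]
    congr 1
    refine funHH_congr fun m n => ?_
    simp only [Pi.mul_apply, C_base, C_pow_eq]
    rw [mul_left_comm, xq_mul, mul_comm]
    congr 1
    refine xq_congr (by ring) ?_
    push_cast; ring

end Relations

/-! ### Naturality and rationality -/

section Natural

/-- Pairs of operators on `X` and `Y` which are intertwined by `φ : X → Y`. -/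
def natSubalgebra {X Y : Type} [AddCommGroup X] [Module ℂ X] [AddCommGroup Y] [Module ℂ Y]
    (φ : X →ₗ[ℂ] Y) : Subalgebra ℂ (Op X × Op Y) where
  carrier := {a | LinearMap.lTensor Fld (LinearMap.llcomp ℂ X X Y φ) a.1 =
    LinearMap.lTensor Fld (LinearMap.lcomp ℂ Y φ) a.2}
  add_mem' {a b} ha hb := by
    have ha' : _ = _ := ha
    have hb' : _ = _ := hb
    change _ = _
    rw [Prod.fst_add, Prod.snd_add, map_add, map_add, ha', hb']
  mul_mem' {a b} ha hb := by
    -- both sides are computed in the bimodule `ℂ(ν̃) ⊗ Hom(X, Y)`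
    have ha' : _ = _ := ha
    have hb' : _ = _ := hb
    change _ = _
    have h1 : ∀ s t : Op X, LinearMap.lTensor Fld (LinearMap.llcomp ℂ X X Y φ) (s * t) =
        TensorProduct.map₂ (LinearMap.mul ℂ Fld) (LinearMap.llcomp ℂ X X Y)
          (LinearMap.lTensor Fld (LinearMap.llcomp ℂ X X Y φ) s) t := by
      intro s t
      induction s using TensorProduct.induction_on with
      | zero => simp
      | add x y hx hy => simp only [add_mul, map_add, hx, hy, LinearMap.add_apply]
      | tmul g A =>
        induction t using TensorProduct.induction_on with
        | zero => simp
        | add x y hx hy => simp only [mul_add, map_add, hx, hy]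
        | tmul g' A' => simp; rfl
    have h2 : ∀ (s : Op Y) (t : Op X),
        TensorProduct.map₂ (LinearMap.mul ℂ Fld) (LinearMap.llcomp ℂ X X Y)
          (LinearMap.lTensor Fld (LinearMap.lcomp ℂ Y φ) s) t =
        TensorProduct.map₂ (LinearMap.mul ℂ Fld) (LinearMap.llcomp ℂ X Y Y) s
          (LinearMap.lTensor Fld (LinearMap.llcomp ℂ X X Y φ) t) := by
      intro s t
      induction s using TensorProduct.induction_on with
      | zero => simp
      | add x y hx hy => simp only [map_add, hx, hy, LinearMap.add_apply]
      | tmul g A =>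
        induction t using TensorProduct.induction_on with
        | zero => simp
        | add x y hx hy => simp only [map_add, hx, hy]
        | tmul g' A' => simp; rfl
    have h3 : ∀ s t : Op Y, TensorProduct.map₂ (LinearMap.mul ℂ Fld) (LinearMap.llcomp ℂ X Y Y) s
          (LinearMap.lTensor Fld (LinearMap.lcomp ℂ Y φ) t) =
        LinearMap.lTensor Fld (LinearMap.lcomp ℂ Y φ) (s * t) := by
      intro s t
      induction s using TensorProduct.induction_on with
      | zero => simp
      | add x y hx hy => simp only [add_mul, map_add, hx, hy, LinearMap.add_apply]
      | tmul g A =>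
        induction t using TensorProduct.induction_on with
        | zero => simp
        | add x y hx hy => simp only [mul_add, map_add, hx, hy]
        | tmul g' A' => simp; rfl
    rw [Prod.fst_mul, Prod.snd_mul, h1, ha', h2, hb', h3]
  algebraMap_mem' z := by
    have h : ∀ X : Type, ∀ [AddCommGroup X] [Module ℂ X],
        algebraMap ℂ (Op X) z = algebraMap ℂ Fld z ⊗ₜ (1 : Module.End ℂ X) := fun _ => rfl
    change LinearMap.lTensor Fld _ (algebraMap ℂ (Op X) z) =
      LinearMap.lTensor Fld _ (algebraMap ℂ (Op Y) z)
    rw [h, h, LinearMap.lTensor_tmul, LinearMap.lTensor_tmul]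
    rfl

variable {X Y : Type} [AddCommGroup X] [Module ℂ X] [AddCommGroup Y] [Module ℂ Y]
  {φ : X →ₗ[ℂ] Y}

theorem tmul_mem_natSubalgebra (g : Fld) {A : Module.End ℂ X} {A' : Module.End ℂ Y}
    (h : φ ∘ₗ A = A' ∘ₗ φ) : ((g ⊗ₜ A, g ⊗ₜ A') : Op X × Op Y) ∈ natSubalgebra φ := by
  change LinearMap.lTensor Fld _ (g ⊗ₜ A) = LinearMap.lTensor Fld _ (g ⊗ₜ A')
  rw [LinearMap.lTensor_tmul, LinearMap.lTensor_tmul]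
  exact congrArg _ h

variable {p : QParam} {V V' W W' : Rep p}

theorem isNatural1_iff {a : Fam1 p} : IsNatural1 a ↔ ∀ (V W : Rep p) (φ : V.V →ₗ[ℂ] W.V),
    IsIntertwiner φ → (a V, a W) ∈ natSubalgebra φ := Iff.rfl

theorem gen_mem_natSubalgebra {φ : V.V →ₗ[ℂ] W.V} (hφ : IsIntertwiner φ) (u : Uq p) :
    (gen p u V, gen p u W) ∈ natSubalgebra φ :=
  tmul_mem_natSubalgebra 1 (hφ u)

theorem funH_mem_natSubalgebra {φ : V.V →ₗ[ℂ] W.V} (hφ : IsIntertwiner φ) (g : ℤ → Fld) :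
    (funH p g V, funH p g W) ∈ natSubalgebra φ := by
  rw [funH_eq_sum V g Finset.subset_union_left (s := V.weights ∪ W.weights),
    funH_eq_sum W g Finset.subset_union_right (s := V.weights ∪ W.weights), prod_mk_sum]
  exact sum_mem fun m _ => tmul_mem_natSubalgebra _ (mul_proj_of_isIntertwiner hφ m)

theorem funHH_mem_natSubalgebra {φ : V.V →ₗ[ℂ] V'.V} {ψ : W.V →ₗ[ℂ] W'.V} (hφ : IsIntertwiner φ)
    (hψ : IsIntertwiner ψ) (g : ℤ → ℤ → Fld) :
    (funHH p g V W, funHH p g V' W') ∈ natSubalgebra (TensorProduct.map φ ψ) := by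
  rw [funHH_eq_sum V W g Finset.subset_union_left Finset.subset_union_left
      (s := V.weights ∪ V'.weights) (t := W.weights ∪ W'.weights),
    funHH_eq_sum V' W' g Finset.subset_union_right Finset.subset_union_right
      (s := V.weights ∪ V'.weights) (t := W.weights ∪ W'.weights), prod_mk_sum]
  refine sum_mem fun m _ => ?_
  rw [prod_mk_sum]
  refine sum_mem fun n _ => tmul_mem_natSubalgebra _ ?_
  rw [← TensorProduct.map_comp, ← TensorProduct.map_comp, mul_proj_of_isIntertwiner hφ,
    mul_proj_of_isIntertwiner hψ]

theorem genE1_mul_genF2_mem_natSubalgebra {φ : V.V →ₗ[ℂ] V'.V} {ψ : W.V →ₗ[ℂ] W'.V}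
    (hφ : IsIntertwiner φ) (hψ : IsIntertwiner ψ) :
    ((genE1 p * genF2 p) V W, (genE1 p * genF2 p) V' W') ∈
      natSubalgebra (TensorProduct.map φ ψ) := by
  have h : ∀ V W : Rep p, (genE1 p * genF2 p) V W =
      1 ⊗ₜ TensorProduct.map (V.ρ (Uq.of p .e)) (W.ρ (Uq.of p .f)) := fun V W =>
    (gen_tensor_eq V W _ _).symm
  rw [h, h]
  refine tmul_mem_natSubalgebra _ ?_
  rw [← TensorProduct.map_comp, ← TensorProduct.map_comp, hφ, hψ]

theorem isNatural1_mul {a b : Fam1 p} (ha : IsNatural1 a) (hb : IsNatural1 b) :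
    IsNatural1 (a * b) := fun V W φ hφ =>
  mul_mem (show (a V, a W) ∈ natSubalgebra φ from ha V W φ hφ)
    (show (b V, b W) ∈ natSubalgebra φ from hb V W φ hφ)

theorem isNatural1_one : IsNatural1 (1 : Fam1 p) := fun _ _ φ _ => one_mem (natSubalgebra φ)

theorem isNatural1_exp1 {a : Fam1 p} (ha : IsNatural1 a) (hn : ∀ V, IsNilpotent (a V)) :
    IsNatural1 (exp1 p a) := fun V W φ hφ => by
  have h := qInvExp_mem p (natSubalgebra φ) (isNatural1_iff.1 ha V W φ hφ)
  have hN : IsNilpotent (a V, a W) := by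
    obtain ⟨m, hm⟩ := hn V
    obtain ⟨n, hn⟩ := hn W
    refine ⟨m + n, ?_⟩
    rw [Prod.pow_mk, pow_eq_zero_of_le (Nat.le_add_right m n) hm,
      pow_eq_zero_of_le (Nat.le_add_left n m) hn]
    rfl
  have h1 := map_qInvExp p (AlgHom.fst ℂ (Op V.V) (Op W.V)) hN
  have h2 := map_qInvExp p (AlgHom.snd ℂ (Op V.V) (Op W.V)) hN
  have h3 : qInvExp p (a V, a W) = (exp1 p a V, exp1 p a W) := Prod.ext h1 h2
  rw [h3] at h
  exact h

theorem isUnit_fam {a : Fam1 p} (hn : ∀ V, IsNilpotent (a V - 1)) : IsUnit a :=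
  Pi.isUnit_iff.2 fun V => isUnit_of_isNilpotent_sub_one (hn V)

theorem inverse_apply {a : Fam1 p} (ha : IsUnit a) (V : Rep p) :
    Ring.inverse a V = Ring.inverse (a V) :=
  map_ringInverse (Pi.evalRingHom _ V) ha

theorem isNatural1_inverse {a : Fam1 p} (ha : IsNatural1 a) (hn : ∀ V, IsNilpotent (a V - 1)) :
    IsNatural1 (Ring.inverse a) := fun V W φ hφ => by
  have hN : IsNilpotent ((a V, a W) - 1) := by
    obtain ⟨m, hm⟩ := hn V
    obtain ⟨n, hn⟩ := hn W
    refine ⟨m + n, ?_⟩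
    change ((a V - 1, a W - 1) : Op V.V × Op W.V) ^ (m + n) = 0
    rw [Prod.pow_mk, pow_eq_zero_of_le (Nat.le_add_right m n) hm,
      pow_eq_zero_of_le (Nat.le_add_left n m) hn]
    rfl
  have h := inverse_mem_of_isNilpotent (natSubalgebra φ).toSubring
    (isNatural1_iff.1 ha V W φ hφ) hN
  have hu := isUnit_of_isNilpotent_sub_one hN
  have h1 := map_ringInverse (RingHom.fst (Op V.V) (Op W.V)) hu
  have h2 := map_ringInverse (RingHom.snd (Op V.V) (Op W.V)) hu
  have h3 : Ring.inverse (a V, a W) = (Ring.inverse a V, Ring.inverse a W) := by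
    rw [inverse_apply (isUnit_fam hn), inverse_apply (isUnit_fam hn)]
    exact Prod.ext h1 h2
  rw [h3] at h
  exact h

/-- The subfield `ℂ(ν̃ ^ n)`. -/
def powSubfield (n : ℕ) (hn : n ≠ 0) : Subfield Fld := (powFld n hn).toRingHom.fieldRange

theorem C_mem_powSubfield (n : ℕ) (hn : n ≠ 0) (z : ℂ) : RatFunc.C z ∈ powSubfield n hn :=
  ⟨RatFunc.C z, algHom_C _ z⟩

theorem xVar_mem_powSubfield : xVar ∈ powSubfield 4 (by norm_num) :=
  ⟨RatFunc.X, powFld_X 4 _⟩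

theorem xVar_sq_mem_powSubfield : xVar ^ 2 ∈ powSubfield 8 (by norm_num) :=
  ⟨RatFunc.X, (powFld_X 8 _).trans (by rw [xVar]; ring)⟩

theorem xq_mem_powSubfield (k : ℤ) (z : ℂ) : xq p k z ∈ powSubfield 4 (by norm_num) :=
  mul_mem (zpow_mem xVar_mem_powSubfield k) (C_mem_powSubfield _ _ _)

theorem xq_even_mem_powSubfield (k : ℤ) (z : ℂ) : xq p (2 * k) z ∈ powSubfield 8 (by norm_num) := by
  rw [xq, zpow_mul]
  exact mul_mem (zpow_mem xVar_sq_mem_powSubfield k) (C_mem_powSubfield _ _ _)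

theorem tmul_mem_range {n : ℕ} {hn : n ≠ 0} {g : Fld} (hg : g ∈ powSubfield n hn)
    (A : Module.End ℂ X) : g ⊗ₜ A ∈ (mapCoeff X (powFld n hn)).range := by
  obtain ⟨g', rfl⟩ := hg
  exact ⟨g' ⊗ₜ A, rfl⟩

theorem funH_mem_range {n : ℕ} {hn : n ≠ 0} {g : ℤ → Fld} (hg : ∀ m, g m ∈ powSubfield n hn)
    (V : Rep p) : funH p g V ∈ (mapCoeff V.V (powFld n hn)).range :=
  sum_mem fun m _ => tmul_mem_range (hg m) _

theorem funHH_mem_range {n : ℕ} {hn : n ≠ 0} {g : ℤ → ℤ → Fld}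
    (hg : ∀ k l, g k l ∈ powSubfield n hn) (V W : Rep p) :
    funHH p g V W ∈ (mapCoeff (V.V ⊗[ℂ] W.V) (powFld n hn)).range :=
  sum_mem fun k _ => sum_mem fun l _ => tmul_mem_range (hg k l) _

theorem gen_mem_range (n : ℕ) (hn : n ≠ 0) (u : Uq p) (V : Rep p) :
    gen p u V ∈ (mapCoeff V.V (powFld n hn)).range :=
  tmul_mem_range (one_mem _) _

theorem isNuRational1_mul {a b : Fam1 p} (ha : IsNuRational1 a) (hb : IsNuRational1 b) :
    IsNuRational1 (a * b) := fun V => mul_mem (ha V) (hb V)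

theorem isNuRational1_exp1 {a : Fam1 p} (ha : IsNuRational1 a) : IsNuRational1 (exp1 p a) :=
  fun V => qInvExp_mem p _ (ha V)

theorem isNuRational1_inverse {a : Fam1 p} (ha : IsNuRational1 a)
    (hn : ∀ V, IsNilpotent (a V - 1)) : IsNuRational1 (Ring.inverse a) := fun V => by
  rw [inverse_apply (isUnit_fam hn)]
  exact inverse_mem_of_isNilpotent (mapCoeff V.V _).range.toSubring (ha V) (hn V)

end Natural

/-! ### Series in the negative generator -/

section SeriesFam

variable {p : QParam}

theorem isLower_evalSeries_sub_one {ι k R : Type} [Field k] [Ring R] {G : WeightGrading R}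
    {χ : (ι → k) →+* R} {f : R} {c : ℕ → ι → k} (hχ : ∀ g, IsLower G 0 (χ g))
    (hf : IsLower G 1 f) (hc : c 0 = 1) : IsLower G 1 (evalSeries χ f c - 1) := by
  obtain ⟨N, hN⟩ := hf.isNilpotent
  rw [evalSeries_eq_sum χ c (pow_eq_zero_of_le (Nat.le_succ N) hN), Finset.sum_range_succ', hc,
    pow_zero, mul_one, χ.map_one, add_sub_cancel_right]
  refine IsLower.sum fun n _ => (hχ _).weak_mul ((hf.pow (n + 1)).mono ?_)
  push_cast; omega

theorem commute_evalSeries {ι k R : Type} [Field k] [Ring R] {χ : (ι → k) →+* R} {f a : R}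
    (hχ : ∀ g, Commute a (χ g)) (hf : Commute a f) (c : ℕ → ι → k) :
    Commute a (evalSeries χ f c) :=
  Commute.sum_right _ _ _ fun n _ => (hχ _).mul_right (hf.pow_right n)

theorem evalSeries_mem {ι k R : Type} [Field k] [Ring R] (S : Subring R) {χ : (ι → k) →+* R}
    {f : R} {c : ℕ → ι → k} (hχ : ∀ n, χ (c n) ∈ S) (hf : f ∈ S) : evalSeries χ f c ∈ S :=
  sum_mem fun n _ => mul_mem (hχ n) (pow_mem hf n)

/-- The eigenvalues of `B(x)`. -/
def eigB (p : QParam) (m : ℤ) : Fld := xq p m (m ^ 2 / 2)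

theorem intDegree_X_pow (n : ℕ) : RatFunc.intDegree (RatFunc.X ^ n : Fld) = n := by
  induction n with
  | zero => simp
  | succ n ih =>
    rw [pow_succ, RatFunc.intDegree_mul (pow_ne_zero _ RatFunc.X_ne_zero) RatFunc.X_ne_zero, ih,
      RatFunc.intDegree_X]
    push_cast; ring

theorem xq_ne_one {k : ℤ} (hk : k ≠ 0) (z : ℂ) : xq p k z ≠ 1 := by
  have key : ∀ (n : ℕ) (z : ℂ), n ≠ 0 → xq p n z ≠ 1 := by
    intro n z hn h
    have h1 := congrArg RatFunc.intDegree h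
    rw [xq, zpow_natCast, xVar, ← pow_mul, RatFunc.intDegree_mul
      (pow_ne_zero _ RatFunc.X_ne_zero) (by simpa using p.pow_ne_zero z), intDegree_X_pow,
      RatFunc.intDegree_C, RatFunc.intDegree_one] at h1
    push_cast at h1
    omega
  obtain ⟨n, rfl | rfl⟩ := k.eq_nat_or_neg
  · exact key n z (by simpa using hk)
  · intro h
    have h1 := xq_mul_neg (p := p) n (-z)
    rw [neg_neg, h, mul_one] at h1
    exact key n (-z) (by simpa using hk) h1

theorem xq_eq_xq {k l : ℤ} {y z : ℂ} (h : xq p k y = xq p l z) : k = l := by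
  by_contra hkl
  have h1 := xq_mul_neg (p := p) l z
  rw [← h, xq_mul] at h1
  exact xq_ne_one (by omega) _ h1

theorem eigB_injective : Function.Injective (eigB p) := fun _ _ h => xq_eq_xq h

theorem iterate_add_two (n : ℕ) (m : ℤ) : (fun m : ℤ => m + 2)^[n] m = m + 2 * n := by
  induction n generalizing m with
  | zero => simp
  | succ n ih => rw [Function.iterate_succ_apply, ih]; push_cast; ring

/-- The coefficients of `(C⁻)⁻¹` as a series in `f`. -/
def coeffD (p : QParam) : ℕ → ℤ → Fld := expCoeff p (fun m => m + 2) fun m => xq p (-1) (-(m + 1))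

/-- The coefficients of `M⁽⁻⁾` as a series in `f`. -/
def coeffM (p : QParam) : ℕ → ℤ → Fld := seriesCoeff (fun m => m + 2) (coeffD p) (eigB p)

/-- The factor `M⁽⁻⁾`. -/
def elemMMinus (p : QParam) : Fam1 p := fun V =>
  evalSeries (funHAt V) (gen p (Uq.of p .f) V) (coeffM p)

theorem gen_f_mul_funHAt (V : Rep p) (g : ℤ → Fld) : gen p (Uq.of p .f) V * funHAt V g =
    funHAt V (g ∘ fun m => m + 2) * gen p (Uq.of p .f) V :=
  congrFun (gen_f_mul_funH g) V

theorem isNilpotent_gen_f (V : Rep p) : IsNilpotent (gen p (Uq.of p .f) V) :=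
  (isLower_gen_f V).isNilpotent

theorem expCoeff_zero {ι k : Type} [Field k] [Algebra ℂ k] (σ : ι → ι) (g : ι → k) :
    expCoeff p σ g 0 = 1 := by
  funext i
  simp [expCoeff, qInvFactorial_zero]

theorem invCMinus_apply (V : Rep p) :
    invCMinus p V = evalSeries (funHAt V) (gen p (Uq.of p .f) V) (coeffD p) :=
  qInvExp_eq_evalSeries p (gen_f_mul_funHAt V) (funHAt_smul V) (isNilpotent_gen_f V) _

/-- The defining equation of `M⁽⁻⁾`: `B M⁽⁻⁾ = (C⁻)⁻¹ M⁽⁻⁾ B`. -/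
theorem elemB_mul_elemMMinus :
    elemB p * elemMMinus p = invCMinus p * elemMMinus p * elemB p := by
  funext V
  simp only [Pi.mul_apply, invCMinus_apply]
  refine evalSeries_intertwines (gen_f_mul_funHAt V) (isNilpotent_gen_f V) (b := eigB p)
    (expCoeff_zero _ _) (fun i => xq_ne_zero _ _) fun n i h => ?_
  have h1 := eigB_injective h
  rw [iterate_add_two] at h1
  push_cast at h1
  omega

theorem isLower_elemMMinus (V : Rep p) : IsLower V.grading 1 ((elemMMinus p - 1) V) :=
  isLower_evalSeries_sub_one (isLower_funH V) (isLower_gen_f V) (seriesCoeff_zero _ _ _)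

theorem isNilpotent_elemMMinus (V : Rep p) : IsNilpotent (elemMMinus p V - 1) :=
  (isLower_elemMMinus V).isNilpotent

theorem isUnit_elemMMinus : IsUnit (elemMMinus p) := isUnit_fam isNilpotent_elemMMinus

theorem isNatural1_elemMMinus : IsNatural1 (elemMMinus p) := fun V W φ hφ => by
  obtain ⟨m, hm⟩ := isNilpotent_gen_f V
  obtain ⟨n, hn⟩ := isNilpotent_gen_f W
  change (elemMMinus p V, elemMMinus p W) ∈ natSubalgebra φ
  simp only [elemMMinus]
  rw [evalSeries_eq_sum _ _ (pow_eq_zero_of_le (Nat.le_add_right m n) hm),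
    evalSeries_eq_sum _ _ (pow_eq_zero_of_le (Nat.le_add_left n m) hn), prod_mk_sum]
  refine sum_mem fun k _ => ?_
  exact mul_mem (S := Subalgebra ℂ (Op V.V × Op W.V)) (funH_mem_natSubalgebra hφ (coeffM p k))
    (pow_mem (gen_mem_natSubalgebra hφ _) k)

theorem expCoeff_mem {ι : Type} {n : ℕ} {hn : n ≠ 0} {σ : ι → ι} {g : ι → Fld}
    (hg : ∀ i, g i ∈ powSubfield n hn) (k : ℕ) (i : ι) : expCoeff p σ g k i ∈ powSubfield n hn := by
  rw [expCoeff, Algebra.smul_def, RatFunc.algebraMap_eq_C]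
  exact mul_mem (C_mem_powSubfield _ _ _) (prod_mem fun l _ => hg _)

theorem isNuRational1_elemMMinus : IsNuRational1 (elemMMinus p) := fun V => by
  refine evalSeries_mem (mapCoeff V.V _).range.toSubring (fun n => ?_) (gen_mem_range _ _ _ V)
  refine funH_mem_range (fun m => ?_) V
  exact seriesCoeff_mem _ (expCoeff_mem fun _ => xq_mem_powSubfield _ _)
    (fun _ _ => div_mem (xq_mem_powSubfield _ _) (xq_mem_powSubfield _ _)) n m

/-- The coefficients of `M⁽⁻⁾` depend on the weight `m` through `x q ^ m` only. -/
theorem shiftFld_coeffM (n : ℤ) (k : ℕ) (m : ℤ) :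
    shiftFld p n (coeffM p k m) = coeffM p k (m + n) := by
  refine seriesCoeff_equivariant (shiftFld p n).toRingHom (fun m => m + n)
    (fun m => by ring) (fun k m => ?_) (fun k m => ?_) k m
  · change shiftFld p n _ = _
    rw [coeffD, expCoeff, expCoeff, Algebra.smul_def, Algebra.smul_def, map_mul, AlgHom.commutes,
      map_prod]
    congr 1
    refine Finset.prod_congr rfl fun l _ => ?_
    rw [shiftFld_xq, iterate_add_two, iterate_add_two]
    refine xq_congr rfl ?_
    push_cast; ring
  · change shiftFld p n _ = _
    rw [eigB, eigB, eigB, eigB, xq_div, xq_div, shiftFld_xq, iterate_add_two, iterate_add_two]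
    refine xq_congr (by ring) ?_
    push_cast; ring

theorem IsLower.add_pow_sub_pow {R : Type*} [Ring R] {G : WeightGrading R} {a b : R}
    (ha : IsLower G 0 a) (hb : IsLower G 1 b) (n : ℕ) : IsLower G 1 ((a + b) ^ n - a ^ n) := by
  induction n with
  | zero => simpa using IsLower.zero 1
  | succ n ih =>
    have h : (a + b) ^ (n + 1) - a ^ (n + 1) = ((a + b) ^ n - a ^ n) * (a + b) + a ^ n * b := by
      rw [pow_succ, pow_succ]; noncomm_ring
    rw [h]
    have han : IsLower G 0 (a ^ n) := pow_mem (S := G.lowerSubring) ha n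
    exact (ih.mul_weak (ha.add (hb.mono zero_le_one))).add (han.weak_mul hb)

/-- `Δ(M⁽⁻⁾)` and `M⁽⁻⁾₁(x q^{h₂})` agree up to terms lowering the second weight. -/
theorem isLower_coprod_elemMMinus_sub (V W : Rep p) :
    IsLower (V.gradingRight W) 1 ((coprod (elemMMinus p) - leg1Shift (elemMMinus p)) V W) := by
  obtain ⟨n, hn⟩ := isNilpotent_gen_f V
  obtain ⟨m, hm⟩ := isNilpotent_gen_f (V.tensor W)
  have h1 : coprod (elemMMinus p) V W = ∑ k ∈ Finset.range (m + n),
      coprod (funH p (coeffM p k)) V W * coprod (gen p (Uq.of p .f)) V W ^ k :=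
    evalSeries_eq_sum _ _ (pow_eq_zero_of_le (Nat.le_add_right m n) hm)
  have h2 : leg1Shift (elemMMinus p) V W = ∑ k ∈ Finset.range (m + n),
      leg1Shift (funH p (coeffM p k)) V W * leg1Shift (gen p (Uq.of p .f)) V W ^ k := by
    have h3 : elemMMinus p V = ∑ k ∈ Finset.range (m + n),
        funH p (coeffM p k) V * gen p (Uq.of p .f) V ^ k :=
      evalSeries_eq_sum _ _ (pow_eq_zero_of_le (Nat.le_add_left n m) hn)
    change dynShiftHom W V.V (elemMMinus p V) = _
    rw [h3, map_sum]
    refine Finset.sum_congr rfl fun k _ => ?_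
    rw [map_mul, map_pow]
    rfl
  rw [Pi.sub_apply, Pi.sub_apply, h1, h2, ← Finset.sum_sub_distrib]
  refine IsLower.sum fun k _ => ?_
  have h3 : leg1Shift (funH p (coeffM p k)) = coprod (funH p (coeffM p k)) := by
    rw [leg1Shift_funH, coprod_funH]
    exact funHH_congr fun _ _ => shiftFld_coeffM _ _ _
  rw [h3, ← mul_sub, coprod_funH, leg1Shift_gen, coprod_gen_f]
  refine (IsLower.of_commute (commute_funHH_gradingRight V W _)).weak_mul ?_
  exact IsLower.add_pow_sub_pow (IsLower.of_commute (commute_leg1_gradingRight V W _))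
    ((IsLower.of_commute (commute_funHH_gradingRight V W _)).weak_mul (isLower_genF2 V W)) k

theorem matK_flip_coprod_gen_f :
    flip (coprod (gen p (Uq.of p .f))) * matK p =
      matK p * (genF1 p + funHH p (fun m _ => RatFunc.C (p.pow m)) * genF2 p) := by
  rw [coprod_gen_f, flip_add, flip_mul, flip_funHH, genF1, genF2, flip_leg1, flip_leg2]
  change (genF2 p + _ * genF1 p) * _ = _ * (genF1 p + _ * genF2 p)
  rw [matK_eq, add_mul, mul_add, genF2_mul_funHH, mul_assoc, genF1_mul_funHH, funHH_mul_mul,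
    funHH_mul_mul, add_comm]
  congr 2
  all_goals
    refine funHH_congr fun m n => ?_
    simp only [Pi.mul_apply, C_pow_eq, xq_mul]
    refine xq_congr (by ring) ?_
    push_cast; ring

/-- `R̂ Δ(f) = K⁻¹ Δᵒᵖ(f) K R̂`. -/
theorem matR_mul_coprod_gen_f : matK p * matRhat p * coprod (gen p (Uq.of p .f)) =
    flip (coprod (gen p (Uq.of p .f))) * (matK p * matRhat p) := by
  rw [mul_assoc, matRhat_mul_coprod_gen_f, ← mul_assoc, ← mul_assoc, matK_flip_coprod_gen_f]

theorem commute_genE1_mul_genF2 (g : ℤ → Fld) :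
    Commute (funHH p fun m n => g (m + n)) (genE1 p * genF2 p) := by
  rw [Commute, SemiconjBy, mul_assoc, genF2_mul_funHH, genE1_mul_funHH_mul]
  congr 1
  exact funHH_congr fun m n => by ring_nf

theorem commute_qInvExp {R : Type} [Ring R] [Algebra ℂ R] {a b : R} (h : Commute a b) :
    Commute a (qInvExp p b) :=
  Commute.sum_right _ _ _ fun n _ => (h.pow_right n).smul_right _

theorem commute_matRhat (g : ℤ → Fld) :
    Commute (funHH p fun m n => g (m + n)) (matRhat p) := by
  have h : Commute (funHH p fun m n => g (m + n)) (expoR p) :=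
    (funHH_commute _ _).mul_right (commute_genE1_mul_genF2 g)
  rw [matRhat_eq, Commute, SemiconjBy]
  funext V W
  exact commute_qInvExp (congrFun (congrFun h.eq V) W)

/-- `R Δ(M⁽⁻⁾) = Δᵒᵖ(M⁽⁻⁾) R`. -/
theorem matR_mul_coprod_elemMMinus : matK p * matRhat p * coprod (elemMMinus p) =
    flip (coprod (elemMMinus p)) * (matK p * matRhat p) := by
  funext V W
  obtain ⟨m, hm⟩ := isNilpotent_gen_f (V.tensor W)
  obtain ⟨n, hn⟩ := isNilpotent_gen_f (W.tensor V)
  have h1 : coprod (elemMMinus p) V W = ∑ k ∈ Finset.range (m + n),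
      coprod (funH p (coeffM p k)) V W * coprod (gen p (Uq.of p .f)) V W ^ k :=
    evalSeries_eq_sum _ _ (pow_eq_zero_of_le (Nat.le_add_right m n) hm)
  have h2 : flip (coprod (elemMMinus p)) V W = ∑ k ∈ Finset.range (m + n),
      flip (coprod (funH p (coeffM p k))) V W * flip (coprod (gen p (Uq.of p .f))) V W ^ k := by
    have h3 : elemMMinus p (W.tensor V) = ∑ k ∈ Finset.range (m + n),
        funH p (coeffM p k) (W.tensor V) * gen p (Uq.of p .f) (W.tensor V) ^ k :=
      evalSeries_eq_sum _ _ (pow_eq_zero_of_le (Nat.le_add_left n m) hn)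
    change opConj _ (elemMMinus p (W.tensor V)) = _
    rw [h3, map_sum]
    refine Finset.sum_congr rfl fun k _ => ?_
    rw [map_mul, map_pow]
    rfl
  simp only [Pi.mul_apply]
  rw [h1, h2, Finset.mul_sum,
    Finset.sum_mul]
  refine Finset.sum_congr rfl fun k _ => ?_
  have h4 : SemiconjBy ((matK p * matRhat p) V W) (coprod (funH p (coeffM p k)) V W)
      (flip (coprod (funH p (coeffM p k))) V W) := by
    have h5 : flip (coprod (funH p (coeffM p k))) = coprod (funH p (coeffM p k)) := by
      rw [coprod_funH, flip_funHH]
      exact funHH_congr fun _ _ => by rw [add_comm]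
    rw [h5, coprod_funH]
    have h6 : Commute (funHH p fun m n => coeffM p k (m + n)) (matK p * matRhat p) := by
      refine Commute.mul_right ?_ (commute_matRhat _)
      rw [matK_eq]
      exact funHH_commute _ _
    exact congrFun (congrFun h6.eq.symm V) W
  have h7 : SemiconjBy ((matK p * matRhat p) V W) (coprod (gen p (Uq.of p .f)) V W)
      (flip (coprod (gen p (Uq.of p .f))) V W) :=
    congrFun (congrFun matR_mul_coprod_gen_f V) W
  exact h4.mul_right (h7.pow_right k)

end SeriesFam

/-! ### The standard solution -/

section Standard

variable {p : QParam}

/-- The shift of weights by `e ⊗ f`. -/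
def shiftPair (x : ℤ × ℤ) : ℤ × ℤ := (x.1 - 2, x.2 + 2)

theorem iterate_shiftPair (n : ℕ) (x : ℤ × ℤ) :
    shiftPair^[n] x = (x.1 - 2 * n, x.2 + 2 * n) := by
  induction n generalizing x with
  | zero => simp
  | succ n ih =>
    rw [Function.iterate_succ_apply, ih, shiftPair]
    ext <;> push_cast <;> ring

/-- The coefficients of the standard solution as a series in `e ⊗ f`. -/
def coeffF (p : QParam) : ℕ → ℤ × ℤ → Fld :=
  seriesCoeff shiftPair (expCoeff p shiftPair fun _ => RatFunc.C (p.q - p.q⁻¹)) fun x => eigB p x.2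

/-- The standard solution of the dynamical cocycle equation. -/
def standardF (p : QParam) : Fam2 p := fun V W =>
  evalSeries (funHHAt V W) ((genE1 p * genF2 p) V W) (coeffF p)

theorem genE1_mul_genF2_mul_funHHAt (V W : Rep p) (g : ℤ × ℤ → Fld) :
    (genE1 p * genF2 p) V W * funHHAt V W g =
      funHHAt V W (g ∘ shiftPair) * (genE1 p * genF2 p) V W := by
  have h : (genE1 p * genF2 p) * funHH p (fun m n => g (m, n)) =
      funHH p (fun m n => g (m - 2, n + 2)) * (genE1 p * genF2 p) := by
    rw [mul_assoc, genF2_mul_funHH, genE1_mul_funHH_mul]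
  exact congrFun (congrFun h V) W

theorem isNilpotent_genE1_mul_genF2 (V W : Rep p) : IsNilpotent ((genE1 p * genF2 p) V W) :=
  (isLower_genE1_genF2 V W).isNilpotent

/-- The ABRR equation for the standard solution, with `R̂` moved to the other side. -/
theorem leg2_elemB_mul_standardF :
    leg2 (elemB p) * standardF p = matRhat p * standardF p * leg2 (elemB p) := by
  have hB : leg2 (elemB p) = funHH p fun _ n => eigB p n := by rw [elemB_eq, leg2_funH]; rfl
  rw [hB]
  funext V W
  have hR : matRhat p V W = evalSeries (funHHAt V W) ((genE1 p * genF2 p) V W)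
      (expCoeff p shiftPair fun _ => RatFunc.C (p.q - p.q⁻¹)) := by
    have h1 : expoR p V W = funHHAt V W (fun _ => RatFunc.C (p.q - p.q⁻¹)) *
        (genE1 p * genF2 p) V W := rfl
    rw [matRhat_eq, exp2, h1]
    exact qInvExp_eq_evalSeries p (genE1_mul_genF2_mul_funHHAt V W) (funHHAt_smul V W)
      (isNilpotent_genE1_mul_genF2 V W) _
  simp only [Pi.mul_apply, hR]
  refine evalSeries_intertwines (genE1_mul_genF2_mul_funHHAt V W)
    (isNilpotent_genE1_mul_genF2 V W) (b := fun x => eigB p x.2) (expCoeff_zero _ _)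
    (fun i => xq_ne_zero _ _) fun n i h => ?_
  have h1 := eigB_injective h
  rw [iterate_shiftPair] at h1
  push_cast at h1
  omega

theorem isUnit_matRhat : IsUnit (matRhat p) := by
  rw [matRhat_eq]; exact isUnit_exp2 isNilpotent_expoR

theorem isLower_standardF (V W : Rep p) :
    IsLower (V.gradingRight W) 1 ((standardF p - 1) V W) :=
  isLower_evalSeries_sub_one
    (fun _ => IsLower.of_commute (commute_funHH_gradingRight V W _)) (isLower_genE1_genF2 V W)
    (seriesCoeff_zero _ _ _)

theorem isNatural2_standardF : IsNatural2 (standardF p) := fun V V' W W' φ ψ hφ hψ => by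
  obtain ⟨m, hm⟩ := isNilpotent_genE1_mul_genF2 V W
  obtain ⟨n, hn⟩ := isNilpotent_genE1_mul_genF2 V' W'
  change (standardF p V W, standardF p V' W') ∈ natSubalgebra (TensorProduct.map φ ψ)
  simp only [standardF]
  rw [evalSeries_eq_sum _ _ (pow_eq_zero_of_le (Nat.le_add_right m n) hm),
    evalSeries_eq_sum _ _ (pow_eq_zero_of_le (Nat.le_add_left n m) hn), prod_mk_sum]
  refine sum_mem fun k _ => ?_
  exact mul_mem (S := Subalgebra ℂ (Op (V.V ⊗[ℂ] W.V) × Op (V'.V ⊗[ℂ] W'.V)))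
    (funHH_mem_natSubalgebra hφ hψ fun m n => coeffF p k (m, n))
    (pow_mem (genE1_mul_genF2_mem_natSubalgebra hφ hψ) k)

theorem isXSqRational2_standardF : IsXSqRational2 (standardF p) := fun V W => by
  have h : (genE1 p * genF2 p) V W ∈ (mapCoeff (V.V ⊗[ℂ] W.V) (powFld 8 (by norm_num))).range := by
    have h1 : (genE1 p * genF2 p) V W =
        1 ⊗ₜ TensorProduct.map (V.ρ (Uq.of p .e)) (W.ρ (Uq.of p .f)) :=
      (gen_tensor_eq V W _ _).symm
    rw [h1]
    exact tmul_mem_range (one_mem _) _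
  refine evalSeries_mem (mapCoeff (V.V ⊗[ℂ] W.V) _).range.toSubring (fun n => ?_) h
  refine funHH_mem_range (fun k l => ?_) V W
  refine seriesCoeff_mem _ (expCoeff_mem fun _ => C_mem_powSubfield _ _ _) (fun n x => ?_) n (k, l)
  rw [iterate_shiftPair, eigB, eigB, xq_div]
  have : x.2 - (x.2 + 2 * (n : ℤ)) = 2 * (-n) := by ring
  rw [this]
  exact xq_even_mem_powSubfield _ _

theorem commute_standardF (g : ℤ → Fld) :
    Commute (funHH p fun m n => g (m + n)) (standardF p) := by
  rw [Commute, SemiconjBy]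
  funext V W
  refine commute_evalSeries (fun c => ?_) ?_ _
  · exact congrFun (congrFun (funHH_commute _ _).eq V) W
  · exact congrFun (congrFun (commute_genE1_mul_genF2 g).eq V) W

theorem isABRRSolution_standardF : IsABRRSolution (standardF p) := by
  refine ⟨isNatural2_standardF, isXSqRational2_standardF, fun m m' h => ?_, ?_⟩
  · funext V W
    exact isLower_standardF V W m m' (by omega)
  · rw [mul_assoc, leg2_elemB_mul_standardF, ← mul_assoc, ← mul_assoc,
      Ring.inverse_mul_cancel _ isUnit_matRhat, one_mul]

theorem leg2_projFam_mul_leg2_elemB (V W : Rep p) (m : ℤ) :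
    (V.gradingRight W).proj m * leg2 (elemB p) V W = eigB p m • (V.gradingRight W).proj m := by
  rw [Rep.gradingRight_proj, leg2, leg2, ← map_mul, elemB_eq, projFam_mul_funH, opRight_smul]
  rfl

theorem leg2_elemB_mul_leg2_projFam (V W : Rep p) (m : ℤ) :
    leg2 (elemB p) V W * (V.gradingRight W).proj m = eigB p m • (V.gradingRight W).proj m := by
  rw [Rep.gradingRight_proj, leg2, leg2, ← map_mul, elemB_eq, funH_mul_projFam, opRight_smul]
  rfl

/-- The ABRR equation has at most one solution which is unipotent in the second factor. -/
theorem eq_standardF_of_abrr {F : Fam2 p}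
    (hF : ∀ V W, IsLower (V.gradingRight W) 1 ((F - 1) V W))
    (h : leg2 (elemB p) * F = matRhat p * F * leg2 (elemB p)) : F = standardF p := by
  rw [← sub_eq_zero]
  funext V W
  have hR : IsLower (V.gradingRight W) 1 (matRhat p V W - 1) := by
    rw [matRhat_eq]
    exact (isLower_expoR V W).qInvExp_sub_one p
  refine eq_zero_of_intertwines (G := V.gradingRight W) (b := eigB p)
    eigB_injective (leg2_projFam_mul_leg2_elemB V W) (leg2_elemB_mul_leg2_projFam V W) hR ?_ ?_
  · have := (hF V W).sub (isLower_standardF V W)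
    simp only [Pi.sub_apply, sub_sub_sub_cancel_right] at this
    exact this
  · have h1 : leg2 (elemB p) * (F - standardF p) =
        matRhat p * (F - standardF p) * leg2 (elemB p) := by
      rw [mul_sub, mul_sub, sub_mul, h, leg2_elemB_mul_standardF]
    exact congrFun (congrFun h1 V) W

theorem isStandardSolution_standardF : IsStandardSolution (standardF p) := by
  refine ⟨isABRRSolution_standardF, fun G hG => eq_standardF_of_abrr (fun V W m m' h => ?_) ?_⟩
  · exact congrFun (congrFun (hG.2.2.1 m m' (by omega)) V) W
  · have h := hG.2.2.2
    rw [mul_assoc, h, mul_assoc, ← mul_assoc, Ring.mul_inverse_cancel _ isUnit_matRhat, one_mul]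

end Standard

/-! ### The coboundary of the Gauss product -/

section Coboundary

variable {p : QParam}

/-- `B(x)₁`, as a function of the weights. -/
theorem leg1_elemB : leg1 (elemB p) = funHH p fun m _ => eigB p m := by
  rw [elemB_eq, leg1_funH]; rfl

theorem leg2_elemB : leg2 (elemB p) = funHH p fun _ n => eigB p n := by
  rw [elemB_eq, leg2_funH]; rfl

theorem coprod_elemB : coprod (elemB p) = funHH p fun m n => eigB p (m + n) := by
  rw [elemB_eq, coprod_funH]; rfl

/-- `Δ(B) = B₁ B₂ K²`. -/
theorem coprod_elemB_eq :
    coprod (elemB p) = leg2 (elemB p) * (matK p * matK p) * leg1 (elemB p) := by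
  rw [coprod_elemB, leg2_elemB, leg1_elemB, matK_eq, funHH_mul, funHH_mul, funHH_mul]
  refine funHH_congr fun m n => ?_
  simp only [Pi.mul_apply, eigB, xq_mul]
  refine xq_congr (by ring) ?_
  push_cast; ring

/-- The inverse of `B(x)`. -/
def invB (p : QParam) : Fam1 p := funH p fun m => (eigB p m)⁻¹

theorem elemB_mul_invB : elemB p * invB p = 1 := by
  funext V
  refine ((funHAt V).map_mul (eigB p) fun m => (eigB p m)⁻¹).symm.trans ?_
  have h : (eigB p * fun m => (eigB p m)⁻¹) = 1 := funext fun m => mul_inv_cancel₀ (xq_ne_zero _ _)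
  rw [h]
  exact (funHAt V).map_one

theorem invB_mul_elemB : invB p * elemB p = 1 := by
  funext V
  refine ((funHAt V).map_mul (fun m => (eigB p m)⁻¹) (eigB p)).symm.trans ?_
  have h : ((fun m => (eigB p m)⁻¹) * eigB p) = 1 :=
    funext fun m => inv_mul_cancel₀ (xq_ne_zero _ _)
  rw [h]
  exact (funHAt V).map_one

theorem commute_leg1Shift_leg2_funH (a : Fam1 p) (g : ℤ → Fld) :
    Commute (leg1Shift a) (leg2 (funH p g)) := by
  rw [Commute, SemiconjBy]
  funext V W
  exact (commute_dynShift_opRight W (a := a V) (commute_funH_projFam W g)).eq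

theorem coprod_projFam (m : ℤ) :
    coprod (projFam p m) = funHH p fun k l => (Pi.single m 1 : ℤ → Fld) (k + l) := by
  rw [projFam_eq_funH, coprod_funH]

theorem commute_funHH_tensorGrading (V W : Rep p) (g : ℤ → ℤ → Fld) (m : ℤ) :
    Commute (funHH p g V W) ((V.tensor W).grading.proj m) := by
  have h : (V.tensor W).grading.proj m = coprod (projFam p m) V W := rfl
  rw [h, coprod_projFam]
  exact congrFun (congrFun (funHH_commute g _).eq V) W

theorem isLower_tensor_genF2 (V W : Rep p) : IsLower (V.tensor W).grading 1 (genF2 p V W) := by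
  refine (IsLower.of_mul_proj 2 fun m => ?_).mono (d' := 1) (by norm_num)
  have h : genF2 p * coprod (projFam p m) = coprod (projFam p (m - 2)) * genF2 p := by
    rw [coprod_projFam, coprod_projFam, genF2_mul_funHH]
    congr 1
    refine funHH_congr fun k l => ?_
    simp only [Pi.single_apply]
    congr 1
    exact propext (by omega)
  exact congrFun (congrFun h V) W

theorem isLower_tensor_leg2_invCMinus (V W : Rep p) :
    IsLower (V.tensor W).grading 1 (leg2 (invCMinus p) V W - 1) := by
  rw [invCMinus, leg2_exp1 isNilpotent_expoF, leg2_expoF]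
  exact IsLower.qInvExp_sub_one p
    ((IsLower.of_commute (commute_funHH_tensorGrading V W _)).weak_mul (isLower_tensor_genF2 V W))

theorem isLower_flip_coprod {a : Fam1 p} (ha : ∀ V, IsLower V.grading 1 (a V)) (V W : Rep p) :
    IsLower (V.tensor W).grading 1 (flip (coprod a) V W) := fun m m' hm => by
  have h : ∀ m, (V.tensor W).grading.proj m = flip (coprod (projFam p m)) V W := by
    intro m
    have h1 : flip (coprod (projFam p m)) = coprod (projFam p m) := by
      rw [coprod_projFam, flip_funHH]
      exact funHH_congr fun _ _ => by rw [add_comm]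
    rw [h1]; rfl
  have h2 := congrArg (opConj (TensorProduct.comm ℂ W.V V.V)) (ha (W.tensor V) m m' hm)
  rw [map_mul, map_mul, map_zero] at h2
  rw [h, h]
  exact h2

/-- `B₂ Δ(M⁽⁻⁾) B₂⁻¹ = C⁻₂⁻¹ K⁻¹ Δᵒᵖ(M⁽⁻⁾) K`. With `T = B₂ Δ(C⁻)⁻¹ B₂⁻¹`, both sides solve
`Δ(B) G = T G Δ(B)`, which has only one solution that is unipotent with respect to the total
weight. -/
theorem leg2_elemB_mul_coprod_elemMMinus : leg2 (elemB p) * coprod (elemMMinus p) =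
    leg2 (invCMinus p) * (invK p * flip (coprod (elemMMinus p)) * matK p) * leg2 (elemB p) := by
  have hb : leg2 (elemB p) * leg2 (invB p) = 1 := by
    rw [← leg2_mul, elemB_mul_invB, leg2_one]
  have hb' : leg2 (invB p) * leg2 (elemB p) = 1 := by
    rw [← leg2_mul, invB_mul_elemB, leg2_one]
  have hkk : matK p * matK p * (invK p * invK p) = 1 := by
    rw [mul_assoc, ← mul_assoc (matK p) (invK p), matK_mul_invK, one_mul, matK_mul_invK]
  have hM : coprod (elemB p) * coprod (elemMMinus p) =
      coprod (invCMinus p) * coprod (elemMMinus p) * coprod (elemB p) :=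
    congrArg coprod elemB_mul_elemMMinus
  have hBb : Commute (coprod (elemB p)) (leg2 (elemB p)) := by
    rw [coprod_elemB, leg2_elemB]; exact funHH_commute _ _
  have hBb' : Commute (coprod (elemB p)) (leg2 (invB p)) := by
    rw [coprod_elemB, invB, leg2_funH]; exact funHH_commute _ _
  have hBk : Commute (coprod (elemB p)) (matK p) := by
    rw [coprod_elemB, matK_eq]; exact funHH_commute _ _
  have hBk' : Commute (coprod (elemB p)) (invK p) := by
    rw [coprod_elemB]; exact funHH_commute _ _
  have hB1b' : Commute (leg1 (elemB p)) (leg2 (invB p)) := commute_leg1_leg2 _ _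
  have hflipK : flip (matK p) = matK p := by
    rw [matK_eq, flip_funHH]; exact funHH_congr fun m n => by rw [mul_comm]
  have hflipB : flip (coprod (elemB p)) = coprod (elemB p) := by
    rw [coprod_elemB, flip_funHH]; exact funHH_congr fun m n => by rw [add_comm]
  have hflipK' : flip (invK p) = invK p := by
    rw [invK, flip_funHH]; exact funHH_congr fun m n => by rw [mul_comm]
  have hfM : coprod (elemB p) * flip (coprod (elemMMinus p)) =
      flip (coprod (invCMinus p)) * flip (coprod (elemMMinus p)) * coprod (elemB p) := by
    have := congrArg flip hM
    rwa [flip_mul, flip_mul, flip_mul, hflipB] at this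
  have hfD : flip (coprod (invCMinus p)) =
      matK p * leg1Shift (invCMinus p) * leg2 (invCMinus p) * invK p := by
    have h1 : matK p * leg2 (invCMinus p) = flip (leg1Shift (invCMinus p)) * matK p := by
      have := congrArg flip (matK_mul_leg1_invCMinus (p := p))
      rwa [flip_mul, flip_mul, hflipK, flip_leg1] at this
    have h2 : flip (leg1Shift (invCMinus p)) = matK p * leg2 (invCMinus p) * invK p := by
      rw [h1, mul_assoc, matK_mul_invK, mul_one]
    rw [coprod_invCMinus, flip_mul, flip_mul, flip_mul, flip_mul, flip_mul, hflipK, hflipK',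
      flip_leg2, h2, mul_assoc (matK p) (matK p), matK_mul_leg1_invCMinus]
    simp only [mul_assoc]
    rw [← mul_assoc (invK p) (matK p), invK_mul_matK, one_mul, ← mul_assoc (matK p) (invK p),
      matK_mul_invK, one_mul]
  set G := leg2 (elemB p) * coprod (elemMMinus p) * leg2 (invB p) with hG
  set G' := leg2 (invCMinus p) * (invK p * flip (coprod (elemMMinus p)) * matK p) with hG'
  set T := leg2 (elemB p) * coprod (invCMinus p) * leg2 (invB p) with hT
  -- The left side solves the equation since `Δ(B)` commutes with `B₂`.
  have e1 : coprod (elemB p) * G = T * G * coprod (elemB p) := by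
    calc coprod (elemB p) * G
        = leg2 (elemB p) * (coprod (elemB p) * coprod (elemMMinus p)) * leg2 (invB p) := by
          rw [hG, ← mul_assoc, ← mul_assoc, hBb.eq, ← mul_assoc]
      _ = leg2 (elemB p) * coprod (invCMinus p) * coprod (elemMMinus p) *
            (coprod (elemB p) * leg2 (invB p)) := by rw [hM]; simp only [mul_assoc]
      _ = leg2 (elemB p) * coprod (invCMinus p) * (leg2 (invB p) * leg2 (elemB p)) *
            coprod (elemMMinus p) * leg2 (invB p) * coprod (elemB p) := by
          rw [hBb'.eq, hb', mul_one]; simp only [mul_assoc]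
      _ = T * G * coprod (elemB p) := by rw [hT, hG]; simp only [mul_assoc]
  -- For the right side, `Δ(B) = B₂ K² B₁` is moved through the two factors of `G'`; the new factors
  -- `B₂ K² C⁻₂⁻¹ K⁻² B₂⁻¹` and `C⁻₁(x q^{h₂})⁻¹` multiply to `T`.
  have e2 : coprod (elemB p) * leg2 (invCMinus p) =
      leg2 (elemB p) * (matK p * matK p * leg2 (invCMinus p) * (invK p * invK p)) *
        leg2 (invB p) * coprod (elemB p) := by
    have h1 : leg2 (invB p) * coprod (elemB p) = matK p * matK p * leg1 (elemB p) := by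
      rw [coprod_elemB_eq, ← mul_assoc, ← mul_assoc, hb', one_mul]
    have h2 : invK p * invK p * (matK p * matK p) = 1 := by
      rw [mul_assoc, ← mul_assoc (invK p) (matK p), invK_mul_matK, one_mul, invK_mul_matK]
    rw [mul_assoc _ (leg2 (invB p)), h1, coprod_elemB_eq, mul_assoc _ (leg1 (elemB p)),
      (commute_leg1_leg2 _ _).eq]
    calc _ = leg2 (elemB p) * (matK p * matK p * leg2 (invCMinus p)) * leg1 (elemB p) := by
          simp only [mul_assoc]
      _ = leg2 (elemB p) * (matK p * matK p * leg2 (invCMinus p)) *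
          (invK p * invK p * (matK p * matK p)) * leg1 (elemB p) := by rw [h2, mul_one]
      _ = _ := by simp only [mul_assoc]
  have e3 : coprod (elemB p) * (invK p * flip (coprod (elemMMinus p)) * matK p) =
      leg1Shift (invCMinus p) * G' * coprod (elemB p) := by
    calc coprod (elemB p) * (invK p * flip (coprod (elemMMinus p)) * matK p)
        = invK p * (coprod (elemB p) * flip (coprod (elemMMinus p))) * matK p := by
          rw [← mul_assoc, ← mul_assoc, hBk'.eq]; simp only [mul_assoc]
      _ = invK p * (flip (coprod (invCMinus p)) * flip (coprod (elemMMinus p))) *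
            (coprod (elemB p) * matK p) := by rw [hfM]; simp only [mul_assoc]
      _ = (invK p * matK p) * leg1Shift (invCMinus p) * leg2 (invCMinus p) * invK p *
            flip (coprod (elemMMinus p)) * matK p * coprod (elemB p) := by
          rw [hfD, hBk.eq]; simp only [mul_assoc]
      _ = _ := by rw [invK_mul_matK, one_mul, hG']; simp only [mul_assoc]
  have e4 : coprod (elemB p) * G' = T * G' * coprod (elemB p) := by
    have hs : Commute (leg1Shift (invCMinus p)) (leg2 (invB p)) := commute_leg1Shift_leg2_funH _ _
    calc coprod (elemB p) * G' = leg2 (elemB p) *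
          (matK p * matK p * leg2 (invCMinus p) * (invK p * invK p)) * leg2 (invB p) *
          (coprod (elemB p) * (invK p * flip (coprod (elemMMinus p)) * matK p)) := by
          rw [hG', ← mul_assoc, e2]; simp only [mul_assoc]
      _ = leg2 (elemB p) *
          (matK p * matK p * leg2 (invCMinus p) * (invK p * invK p)) *
          (leg2 (invB p) * leg1Shift (invCMinus p)) * G' * coprod (elemB p) := by
          rw [e3]; simp only [mul_assoc]
      _ = T * G' * coprod (elemB p) := by
          rw [hT, coprod_invCMinus, ← hs.eq]; simp only [mul_assoc]
  have key : G = G' := by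
    rw [← sub_eq_zero]
    funext V W
    have hβl : ∀ m, (V.tensor W).grading.proj m * coprod (elemB p) V W =
        eigB p m • (V.tensor W).grading.proj m := fun m => projFam_mul_funH (V.tensor W) _ m
    have hβr : ∀ m, coprod (elemB p) V W * (V.tensor W).grading.proj m =
        eigB p m • (V.tensor W).grading.proj m := fun m => funH_mul_projFam (V.tensor W) _ m
    have hcb : ∀ m, Commute (leg2 (elemB p) V W) ((V.tensor W).grading.proj m) := by
      rw [leg2_elemB]; exact commute_funHH_tensorGrading V W _
    have hcb' : ∀ m, Commute (leg2 (invB p) V W) ((V.tensor W).grading.proj m) := by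
      rw [invB, leg2_funH]; exact commute_funHH_tensorGrading V W _
    have hck : ∀ m, Commute (matK p V W) ((V.tensor W).grading.proj m) := by
      rw [matK_eq]; exact commute_funHH_tensorGrading V W _
    have hck' : ∀ m, Commute (invK p V W) ((V.tensor W).grading.proj m) :=
      commute_funHH_tensorGrading V W _
    have hT1 : IsLower (V.tensor W).grading 1 (T V W - 1) := by
      refine IsLower.conj_sub_one ?_ hcb hcb' (congrFun (congrFun hb V) W)
      exact (isLower_expoF (V.tensor W)).qInvExp_sub_one p
    have hG1 : IsLower (V.tensor W).grading 1 (G V W - 1) :=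
      IsLower.conj_sub_one (isLower_elemMMinus (V.tensor W)) hcb hcb' (congrFun (congrFun hb V) W)
    have hG2 : IsLower (V.tensor W).grading 1 (G' V W - 1) := by
      refine (isLower_tensor_leg2_invCMinus V W).sub_one_mul ?_
      refine IsLower.conj_sub_one ?_ hck' hck (congrFun (congrFun invK_mul_matK V) W)
      have h := isLower_flip_coprod (fun V => isLower_elemMMinus (p := p) V) V W
      have h1 : flip (coprod (elemMMinus p - 1)) = flip (coprod (elemMMinus p)) - 1 := by
        change flipHom p (coprodHom p (elemMMinus p - 1)) = _
        rw [map_sub, map_sub, (coprodHom p).map_one, (flipHom p).map_one]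
        rfl
      rw [h1] at h
      exact h
    refine eq_zero_of_intertwines (G := (V.tensor W).grading) (b := eigB p) eigB_injective hβl hβr
      hT1 ?_ ?_
    · have := hG1.sub hG2
      rwa [sub_sub_sub_cancel_right] at this
    · have h1 : coprod (elemB p) * (G - G') = T * (G - G') * coprod (elemB p) := by
        rw [mul_sub, mul_sub, sub_mul, e1, e4]
      exact congrFun (congrFun h1 V) W
  rw [← key, hG, mul_assoc, mul_assoc, hb', mul_one]

/-- The Gauss product `M = (M⁽⁻⁾)⁻¹ M⁽⁺⁾`. -/
def elemM (p : QParam) : Fam1 p := Ring.inverse (elemMMinus p) * elemCPlus p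

theorem isUnit_elemCPlus : IsUnit (elemCPlus p) := by
  rw [elemCPlus_eq]; exact isUnit_exp1 isNilpotent_expoE

theorem isUnit_elemM : IsUnit (elemM p) := isUnit_elemMMinus.ringInverse.mul isUnit_elemCPlus

theorem inverse_elemM : Ring.inverse (elemM p) = Ring.inverse (elemCPlus p) * elemMMinus p := by
  refine inverse_eq_of_mul_eq_one ?_ ?_
  · rw [elemM, mul_assoc, ← mul_assoc (elemCPlus p), Ring.mul_inverse_cancel _ isUnit_elemCPlus,
      one_mul, Ring.inverse_mul_cancel _ isUnit_elemMMinus]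
  · rw [elemM, mul_assoc, ← mul_assoc (elemMMinus p), Ring.mul_inverse_cancel _ isUnit_elemMMinus,
      one_mul, Ring.inverse_mul_cancel _ isUnit_elemCPlus]

theorem coboundary_eq {M : Fam1 p} (hM : IsUnit M) : coboundary (cocycleJ p) M =
    coprod M * leg2 (Ring.inverse M) * leg1Shift (Ring.inverse M) := by
  have h1 : leg2 (Ring.inverse M) = Ring.inverse (leg2 M) := map_ringInverse (leg2Hom p) hM
  have h2 : leg1Shift (Ring.inverse M) = Ring.inverse (leg1Shift M) :=
    map_ringInverse (leg1ShiftHom p) hM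
  rw [coboundary, cocycleJ, mul_one, h1, h2]

/-- `M⁽⁺⁾₁(x q^{h₂}) M⁽⁻⁾₂(x) M⁽⁺⁾₁(x q^{h₂})⁻¹`. -/
def conjMMinus (p : QParam) : Fam2 p :=
  leg1Shift (elemCPlus p) * leg2 (elemMMinus p) * leg1Shift (Ring.inverse (elemCPlus p))

/-- By the formula for `Δ(M⁽⁺⁾)`, the factors `M⁽⁺⁾₂` cancel in the coboundary of `M`. -/
theorem coboundary_elemM : coboundary (cocycleJ p) (elemM p) =
    coprod (Ring.inverse (elemMMinus p)) * conjMMinus p * leg1Shift (elemMMinus p) := by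
  have h : leg2 (elemCPlus p) * leg2 (Ring.inverse (elemCPlus p)) = 1 := by
    rw [← leg2_mul, Ring.mul_inverse_cancel _ isUnit_elemCPlus, leg2_one]
  rw [coboundary_eq isUnit_elemM, inverse_elemM, leg2_mul, leg1Shift_mul, elemM, coprod_mul,
    coprod_elemCPlus, conjMMinus]
  calc _ = coprod (Ring.inverse (elemMMinus p)) * leg1Shift (elemCPlus p) *
        (leg2 (elemCPlus p) * leg2 (Ring.inverse (elemCPlus p))) * leg2 (elemMMinus p) *
        leg1Shift (Ring.inverse (elemCPlus p)) * leg1Shift (elemMMinus p) := by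
        simp only [mul_assoc]
    _ = _ := by rw [h, mul_one]; simp only [mul_assoc]

/-- The equation for `M⁽⁻⁾₂`, conjugated by `M⁽⁺⁾₁(x q^{h₂})`, acquires a factor `R̂`. -/
theorem leg2_elemB_mul_conjMMinus : leg2 (elemB p) * conjMMinus p =
    leg2 (invCMinus p) * matRhat p * conjMMinus p * leg2 (elemB p) := by
  have hP : Commute (leg1Shift (elemCPlus p)) (leg2 (elemB p)) := commute_leg1Shift_leg2_funH _ _
  have hP' : Commute (leg1Shift (Ring.inverse (elemCPlus p))) (leg2 (elemB p)) :=
    commute_leg1Shift_leg2_funH _ _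
  have hM : leg2 (elemB p) * leg2 (elemMMinus p) =
      leg2 (invCMinus p) * leg2 (elemMMinus p) * leg2 (elemB p) := by
    rw [← leg2_mul, elemB_mul_elemMMinus, leg2_mul, leg2_mul]
  calc leg2 (elemB p) * conjMMinus p
      = leg1Shift (elemCPlus p) * (leg2 (elemB p) * leg2 (elemMMinus p)) *
          leg1Shift (Ring.inverse (elemCPlus p)) := by
        rw [conjMMinus, ← mul_assoc, ← mul_assoc, ← hP.eq, ← mul_assoc]
    _ = leg1Shift (elemCPlus p) * leg2 (invCMinus p) * leg2 (elemMMinus p) *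
          (leg2 (elemB p) * leg1Shift (Ring.inverse (elemCPlus p))) := by
        rw [hM]; simp only [mul_assoc]
    _ = _ := by
        rw [leg1Shift_elemCPlus_mul, ← hP'.eq, conjMMinus]; simp only [mul_assoc]

/-- The coboundary of `M` solves the ABRR equation. -/
theorem leg2_elemB_mul_coboundary_elemM :
    leg2 (elemB p) * coboundary (cocycleJ p) (elemM p) =
      matRhat p * coboundary (cocycleJ p) (elemM p) * leg2 (elemB p) := by
  have hR := Ring.mul_inverse_cancel _ (isUnit_matRhat (p := p))
  have hMm : coprod (elemMMinus p) * coprod (Ring.inverse (elemMMinus p)) = 1 := by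
    rw [← coprod_mul, Ring.mul_inverse_cancel _ isUnit_elemMMinus]; rfl
  have hMm' : coprod (Ring.inverse (elemMMinus p)) * coprod (elemMMinus p) = 1 := by
    rw [← coprod_mul, Ring.inverse_mul_cancel _ isUnit_elemMMinus]; rfl
  have h1 : invK p * flip (coprod (elemMMinus p)) * matK p =
      matRhat p * coprod (elemMMinus p) * Ring.inverse (matRhat p) := by
    have h2 := congrArg (fun y => invK p * y * Ring.inverse (matRhat p))
      (matR_mul_coprod_elemMMinus (p := p))
    simp only [mul_assoc] at h2
    rw [hR, mul_one, ← mul_assoc (invK p) (matK p), invK_mul_matK, one_mul] at h2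
    rw [mul_assoc, mul_assoc, h2]
  have h3 := leg2_elemB_mul_coprod_elemMMinus (p := p)
  rw [h1] at h3
  have hs : Commute (leg1Shift (elemMMinus p)) (leg2 (elemB p)) := commute_leg1Shift_leg2_funH _ _
  have h4 : coprod (elemMMinus p) * (Ring.inverse (matRhat p) * (leg2 (elemB p) *
      coboundary (cocycleJ p) (elemM p))) = coprod (elemMMinus p) *
      (coboundary (cocycleJ p) (elemM p) * leg2 (elemB p)) := by
    have hD : IsUnit (leg2 (invCMinus p) * matRhat p) :=
      ((isUnit_exp1 isNilpotent_expoF).map (leg2Hom p)).mul isUnit_matRhat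
    refine hD.mul_left_cancel ?_
    rw [coboundary_elemM]
    calc _ = (leg2 (invCMinus p) * (matRhat p * coprod (elemMMinus p) *
          Ring.inverse (matRhat p)) * leg2 (elemB p)) * coprod (Ring.inverse (elemMMinus p)) *
          conjMMinus p * leg1Shift (elemMMinus p) := by simp only [mul_assoc]
      _ = leg2 (elemB p) * (coprod (elemMMinus p) * coprod (Ring.inverse (elemMMinus p))) *
          conjMMinus p * leg1Shift (elemMMinus p) := by rw [← h3]; simp only [mul_assoc]
      _ = leg2 (invCMinus p) * matRhat p * conjMMinus p *
          (leg2 (elemB p) * leg1Shift (elemMMinus p)) := by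
          rw [hMm, mul_one, leg2_elemB_mul_conjMMinus]; simp only [mul_assoc]
      _ = leg2 (invCMinus p) * matRhat p *
          (coprod (elemMMinus p) * coprod (Ring.inverse (elemMMinus p))) * conjMMinus p *
          leg1Shift (elemMMinus p) * leg2 (elemB p) := by
          rw [hMm, mul_one, ← hs.eq]; simp only [mul_assoc]
      _ = _ := by simp only [mul_assoc]
  have h5 := congrArg (fun y => coprod (Ring.inverse (elemMMinus p)) * y) h4
  simp only [← mul_assoc] at h5
  rw [hMm', one_mul, one_mul] at h5
  have h6 := congrArg (fun y => matRhat p * y) h5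
  simp only [← mul_assoc] at h6
  rw [hR, one_mul] at h6
  exact h6

theorem commute_leg1Shift_gradingRight (V W : Rep p) (a : Fam1 p) (m : ℤ) :
    Commute (leg1Shift a V W) ((V.gradingRight W).proj m) := by
  refine commute_dynShift_opRight W (a := a V) fun n => ?_
  have h : W.grading.proj m = funH p (Pi.single m 1) W := congrFun (projFam_eq_funH m) W
  rw [h]
  exact commute_funH_projFam W _ n

/-- The coboundary of `M` is unipotent in the second factor: modulo operators lowering the second
weight, `Δ(M⁽⁻⁾)` equals `M⁽⁻⁾₁(x q^{h₂})` and `M⁽⁻⁾₂` equals one. -/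
theorem isLower_coboundary_elemM (V W : Rep p) :
    IsLower (V.gradingRight W) 1 ((coboundary (cocycleJ p) (elemM p) - 1) V W) := by
  have hM := isLower_coprod_elemMMinus_sub (p := p) V W
  have hs : IsLower (V.gradingRight W) 0 (leg1Shift (elemMMinus p) V W) :=
    IsLower.of_commute (commute_leg1Shift_gradingRight V W _)
  have hN : IsLower (V.gradingRight W) 1 (conjMMinus p V W - 1) := by
    refine IsLower.conj_sub_one ?_ (commute_leg1Shift_gradingRight V W _)
      (commute_leg1Shift_gradingRight V W _) ?_
    · have h := isLower_leg2 V (isLower_elemMMinus (p := p) W)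
      have h1 : leg2 (elemMMinus p - 1) = leg2 (elemMMinus p) - 1 := by
        change leg2Hom p (elemMMinus p - 1) = _
        rw [map_sub, (leg2Hom p).map_one]; rfl
      rw [h1] at h
      exact h
    · have : leg1Shift (elemCPlus p) * leg1Shift (Ring.inverse (elemCPlus p)) = 1 := by
        rw [← leg1Shift_mul, Ring.mul_inverse_cancel _ isUnit_elemCPlus, leg1Shift_one]
      exact congrFun (congrFun this V) W
  have hi : IsLower (V.gradingRight W) 0 (coprod (Ring.inverse (elemMMinus p)) V W) := by
    have h1 : coprod (Ring.inverse (elemMMinus p)) V W =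
        Ring.inverse (coprod (elemMMinus p) V W) := inverse_apply isUnit_elemMMinus (V.tensor W)
    rw [h1]
    refine inverse_mem_of_isNilpotent (V.gradingRight W).lowerSubring ?_
      (isNilpotent_elemMMinus (V.tensor W))
    have h2 := (hM.mono zero_le_one).add hs
    rwa [Pi.sub_apply, Pi.sub_apply, sub_add_cancel] at h2
  have hMm' : coprod (Ring.inverse (elemMMinus p)) * coprod (elemMMinus p) = 1 := by
    rw [← coprod_mul, Ring.inverse_mul_cancel _ isUnit_elemMMinus]; rfl
  have h : coboundary (cocycleJ p) (elemM p) - 1 = coprod (Ring.inverse (elemMMinus p)) *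
      ((conjMMinus p - 1) * leg1Shift (elemMMinus p) -
        (coprod (elemMMinus p) - leg1Shift (elemMMinus p))) := by
    rw [coboundary_elemM, mul_sub, mul_sub, hMm']
    noncomm_ring
  rw [h]
  exact hi.weak_mul ((hN.mul_weak hs).sub hM)

theorem coboundary_elemM_eq_standardF : coboundary (cocycleJ p) (elemM p) = standardF p :=
  eq_standardF_of_abrr isLower_coboundary_elemM leg2_elemB_mul_coboundary_elemM

theorem isUnit_standardF : IsUnit (standardF p) :=
  Pi.isUnit_iff.2 fun V => Pi.isUnit_iff.2 fun W =>
    have h : IsNilpotent (standardF p V W - 1) := (isLower_standardF V W).isNilpotent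
    isUnit_of_isNilpotent_sub_one h

theorem isZeroWeight_standardF : IsZeroWeight (standardF p) := by
  have h : leg1 (funH p fun m => RatFunc.C (m : ℂ)) + leg2 (funH p fun m => RatFunc.C (m : ℂ)) =
      funHH p fun m n => RatFunc.C ((m + n : ℤ) : ℂ) := by
    rw [leg1_funH, leg2_funH]
    funext V W
    refine op_ext₂ fun m n => ?_
    rw [Pi.add_apply, Pi.add_apply, add_mul, funHH_mul_projPair, funHH_mul_projPair,
      funHH_mul_projPair, ← add_smul, ← map_add]
    push_cast; rfl
  rw [IsZeroWeight, h]
  exact (commute_standardF fun k : ℤ => RatFunc.C (k : ℂ)).symm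

/-- For a zero weight solution of the ABRR equation, `Δ(B) = B₁ B₂ K²` implies the equation
`R₁₂(x) B₂(x) = B₂(x) K² R₂₁(x)⁻¹`. -/
theorem dynR_standardF : dynR (standardF p) * leg2 (elemB p) =
    leg2 (elemB p) * matK p ^ 2 * Ring.inverse (flip (dynR (standardF p))) := by
  have hflipK : flip (matK p) = matK p := by
    rw [matK_eq, flip_funHH]; exact funHH_congr fun m n => by rw [mul_comm]
  set F := standardF p with hF
  have hFu : IsUnit F := isUnit_standardF
  have hF21 : IsUnit (flip F) := hFu.map (flipHom p)
  have hR21 : IsUnit (flip (matRhat p)) := isUnit_matRhat.map (flipHom p)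
  have h1 : leg2 (elemB p) * F = matRhat p * F * leg2 (elemB p) := leg2_elemB_mul_standardF
  have h2 : leg1 (elemB p) * flip F = flip (matRhat p) * flip F * leg1 (elemB p) := by
    have := congrArg flip h1
    rwa [flip_mul, flip_mul, flip_mul, flip_leg2] at this
  have hFi : flip (Ring.inverse (flip F)) = Ring.inverse F := by
    have := map_ringInverse (flipHom p) hF21
    exact this.trans (congrArg Ring.inverse (flip_flip F))
  have hinv : Ring.inverse (flip (dynR F)) =
      Ring.inverse (flip F) * Ring.inverse (flip (matRhat p)) * invK p * F := by
    have e : flip (dynR F) = Ring.inverse F * (matK p * flip (matRhat p)) * flip F := by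
      rw [dynR, flip_mul, flip_mul, hFi, matR, flip_mul, hflipK]
    rw [e]
    refine inverse_eq_of_mul_eq_one ?_ ?_
    · calc _ = Ring.inverse F * matK p * flip (matRhat p) * (flip F * Ring.inverse (flip F)) *
            Ring.inverse (flip (matRhat p)) * invK p * F := by simp only [mul_assoc]
        _ = Ring.inverse F * matK p * (flip (matRhat p) * Ring.inverse (flip (matRhat p))) *
            invK p * F := by rw [Ring.mul_inverse_cancel _ hF21, mul_one]; simp only [mul_assoc]
        _ = Ring.inverse F * (matK p * invK p) * F := by
            rw [Ring.mul_inverse_cancel _ hR21, mul_one]; simp only [mul_assoc]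
        _ = 1 := by rw [matK_mul_invK, mul_one, Ring.inverse_mul_cancel _ hFu]
    · calc _ = Ring.inverse (flip F) * Ring.inverse (flip (matRhat p)) * invK p *
            (F * Ring.inverse F) * matK p * flip (matRhat p) * flip F := by simp only [mul_assoc]
        _ = Ring.inverse (flip F) * Ring.inverse (flip (matRhat p)) * (invK p * matK p) *
            flip (matRhat p) * flip F := by
            rw [Ring.mul_inverse_cancel _ hFu, mul_one]; simp only [mul_assoc]
        _ = Ring.inverse (flip F) * (Ring.inverse (flip (matRhat p)) * flip (matRhat p)) *
            flip F := by rw [invK_mul_matK, mul_one]; simp only [mul_assoc]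
        _ = 1 := by
            rw [Ring.inverse_mul_cancel _ hR21, mul_one, Ring.inverse_mul_cancel _ hF21]
  have hb : leg1 (elemB p) * leg1 (invB p) = 1 := by
    rw [← leg1_mul, elemB_mul_invB, leg1_one]
  have h3 : Ring.inverse (flip F) * Ring.inverse (flip (matRhat p)) =
      leg1 (elemB p) * Ring.inverse (flip F) * leg1 (invB p) := by
    have hu : IsUnit (flip (matRhat p) * flip F) := hR21.mul hF21
    refine hu.mul_left_cancel ?_
    calc _ = flip (matRhat p) * (flip F * Ring.inverse (flip F)) *
          Ring.inverse (flip (matRhat p)) := by simp only [mul_assoc]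
      _ = 1 := by rw [Ring.mul_inverse_cancel _ hF21, mul_one, Ring.mul_inverse_cancel _ hR21]
      _ = leg1 (elemB p) * (flip F * Ring.inverse (flip F)) * leg1 (invB p) := by
          rw [Ring.mul_inverse_cancel _ hF21, mul_one, hb]
      _ = _ := by rw [← mul_assoc, ← mul_assoc, ← mul_assoc, h2]
  have hcF : Commute (coprod (elemB p)) (flip F) := by
    have := congrArg flip (commute_standardF (p := p) (eigB p)).eq
    rw [flip_mul, flip_mul, flip_funHH] at this
    rw [coprod_elemB, Commute, SemiconjBy]
    simpa only [add_comm] using this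
  have hcFi : coprod (elemB p) * Ring.inverse (flip F) =
      Ring.inverse (flip F) * coprod (elemB p) := by
    refine hF21.mul_left_cancel ?_
    rw [← mul_assoc, ← hcF.eq, mul_assoc, ← mul_assoc (flip F), Ring.mul_inverse_cancel _ hF21,
      mul_one, one_mul]
  have hcb : Commute (leg1 (elemB p)) (leg2 (elemB p) * (matK p * matK p)) := by
    rw [leg1_elemB, leg2_elemB, matK_eq, funHH_mul, funHH_mul]
    exact funHH_commute _ _
  have hbk : Commute (leg2 (elemB p)) (matK p) := by
    rw [leg2_elemB, matK_eq]
    exact funHH_commute _ _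
  rw [hinv, h3]
  calc dynR F * leg2 (elemB p)
      = Ring.inverse (flip F) * matK p * (matRhat p * F * leg2 (elemB p)) := by
        rw [dynR, matR]; simp only [mul_assoc]
    _ = Ring.inverse (flip F) * (matK p * leg2 (elemB p)) * F := by
        rw [← h1]; simp only [mul_assoc]
    _ = Ring.inverse (flip F) * (leg2 (elemB p) * matK p * (leg1 (elemB p) * leg1 (invB p)) *
          (matK p * invK p)) * F := by rw [hb, matK_mul_invK, mul_one, mul_one, hbk.eq]
    _ = Ring.inverse (flip F) * coprod (elemB p) * leg1 (invB p) * invK p * F := by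
        have hk : Commute (leg1 (elemB p) * leg1 (invB p)) (matK p) := by
          rw [hb]; exact Commute.one_left _
        rw [coprod_elemB_eq]
        have hk2 : leg1 (elemB p) * leg1 (invB p) * (matK p * invK p) =
            matK p * (leg1 (elemB p) * leg1 (invB p)) * invK p := by
          rw [← mul_assoc, hk.eq]
        rw [mul_assoc (leg2 (elemB p) * matK p), hk2]
        simp only [mul_assoc]
    _ = coprod (elemB p) * Ring.inverse (flip F) * leg1 (invB p) * invK p * F := by rw [hcFi]
    _ = _ := by rw [coprod_elemB_eq, pow_two]; simp only [mul_assoc]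

end Coboundary

/-! ### The dynamical cocycle equation -/

section Cocycle

variable {p : QParam}

theorem tensorAction_e (V W : Rep p) : tensorAction p V W (Uq.of p .e) =
    TensorProduct.map (V.ρ (Uq.of p .e)) (W.ρ (Uq.of p (.k 1))) +
      TensorProduct.map 1 (W.ρ (Uq.of p .e)) := by
  rw [tensorAction, AlgHom.comp_apply, comul_of, comulGen, map_add, tensorAction_tmul,
    tensorAction_tmul, map_one]

theorem tensorAction_f (V W : Rep p) : tensorAction p V W (Uq.of p .f) =
    TensorProduct.map (V.ρ (Uq.of p .f)) 1 +
      TensorProduct.map (V.ρ (Uq.of p (.k (-1)))) (W.ρ (Uq.of p .f)) := by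
  rw [tensorAction, AlgHom.comp_apply, comul_of, comulGen, map_add, tensorAction_tmul,
    tensorAction_tmul, map_one]

/-- The coproduct is coassociative. -/
theorem isIntertwiner_assoc (U V W : Rep p) :
    IsIntertwiner (V := (U.tensor V).tensor W) (W := U.tensor (V.tensor W))
      (TensorProduct.assoc ℂ U.V V.V W.V).toLinearMap := by
  set φ := TensorProduct.assoc ℂ U.V V.V W.V with hφ
  have key : ((φ.conjAlgEquiv ℂ).toAlgHom.comp (tensorAction p (U.tensor V) W)) =
      tensorAction p U (V.tensor W) := by
    apply RingQuot.ringQuot_ext'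
    apply FreeAlgebra.hom_ext
    funext g
    change φ.conj (tensorAction p (U.tensor V) W (Uq.of p g)) =
      tensorAction p U (V.tensor W) (Uq.of p g)
    refine TensorProduct.ext' fun u x => ?_
    induction x using TensorProduct.induction_on with
    | zero => simp
    | add x y hx hy => rw [TensorProduct.tmul_add, map_add, map_add, hx, hy]
    | tmul v w =>
      rw [LinearEquiv.conj_apply_apply, hφ, TensorProduct.assoc_symm_tmul]
      cases g with
      | e =>
        rw [tensorAction_e (U.tensor V) W, tensorAction_e U (V.tensor W)]
        simp only [LinearMap.add_apply, TensorProduct.map_tmul, tensorAction_e, tensorAction_k,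
          Module.End.one_apply, TensorProduct.add_tmul, TensorProduct.tmul_add, map_add,
          TensorProduct.assoc_tmul]
        abel
      | f =>
        rw [tensorAction_f (U.tensor V) W, tensorAction_f U (V.tensor W)]
        simp only [LinearMap.add_apply, TensorProduct.map_tmul, tensorAction_f, tensorAction_k,
          Module.End.one_apply, TensorProduct.add_tmul, TensorProduct.tmul_add, map_add,
          TensorProduct.assoc_tmul]
        abel
      | k t =>
        rw [tensorAction_k p (U.tensor V) W, tensorAction_k p U (V.tensor W)]
        simp only [TensorProduct.map_tmul, tensorAction_k, TensorProduct.assoc_tmul]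
  intro u
  have h := DFunLike.congr_fun key u
  refine LinearMap.ext fun x => ?_
  have h2 := LinearMap.congr_fun h (φ x)
  change φ (tensorAction p (U.tensor V) W u (φ.symm (φ x))) = _ at h2
  rw [LinearEquiv.symm_apply_apply] at h2
  exact h2

theorem opConj_of_isNatural1 {a : Fam1 p} (ha : IsNatural1 a) {X Y : Rep p} (φ : X.V ≃ₗ[ℂ] Y.V)
    (hφ : IsIntertwiner φ.toLinearMap) : opConj φ (a X) = a Y := by
  have h := congrArg (LinearMap.lTensor Fld (LinearMap.lcomp ℂ Y.V φ.symm.toLinearMap))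
    (ha X Y _ hφ)
  rw [← LinearMap.lTensor_comp_apply, ← LinearMap.lTensor_comp_apply] at h
  have h1 : opConj φ (a X) = LinearMap.lTensor Fld (φ.conj.toLinearMap) (a X) := rfl
  have h2 : LinearMap.lcomp ℂ Y.V φ.symm.toLinearMap ∘ₗ
      LinearMap.lcomp ℂ Y.V φ.toLinearMap = LinearMap.id := by
    ext A y
    simp
  rw [h2, LinearMap.lTensor_id, LinearMap.id_apply] at h
  rw [h1, ← h]
  congr 2

variable (U V W : Type) [AddCommGroup U] [Module ℂ U] [AddCommGroup V] [Module ℂ V]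
  [AddCommGroup W] [Module ℂ W]

theorem opConj_assoc_opRight (a : Op W) :
    opConj (TensorProduct.assoc ℂ U V W) (opRight (U ⊗[ℂ] V) W a) =
      opRight U (V ⊗[ℂ] W) (opRight V W a) := by
  induction a using TensorProduct.induction_on with
  | zero => simp only [map_zero]
  | add x y hx hy => simp only [map_add, hx, hy]
  | tmul g A =>
    rw [opRight_tmul, opRight_tmul, opRight_tmul, opConj_tmul]
    congr 1
    ext u v w
    simp [LinearEquiv.conj_apply]

theorem opConj_assoc_opLeft_opRight (a : Op V) :
    opConj (TensorProduct.assoc ℂ U V W) (opLeft (U ⊗[ℂ] V) W (opRight U V a)) =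
      opRight U (V ⊗[ℂ] W) (opLeft V W a) := by
  induction a using TensorProduct.induction_on with
  | zero => simp only [map_zero]
  | add x y hx hy => simp only [map_add, hx, hy]
  | tmul g A =>
    rw [opRight_tmul, opLeft_tmul, opLeft_tmul, opRight_tmul, opConj_tmul]
    congr 1
    ext u v w
    simp [LinearEquiv.conj_apply]

theorem opConj_assoc_opLeft_opLeft (a : Op U) :
    opConj (TensorProduct.assoc ℂ U V W) (opLeft (U ⊗[ℂ] V) W (opLeft U V a)) =
      opLeft U (V ⊗[ℂ] W) a := by
  induction a using TensorProduct.induction_on with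
  | zero => simp only [map_zero]
  | add x y hx hy => simp only [map_add, hx, hy]
  | tmul g A =>
    rw [opLeft_tmul, opLeft_tmul, opLeft_tmul, opConj_tmul]
    congr 1
    ext u v w
    simp [LinearEquiv.conj_apply]

theorem mapCoeff_opRight (τ : Fld →ₐ[ℂ] Fld) (a : Op V) :
    mapCoeff (U ⊗[ℂ] V) τ (opRight U V a) = opRight U V (mapCoeff V τ a) := by
  induction a using TensorProduct.induction_on with
  | zero => simp only [map_zero]
  | add x y hx hy => simp only [map_add, hx, hy]
  | tmul g A => rfl

theorem mapCoeff_opLeft (τ : Fld →ₐ[ℂ] Fld) (a : Op U) :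
    mapCoeff (U ⊗[ℂ] V) τ (opLeft U V a) = opLeft U V (mapCoeff U τ a) := by
  induction a using TensorProduct.induction_on with
  | zero => simp only [map_zero]
  | add x y hx hy => simp only [map_add, hx, hy]
  | tmul g A => rfl

theorem shiftFld_comp (m n : ℤ) (g : Fld) :
    shiftFld p n (shiftFld p m g) = shiftFld p (m + n) g := by
  have h : ((shiftFld p n).comp (shiftFld p m)).toRingHom = (shiftFld p (m + n)).toRingHom := by
    refine IsLocalization.ringHom_ext (nonZeroDivisors (Polynomial ℂ)) ?_
    have hX : ∀ k : ℤ, shiftFld p k RatFunc.X = RatFunc.C (p.pow (k / 4)) * RatFunc.X := by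
      intro k
      rw [shiftFld, subst_X, map_mul, RatFunc.algebraMap_X, RatFunc.algebraMap_C]
    refine Polynomial.ringHom_ext (fun z => ?_) ?_
    · change shiftFld p n (shiftFld p m (algebraMap _ _ (Polynomial.C z))) =
        shiftFld p (m + n) (algebraMap _ _ (Polynomial.C z))
      rw [RatFunc.algebraMap_C, algHom_C, algHom_C, algHom_C]
    · change shiftFld p n (shiftFld p m (algebraMap _ _ Polynomial.X)) =
        shiftFld p (m + n) (algebraMap _ _ Polynomial.X)
      rw [RatFunc.algebraMap_X, hX, map_mul, algHom_C, hX, hX, ← mul_assoc, ← map_mul,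
        ← p.pow_add]
      congr 3
      push_cast; ring
  exact RingHom.congr_fun h g

theorem mapCoeff_shiftFld_comp (m n : ℤ) (a : Op U) :
    mapCoeff U (shiftFld p n) (mapCoeff U (shiftFld p m) a) =
      mapCoeff U (shiftFld p (m + n)) a := by
  induction a using TensorProduct.induction_on with
  | zero => simp only [map_zero]
  | add x y hx hy => simp only [map_add, hx, hy]
  | tmul g A => rw [mapCoeff_tmul, mapCoeff_tmul, mapCoeff_tmul, shiftFld_comp]

variable {U V}

theorem opConj_assoc_dynShift_opRight (a : Op V) (W : Rep p) :
    opConj (TensorProduct.assoc ℂ U V W.V) (dynShift (opRight U V a) W) =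
      opRight U (V ⊗[ℂ] W.V) (dynShift a W) := by
  rw [dynShift, dynShift, map_sum, map_sum]
  refine Finset.sum_congr rfl fun m _ => ?_
  rw [map_mul, map_mul, mapCoeff_opRight, opConj_assoc_opLeft_opRight, opConj_assoc_opRight]

theorem dynShift_tensor (a : Op U) (V W : Rep p) :
    dynShift a (V.tensor W) = ∑ n ∈ W.weights, ∑ m ∈ V.weights,
      opLeft U (V.V ⊗[ℂ] W.V) (mapCoeff U (shiftFld p (m + n)) a) *
        opRight U (V.V ⊗[ℂ] W.V) (projPair V W m n) := by
  have h1 : (1 : Op (U ⊗[ℂ] (V.V ⊗[ℂ] W.V))) = ∑ n ∈ W.weights, ∑ m ∈ V.weights,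
      opRight U (V.V ⊗[ℂ] W.V) (projPair V W m n) := by
    rw [Finset.sum_comm]
    simp_rw [← map_sum]
    rw [sum_projPair, opRight_one]
  rw [← mul_one (dynShift a (V.tensor W)), h1, Finset.mul_sum]
  refine Finset.sum_congr rfl fun n _ => ?_
  rw [Finset.mul_sum]
  refine Finset.sum_congr rfl fun m _ => ?_
  have h2 : projPair V W m n = projFam p (m + n) (V.tensor W) * projPair V W m n := by
    rw [projFam_tensor_mul_projPair, if_pos rfl]
  rw [h2, map_mul, ← mul_assoc, dynShift_mul_projFam, mul_assoc]

theorem opConj_assoc_dynShift_dynShift (a : Op U) (V W : Rep p) :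
    opConj (TensorProduct.assoc ℂ U V.V W.V) (dynShift (dynShift a V) W) =
      dynShift a (V.tensor W) := by
  rw [dynShift_tensor]
  have h : dynShift (dynShift a V) W = ∑ n ∈ W.weights,
      opLeft (U ⊗[ℂ] V.V) W.V (mapCoeff (U ⊗[ℂ] V.V) (shiftFld p n) (dynShift a V)) *
        opRight (U ⊗[ℂ] V.V) W.V (projFam p n W) := rfl
  rw [h, map_sum]
  refine Finset.sum_congr rfl fun n _ => ?_
  rw [dynShift, map_sum, map_sum, Finset.sum_mul, map_sum]
  refine Finset.sum_congr rfl fun m _ => ?_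
  have h3 : mapCoeff V.V (shiftFld p n) (projFam p m V) = projFam p m V := by
    rw [projFam, mapCoeff_tmul, map_one]
  rw [map_mul, map_mul, map_mul, map_mul, mapCoeff_opLeft, mapCoeff_opRight, h3,
    opConj_assoc_opLeft_opLeft, opConj_assoc_opLeft_opRight, opConj_assoc_opRight,
    mapCoeff_shiftFld_comp, mul_assoc, ← map_mul]
  rfl

/-- The coboundary of a natural family satisfies the dynamical cocycle equation as soon as it has
weight zero. -/
theorem satisfiesQDCE_coboundary {M : Fam1 p} (hM : IsUnit M) (hn : IsNatural1 M)
    (hz : ∀ V W : Rep p, ∀ m, Commute (coboundary (cocycleJ p) M V W)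
      (projFam p m (V.tensor W))) : SatisfiesQDCE (coboundary (cocycleJ p) M) := by
  intro U V W
  have hF : ∀ V W : Rep p, coboundary (cocycleJ p) M V W =
      M (V.tensor W) * opRight V.V W.V (Ring.inverse M W) * dynShift (Ring.inverse M V) W :=
    fun V W => congrFun (congrFun (coboundary_eq hM) V) W
  have hi : ∀ V : Rep p, Ring.inverse M V * M V = 1 := fun V =>
    congrFun (Ring.inverse_mul_cancel M hM) V
  have hsh : dynShift (Ring.inverse M (U.tensor V)) W * dynShift (M (U.tensor V)) W = 1 := by
    change dynShiftHom W _ _ * dynShiftHom W _ _ = 1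
    rw [← map_mul, hi]
    exact (dynShiftHom W _).map_one'
  have hL : coboundary (cocycleJ p) M (U.tensor V) W *
      dynShift (coboundary (cocycleJ p) M U V) W = M ((U.tensor V).tensor W) *
      opRight (U.V ⊗[ℂ] V.V) W.V (Ring.inverse M W) *
      dynShift (opRight U.V V.V (Ring.inverse M V)) W *
      dynShift (dynShift (Ring.inverse M U) V) W := by
    have h1 : dynShift (coboundary (cocycleJ p) M U V) W = dynShift (M (U.tensor V)) W *
        dynShift (opRight U.V V.V (Ring.inverse M V)) W *
        dynShift (dynShift (Ring.inverse M U) V) W := by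
      rw [hF]
      change dynShiftHom W _ _ = _
      rw [map_mul, map_mul]
      rfl
    rw [h1, hF]
    calc _ = M ((U.tensor V).tensor W) * opRight (U.V ⊗[ℂ] V.V) W.V (Ring.inverse M W) *
          (dynShift (Ring.inverse M (U.tensor V)) W * dynShift (M (U.tensor V)) W) *
          dynShift (opRight U.V V.V (Ring.inverse M V)) W *
          dynShift (dynShift (Ring.inverse M U) V) W := by simp only [mul_assoc]
      _ = _ := by rw [hsh, mul_one]
  have hR : opRight U.V (V.V ⊗[ℂ] W.V) (Ring.inverse M (V.tensor W)) *
      opRight U.V (V.V ⊗[ℂ] W.V) (coboundary (cocycleJ p) M V W) =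
      opRight U.V (V.V ⊗[ℂ] W.V) (opRight V.V W.V (Ring.inverse M W)) *
      opRight U.V (V.V ⊗[ℂ] W.V) (dynShift (Ring.inverse M V) W) := by
    rw [← map_mul, ← map_mul, hF, ← mul_assoc, ← mul_assoc, hi, one_mul]
  have hc : Commute (dynShift (Ring.inverse M U) (V.tensor W))
      (opRight U.V (V.V ⊗[ℂ] W.V) (coboundary (cocycleJ p) M V W)) :=
    commute_dynShift_opRight (V.tensor W) (hz V W)
  have hα : opConj (TensorProduct.assoc ℂ U.V V.V W.V) (M ((U.tensor V).tensor W)) =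
      M (U.tensor (V.tensor W)) :=
    opConj_of_isNatural1 hn (X := (U.tensor V).tensor W) (Y := U.tensor (V.tensor W)) _
      (isIntertwiner_assoc U V W)
  refine (congrArg (opConj (TensorProduct.assoc ℂ U.V V.V W.V)) hL).trans ?_
  rw [map_mul, map_mul, map_mul, hα, opConj_assoc_opRight, opConj_assoc_dynShift_opRight,
    opConj_assoc_dynShift_dynShift, hF U (V.tensor W)]
  calc _ = M (U.tensor (V.tensor W)) * (opRight U.V (V.V ⊗[ℂ] W.V)
        (opRight V.V W.V (Ring.inverse M W)) *
        opRight U.V (V.V ⊗[ℂ] W.V) (dynShift (Ring.inverse M V) W)) *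
        dynShift (Ring.inverse M U) (V.tensor W) := by simp only [mul_assoc]
    _ = _ := by rw [← hR]; simp only [mul_assoc]; rw [hc.eq]

theorem satisfiesQDCE_elemM (hn : IsNatural1 (elemM p)) :
    SatisfiesQDCE (coboundary (cocycleJ p) (elemM p)) := by
  refine satisfiesQDCE_coboundary isUnit_elemM hn fun V W m => ?_
  rw [coboundary_elemM_eq_standardF]
  have h : projFam p m (V.tensor W) =
      funHH p (fun k l => (Pi.single m 1 : ℤ → Fld) (k + l)) V W :=
    congrFun (congrFun (coprod_projFam m) V) W
  rw [h]
  exact congrFun (congrFun (commute_standardF (Pi.single m 1)).eq.symm V) W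

end Cocycle

/-! ### Values of the coefficients near `ν̃ = 0` -/

section Regular

open Filter Topology

/-- The rational function `g` has no pole at `z`. -/
def RegularAt (z : ℂ) (g : Fld) : Prop := g.denom.eval z ≠ 0

/-- The value of `g` at `z`. -/
def valueAt (z : ℂ) (g : Fld) : ℂ := g.eval (RingHom.id ℂ) z

variable {z : ℂ} {g g' : Fld}

theorem RegularAt.add (h : RegularAt z g) (h' : RegularAt z g') : RegularAt z (g + g') := fun h0 =>
  mul_ne_zero h h' <| by
    rw [← Polynomial.eval_mul]
    exact Polynomial.eval_eq_zero_of_dvd_of_eval_eq_zero (RatFunc.denom_add_dvd g g') h0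

theorem RegularAt.mul (h : RegularAt z g) (h' : RegularAt z g') : RegularAt z (g * g') := fun h0 =>
  mul_ne_zero h h' <| by
    rw [← Polynomial.eval_mul]
    exact Polynomial.eval_eq_zero_of_dvd_of_eval_eq_zero (RatFunc.denom_mul_dvd g g') h0

theorem regularAt_algebraMap (z : ℂ) (P : Polynomial ℂ) :
    RegularAt z (algebraMap (Polynomial ℂ) Fld P) := by
  rw [RegularAt, RatFunc.denom_algebraMap, Polynomial.eval_one]
  exact one_ne_zero

theorem regularAt_C (z c : ℂ) : RegularAt z (RatFunc.C c) := by
  rw [← RatFunc.algebraMap_C]; exact regularAt_algebraMap z _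

theorem valueAt_add (h : RegularAt z g) (h' : RegularAt z g') :
    valueAt z (g + g') = valueAt z g + valueAt z g' := RatFunc.eval_add _ _ h h'

theorem valueAt_mul (h : RegularAt z g) (h' : RegularAt z g') :
    valueAt z (g * g') = valueAt z g * valueAt z g' := RatFunc.eval_mul _ _ h h'

theorem RegularAt.pow (h : RegularAt z g) (n : ℕ) : RegularAt z (g ^ n) := by
  induction n with
  | zero => simpa using regularAt_C z 1
  | succ n ih => rw [pow_succ]; exact ih.mul h

theorem valueAt_pow (h : RegularAt z g) (n : ℕ) : valueAt z (g ^ n) = valueAt z g ^ n := by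
  induction n with
  | zero => rw [pow_zero, pow_zero]; exact RatFunc.eval_one (RingHom.id ℂ) z
  | succ n ih => rw [pow_succ, valueAt_mul (h.pow n) h, ih, pow_succ]

theorem regularAt_sum {ι : Type*} {s : Finset ι} {u : ι → Fld} (h : ∀ i ∈ s, RegularAt z (u i)) :
    RegularAt z (∑ i ∈ s, u i) :=
  Finset.sum_induction _ _ (fun _ _ => RegularAt.add) (by simpa using regularAt_C z 0) h

theorem valueAt_sum {ι : Type*} {s : Finset ι} {u : ι → Fld} (h : ∀ i ∈ s, RegularAt z (u i)) :
    valueAt z (∑ i ∈ s, u i) = ∑ i ∈ s, valueAt z (u i) := by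
  classical
  induction s using Finset.induction_on with
  | empty => rw [Finset.sum_empty, Finset.sum_empty]; exact RatFunc.eval_zero (RingHom.id ℂ) z
  | insert i s hi ih =>
    have hs : ∀ j ∈ s, RegularAt z (u j) := fun j hj => h j (Finset.mem_insert_of_mem hj)
    rw [Finset.sum_insert hi, Finset.sum_insert hi,
      valueAt_add (h i (Finset.mem_insert_self _ _)) (regularAt_sum hs), ih hs]

theorem eventually_regularAt (g : Fld) : ∀ᶠ z in 𝓝[≠] (0 : ℂ), RegularAt z g :=
  nhdsNE_le_cofinite 0 (Polynomial.finite_setOfPred_isRoot g.denom_ne_zero).compl_mem_cofinite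

variable {V : Type} [AddCommGroup V] [Module ℂ V]

theorem coeff_tmul (l : Module.End ℂ V →ₗ[ℂ] ℂ) (g : Fld) (A : Module.End ℂ V) :
    coeff l (g ⊗ₜ A) = RatFunc.C (l A) * g := by
  rw [coeff, LinearMap.comp_apply, LinearMap.lTensor_tmul]
  change TensorProduct.rid ℂ Fld (g ⊗ₜ l A) = _
  rw [TensorProduct.rid_tmul, Algebra.smul_def, RatFunc.algebraMap_eq_C]

theorem coeff_smul (l : Module.End ℂ V →ₗ[ℂ] ℂ) (g : Fld) (a : Op V) :
    coeff l (g • a) = g * coeff l a := by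
  induction a using TensorProduct.induction_on with
  | zero => simp
  | add x y hx hy => rw [smul_add, map_add, map_add, hx, hy, mul_add]
  | tmul k A =>
    rw [TensorProduct.smul_tmul', coeff_tmul, coeff_tmul, smul_eq_mul, mul_left_comm]

/-- An operator has finitely many entries, so that none of them has a pole near `0`, except possibly
at `0`. -/
theorem eventually_regularAt_coeff (a : Op V) :
    ∀ᶠ z in 𝓝[≠] (0 : ℂ), ∀ l, RegularAt z (coeff l a) := by
  induction a using TensorProduct.induction_on with
  | zero => exact Eventually.of_forall fun z l => by simpa using regularAt_C z 0
  | add x y hx hy =>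
    filter_upwards [hx, hy] with z h h' l
    rw [map_add]
    exact (h l).add (h' l)
  | tmul g A =>
    filter_upwards [eventually_regularAt g] with z h l
    rw [coeff_tmul]
    exact (regularAt_C z _).mul h

/-- `x ^ k q ^ c` is small near `ν̃ = 0` if `k > 0`. -/
theorem eventually_xq_small {p : QParam} {k : ℤ} (hk : 0 < k) (c : ℂ) :
    ∀ᶠ z in 𝓝[≠] (0 : ℂ), RegularAt z (xq p k c) ∧ ‖valueAt z (xq p k c)‖ < 1 := by
  obtain ⟨n, rfl⟩ := Int.eq_ofNat_of_zero_le hk.le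
  set P : Polynomial ℂ := Polynomial.X ^ (4 * n) * Polynomial.C (p.pow c) with hP
  have h : xq p n c = algebraMap (Polynomial ℂ) Fld P := by
    rw [hP, map_mul, map_pow, RatFunc.algebraMap_X, RatFunc.algebraMap_C, xq, xVar, zpow_natCast,
      pow_mul]
  have hv : ∀ z, valueAt z (xq p n c) = P.eval z := fun z => by
    rw [h, valueAt, RatFunc.eval_algebraMap]; rfl
  have h0 : P.eval 0 = 0 := by
    rw [hP, Polynomial.eval_mul, Polynomial.eval_pow, Polynomial.eval_X, zero_pow (by omega),
      zero_mul]
  have h1 : ∀ᶠ z in 𝓝 (0 : ℂ), ‖P.eval z‖ < 1 :=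
    P.continuous.norm.continuousAt.eventually_lt continuousAt_const (by simp [h0])
  filter_upwards [nhdsWithin_le_nhds h1] with z hz
  exact ⟨h ▸ regularAt_algebraMap z P, hv z ▸ hz⟩

end Regular

/-! ### Convergence of the infinite products -/

section InfiniteProduct

open Filter Topology

variable {p : QParam}

/-- An infinite product converges to `L` if its partial products differ from `L` by a finite sum of
geometric sequences with ratios of norm less than one near `ν̃ = 0`. -/
theorem isInfiniteProduct_of_geometric {a : ℕ → Fam1 p} {L : Fam1 p}
    (h : ∀ V : Rep p, ∃ (s : Finset (ℤ × ℤ)) (r : ℤ × ℤ → Fld) (A : ℤ × ℤ → Op V.V),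
      (∀ N : ℕ, ((List.range N).map a).prod V = L V + ∑ i ∈ s, r i ^ N • A i) ∧
      ∀ i ∈ s, ∀ᶠ z in 𝓝[≠] (0 : ℂ), RegularAt z (r i) ∧ ‖valueAt z (r i)‖ < 1) :
    IsInfiniteProduct a L := by
  intro V
  obtain ⟨s, r, A, hQ, hr⟩ := h V
  have h1 : ∀ᶠ z in 𝓝[≠] (0 : ℂ), (∀ l, RegularAt z (coeff l (L V))) ∧
      ∀ i ∈ s, (RegularAt z (r i) ∧ ‖valueAt z (r i)‖ < 1) ∧ ∀ l, RegularAt z (coeff l (A i)) :=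
    (eventually_regularAt_coeff (L V)).and <| (Filter.eventually_all_finset s).2 fun i hi =>
      (hr i hi).and (eventually_regularAt_coeff (A i))
  obtain ⟨c, hc, hb⟩ := Metric.mem_nhdsWithin_iff.1 h1
  refine ⟨c, hc, fun z hz0 hz l => ?_⟩
  obtain ⟨hL, hs⟩ := hb ⟨by simpa using hz, by simpa using hz0⟩
  have hQl : ∀ N : ℕ, coeff l (((List.range N).map a).prod V) =
      coeff l (L V) + ∑ i ∈ s, r i ^ N * coeff l (A i) := fun N => by
    rw [hQ, map_add, map_sum]
    simp only [coeff_smul]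
  have hreg : ∀ N : ℕ, ∀ i ∈ s, RegularAt z (r i ^ N * coeff l (A i)) := fun N i hi =>
    ((hs i hi).1.1.pow N).mul ((hs i hi).2 l)
  refine ⟨fun N => ?_, hL l, ?_⟩
  · rw [hQl]
    exact (hL l).add (regularAt_sum (hreg N))
  · have hv : ∀ N : ℕ, valueAt z (coeff l (((List.range N).map a).prod V)) =
        valueAt z (coeff l (L V)) +
          ∑ i ∈ s, valueAt z (r i) ^ N * valueAt z (coeff l (A i)) := fun N => by
      rw [hQl, valueAt_add (hL l) (regularAt_sum (hreg N)), valueAt_sum (hreg N)]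
      congr 1
      refine Finset.sum_congr rfl fun i hi => ?_
      rw [valueAt_mul ((hs i hi).1.1.pow N) ((hs i hi).2 l), valueAt_pow (hs i hi).1.1]
    have ht : Tendsto (fun N : ℕ => valueAt z (coeff l (L V)) +
        ∑ i ∈ s, valueAt z (r i) ^ N * valueAt z (coeff l (A i))) atTop
        (𝓝 (valueAt z (coeff l (L V)) + ∑ i ∈ s, 0 * valueAt z (coeff l (A i)))) :=
      tendsto_const_nhds.add <| tendsto_finsetSum _ fun i hi =>
        (tendsto_pow_atTop_nhds_zero_of_norm_lt_one (hs i hi).1.2).mul_const _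
    simp only [zero_mul, Finset.sum_const_zero, add_zero] at ht
    exact ht.congr fun N => (hv N).symm

theorem tau_eq_one {a : Fam1 p} (h : a (Rep.trivial p) = 1) : tau a = 1 := by
  funext V
  rw [tau, h, Algebra.TensorProduct.one_def, coeff_tmul]
  simp [Algebra.TensorProduct.one_def]

theorem tau_one : tau (1 : Fam1 p) = 1 := tau_eq_one rfl

theorem tau_elemCPlus : tau (elemCPlus p) = 1 := by
  refine tau_eq_one ?_
  have h : gen p (Uq.of p .e) (Rep.trivial p) = 0 := by
    have h1 : trivialAction p (Uq.of p .e) = 0 := by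
      simp [trivialAction, counit, Uq.of, counitGen]
    rw [gen]
    change (1 : Fld) ⊗ₜ[ℂ] trivialAction p (Uq.of p .e) = 0
    rw [h1, TensorProduct.tmul_zero]
  rw [elemCPlus, h, smul_zero, neg_zero, qInvExp_zero]

theorem tau_iterate_succ (n : ℕ) : tau^[n + 1] (elemCPlus p) = 1 := by
  rw [Function.iterate_succ_apply, tau_elemCPlus]
  exact Function.iterate_fixed tau_one n

theorem isInfiniteProduct_elemCPlus :
    IsInfiniteProduct (fun j => tau^[j] (elemCPlus p)) (elemCPlus p) := by
  have hQ : ∀ N : ℕ, ((List.range (N + 1)).map fun j => tau^[j] (elemCPlus p)).prod =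
      elemCPlus p := fun N => by
    induction N with
    | zero => simp
    | succ N ih =>
      rw [List.range_succ, List.map_append, List.prod_append, ih]
      simp only [List.map_cons, List.map_nil, List.prod_singleton]
      rw [tau_iterate_succ, mul_one]
  -- The partial products are `C⁺ + 0 ^ N (1 - C⁺)`: only the empty one differs from `C⁺`.
  refine isInfiniteProduct_of_geometric fun V =>
    ⟨{0}, fun _ => 0, fun _ => 1 - elemCPlus p V, fun N => ?_, fun _ _ => ?_⟩
  · rw [Finset.sum_singleton]
    cases N with
    | zero => simp
    | succ N => rw [hQ, zero_pow (Nat.succ_ne_zero N), zero_smul, add_zero]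
  · refine Eventually.of_forall fun z => ⟨by simpa using regularAt_C z 0, ?_⟩
    rw [valueAt, RatFunc.eval_zero, norm_zero]
    exact one_pos

/-- If `u m = v m u`, the product of the conjugates `u⁻ᵏ v uᵏ` telescopes. -/
theorem prod_conj_telescope {R : Type*} [Ring R] {u v m : Rˣ} (h : u * m = v * m * u) (N : ℕ) :
    ((List.range N).map fun j => Ring.inverse
      (Ring.inverse (u : R) ^ (j + 1) * Ring.inverse (v : R) * (u : R) ^ (j + 1))).prod =
      (m : R) * (((u⁻¹ : Rˣ) : R) ^ N * ((m⁻¹ : Rˣ) : R) * (u : R) ^ N) := by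
  have hv : v = u * m * u⁻¹ * m⁻¹ := by rw [h]; group
  have hj : ∀ j : ℕ, Ring.inverse
      (Ring.inverse (u : R) ^ (j + 1) * Ring.inverse (v : R) * (u : R) ^ (j + 1)) =
      (((u⁻¹) ^ (j + 1) * v * u ^ (j + 1) : Rˣ) : R) := fun j => by
    have h1 : Ring.inverse (u : R) ^ (j + 1) * Ring.inverse (v : R) * (u : R) ^ (j + 1) =
        (((u⁻¹) ^ (j + 1) * v⁻¹ * u ^ (j + 1) : Rˣ) : R) := by
      simp only [Ring.inverse_unit, Units.val_mul, Units.val_pow_eq_pow_val]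
    rw [h1, Ring.inverse_unit]
    congr 1
    group
  simp only [hj]
  have key : ((List.range N).map fun j => (((u⁻¹) ^ (j + 1) * v * u ^ (j + 1) : Rˣ) : R)).prod =
      ((m * ((u⁻¹) ^ N * m⁻¹ * u ^ N) : Rˣ) : R) := by
    induction N with
    | zero => simp
    | succ N ih =>
      rw [List.range_succ, List.map_append, List.prod_append, ih, List.map_singleton,
        List.prod_singleton, ← Units.val_mul, hv]
      congr 1
      rw [pow_succ, pow_succ' u]
      have h2 : u ^ N * (u⁻¹) ^ N = 1 := by rw [inv_pow, mul_inv_cancel]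
      calc _ = m * u⁻¹ ^ N * m⁻¹ * (u ^ N * u⁻¹ ^ N) * m * u⁻¹ * m⁻¹ * (u * u ^ N) := by group
        _ = _ := by rw [h2]; group
  rw [key]
  simp only [Units.val_mul, Units.val_pow_eq_pow_val]

/-- The product of the conjugates `B⁻ᵏ (C⁻)⁻¹ Bᵏ` up to `k = N` is `M⁽⁻⁾ · B⁻ᴺ (M⁽⁻⁾)⁻¹ Bᴺ`. The
entry of the second factor from weight `n` to weight `m` contains the `N`-th power of the ratio of
the values of `B` on the weights `n` and `m`, a multiple of `x ^ (n - m)`, and it vanishes off the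
diagonal unless `m < n`. -/
theorem isInfiniteProduct_elemMMinus : IsInfiniteProduct (fun j => Ring.inverse
    (Ring.inverse (elemB p) ^ (j + 1) * elemCMinus p * elemB p ^ (j + 1))) (elemMMinus p) := by
  obtain ⟨m, hm⟩ := isUnit_elemMMinus (p := p)
  obtain ⟨v, hv⟩ : IsUnit (invCMinus p) := isUnit_exp1 isNilpotent_expoF
  let u : (Fam1 p)ˣ := ⟨elemB p, invB p, elemB_mul_invB, invB_mul_elemB⟩
  have hu : u * m = v * m * u := Units.ext <| by
    simp only [Units.val_mul, hm, hv]
    exact elemB_mul_elemMMinus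
  refine isInfiniteProduct_of_geometric fun V =>
    ⟨(V.weights ×ˢ V.weights).filter fun i => i.1 < i.2,
      fun i => xq p (i.2 - i.1) (i.2 ^ 2 / 2 - i.1 ^ 2 / 2),
      fun i => elemMMinus p V * (projFam p i.1 V * (Ring.inverse (elemMMinus p) V - 1) *
        projFam p i.2 V), fun N => ?_, fun i hi => ?_⟩
  · have h1 := congrFun (prod_conj_telescope hu N) V
    rw [← Ring.inverse_unit m, hm, hv, ← elemCMinus_eq] at h1
    refine h1.trans ?_
    set Z : Op V.V := Ring.inverse (elemMMinus p) V - 1 with hZ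
    have hZlow : IsLower V.grading 1 Z := by
      rw [hZ, inverse_apply isUnit_elemMMinus]
      exact (isLower_elemMMinus V).inverse_sub_one
    have hpow : ∀ (g : ℤ → Fld), funH p g V ^ N = funH p (g ^ N) V := fun g =>
      ((funHAt V).map_pow g N).symm
    have hBB : invB p V ^ N * elemB p V ^ N = 1 := by
      have h2 : (u⁻¹ ^ N * u ^ N : (Fam1 p)ˣ) = 1 := by rw [inv_pow, inv_mul_cancel]
      have h3 := congrFun (congrArg Units.val h2) V
      rw [Units.val_mul, Units.val_pow_eq_pow_val, Units.val_pow_eq_pow_val] at h3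
      exact h3
    have hconj : invB p V ^ N * Z * elemB p V ^ N =
        ∑ i ∈ (V.weights ×ˢ V.weights).filter fun i => i.1 < i.2,
          xq p (i.2 - i.1) (i.2 ^ 2 / 2 - i.1 ^ 2 / 2) ^ N •
            (projFam p i.1 V * Z * projFam p i.2 V) := by
      have hentry : ∀ k l : ℤ, projFam p k V * (invB p V ^ N * Z * elemB p V ^ N) * projFam p l V =
          xq p (l - k) (l ^ 2 / 2 - k ^ 2 / 2) ^ N • (projFam p k V * Z * projFam p l V) := by
        intro k l
        have e1 : projFam p k V * invB p V ^ N = ((eigB p k)⁻¹) ^ N • projFam p k V := by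
          rw [invB, hpow, projFam_mul_funH]; rfl
        have e2 : elemB p V ^ N * projFam p l V = eigB p l ^ N • projFam p l V := by
          rw [elemB_eq, hpow, funH_mul_projFam]; rfl
        calc _ = (projFam p k V * invB p V ^ N) * Z * (elemB p V ^ N * projFam p l V) := by
              simp only [mul_assoc]
          _ = _ := by
            rw [e1, e2, smul_mul_assoc, smul_mul_assoc, mul_smul_comm, smul_smul, ← mul_pow,
              inv_mul_eq_div, eigB, eigB, xq_div]
      rw [Finset.sum_filter, Finset.sum_product]
      conv_lhs => rw [← one_mul (invB p V ^ N * Z * elemB p V ^ N), ← sum_projFam, Finset.sum_mul]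
      refine Finset.sum_congr rfl fun k _ => ?_
      conv_lhs => rw [← mul_one (projFam p k V * _), ← sum_projFam, Finset.mul_sum]
      refine Finset.sum_congr rfl fun l _ => ?_
      rw [hentry]
      split_ifs with hkl
      · rfl
      · have h0 : projFam p k V * Z * projFam p l V = 0 := hZlow l k (by omega)
        rw [h0, smul_zero]
    change elemMMinus p V * (invB p V ^ N * Ring.inverse (elemMMinus p) V * elemB p V ^ N) = _
    have hY : Ring.inverse (elemMMinus p) V = 1 + Z := by rw [hZ]; abel
    rw [hY, mul_add, mul_one, add_mul, hBB, mul_add, mul_one, hconj, Finset.mul_sum]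
    simp only [mul_smul_comm]
  · exact eventually_xq_small (by have := (Finset.mem_filter.1 hi).2; omega) _

end InfiniteProduct

/-! ### The Gauss product solves the coboundary problem -/

section Solution

variable {p : QParam}

theorem isNatural1_funH_mul_gen (g : ℤ → Fld) (u : Uq p) : IsNatural1 (funH p g * gen p u) :=
  isNatural1_iff.2 fun V W _ hφ => mul_mem (S := Subalgebra ℂ (Op V.V × Op W.V))
    (funH_mem_natSubalgebra hφ g) (gen_mem_natSubalgebra hφ u)

theorem isNuRational1_funH_mul_gen {g : ℤ → Fld} (hg : ∀ m, g m ∈ powSubfield 4 (by norm_num))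
    (u : Uq p) : IsNuRational1 (funH p g * gen p u) := fun V =>
  mul_mem (funH_mem_range hg V) (gen_mem_range _ _ u V)

theorem isUnipotentLower_of_isLower {a : Fam1 p} (h1 : IsNatural1 a) (h2 : IsNuRational1 a)
    (h3 : ∀ V : Rep p, IsLower V.grading 1 (a V - 1)) : IsUnipotentLower a :=
  ⟨h1, h2, fun m m' hm => funext fun V => h3 V m m' (by omega)⟩

theorem isUnipotentUpper_elemCPlus : IsUnipotentUpper (elemCPlus p) := by
  rw [elemCPlus_eq]
  refine ⟨isNatural1_exp1 (isNatural1_funH_mul_gen _ _) isNilpotent_expoE,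
    isNuRational1_exp1 (isNuRational1_funH_mul_gen
      (fun _ => neg_mem (xq_mem_powSubfield _ _)) _), fun m m' hm => funext fun V => ?_⟩
  have h := (isLower_expoE V).qInvExp_sub_one p (-m) (-m') (by omega)
  change projFam p (- -m') V * _ * projFam p (- -m) V = 0 at h
  rw [neg_neg, neg_neg] at h
  exact h

theorem isLower_invCMinus_sub_one (V : Rep p) : IsLower V.grading 1 (invCMinus p V - 1) :=
  (isLower_expoF V).qInvExp_sub_one p

theorem isUnipotentLower_elemCMinus : IsUnipotentLower (elemCMinus p) := by
  have hn : ∀ V : Rep p, IsNilpotent (invCMinus p V - 1) := fun V =>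
    (isLower_invCMinus_sub_one V).isNilpotent
  rw [elemCMinus_eq]
  refine isUnipotentLower_of_isLower
    (isNatural1_inverse (isNatural1_exp1 (isNatural1_funH_mul_gen _ _) isNilpotent_expoF) hn)
    (isNuRational1_inverse (isNuRational1_exp1 (isNuRational1_funH_mul_gen
      (fun _ => xq_mem_powSubfield _ _) _)) hn) fun V => ?_
  rw [inverse_apply (isUnit_fam hn)]
  exact (isLower_invCMinus_sub_one V).inverse_sub_one

theorem isUnipotentLower_elemMMinus : IsUnipotentLower (elemMMinus p) :=
  isUnipotentLower_of_isLower isNatural1_elemMMinus isNuRational1_elemMMinus isLower_elemMMinus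

theorem isCartan_one : IsCartan (1 : Fam1 p) :=
  ⟨isNatural1_one, fun _ _ => ⟨1, one_mul _⟩⟩

theorem isGaussProduct_elemM :
    IsGaussProduct 1 (elemCPlus p) (elemCMinus p) (elemM p) :=
  ⟨isCartan_one, isUnipotentUpper_elemCPlus, isUnipotentLower_elemCMinus, elemCPlus p,
    elemMMinus p, isUnipotentUpper_elemCPlus, isUnipotentLower_elemMMinus,
    isInfiniteProduct_elemCPlus, isInfiniteProduct_elemMMinus, by rw [one_mul, elemM]⟩

theorem isNatural1_elemM : IsNatural1 (elemM p) :=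
  isNatural1_mul (isNatural1_inverse isNatural1_elemMMinus isNilpotent_elemMMinus)
    isUnipotentUpper_elemCPlus.1

theorem isAlmostNuRational_elemM : IsAlmostNuRational (elemM p) := by
  refine ⟨isNatural1_elemM, 1, isCartan_one, isUnit_one, ?_, fun V W => ?_⟩
  · rw [Ring.inverse_one, one_mul]
    exact isNuRational1_mul (isNuRational1_inverse isNuRational1_elemMMinus isNilpotent_elemMMinus)
      isUnipotentUpper_elemCPlus.2.1
  · have h : coboundary (1 : Fam2 p) (1 : Fam1 p) = 1 := by
      rw [coboundary, leg2_one, leg1Shift_one, Ring.inverse_one, mul_one, mul_one, mul_one]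
      rfl
    rw [h]
    exact one_mem _

theorem isStrongSolution_elemM : IsStrongSolution (elemM p) := by
  refine ⟨⟨isUnit_elemM, isAlmostNuRational_elemM, ?_, ?_,
    satisfiesQDCE_elemM isNatural1_elemM, ?_⟩, ?_⟩
  all_goals rw [coboundary_elemM_eq_standardF]
  · exact isUnit_standardF
  · exact isZeroWeight_standardF
  · exact dynR_standardF
  · exact isStandardSolution_standardF

end Solution

end DynCoboundary

end

theorem mainTheorem4 (p : DynCoboundary.QParam) :
    ∃ M : DynCoboundary.Fam1 p,
      DynCoboundary.IsGaussProduct 1 (DynCoboundary.elemCPlus p) (DynCoboundary.elemCMinus p) M ∧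
      DynCoboundary.IsStrongSolution M :=
  ⟨DynCoboundary.elemM p, DynCoboundary.isGaussProduct_elemM, DynCoboundary.isStrongSolution_elemM⟩
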